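/- **Setting.** Let $P$ be a Borel probability measure on a topological space $\mathcal Z$, $\Phi:\mathcal Z\to\bar{\mathcal Z}\subset\mathbb R^{d_l}$ continuous, with $\Phi(\mathbf z)$, $\mathbf z\sim P$, supported on a bounded set. Let $\bar k_z$ be a bounded kernel on $\bar{\mathcal Z}$ whose integral operator on $L_2(\Phi_\#P)$ has nonincreasing eigenvalues $\lambda_i\le K i^{-(\bar b+1)}$, $\bar b>0$, and such that $\bar g\sim\mathcal{GP}(0,\bar k_z)$ (a jointly measurable version) has finite $L_\infty$ norm almost surely. Put $k_z(z,z')=\bar k_z(\Phi(z),\Phi(z'))$, let $\mathcal I$ be its RKHS, and let $g=\bar g\circ\Phi\sim\mathcal{GP}(0,k_z)$. $\|\cdot\|_2$ is the norm of $L_2(P)$, and $\mathrm{Proj}_{r}$ is the $L_2(P)$-orthogonal projection onto the span of the top $r$ Mercer eigenfunctions of $k_z$ with respect to $P$; $\|h\|_{\mathcal I}$ for $h\in L_2(P)$ is the smallest $\mathcal I$-norm of a representative of $h$ in $\mathcal I$. *Regression oracle.* A measurable procedure maps $n_1$ iid replications of $(\mathbf z,g(\mathbf z)+\mathbf e)$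 (iid given the draw), where $\mathbf z\sim P$, $\mathbb E(\mathbf e\mid\mathbf z)=0$ and $g(\mathbf z)+\mathbf e$ is sub-Gaussian, to an estimate $\hat g$, and $\mathbb E_{g\sim\mathcal{GP}(0,k_z)}\mathbb E_{\mathcal D^{(n_1)}}\|\hat g-g\|_2^2\le\xi_{n_1}^2$ for all $n_1$, where $0\le\xi_{n_1}\to0$. *Learned space.* Let $m=m(n_1)$, $m'=[m/2]$, and suppose that the top $m'$ Mercer eigenvalues of $k_z$ are positive, so that the top $m'$ Mercer eigenfunctions exist. Let $g^{(1)},\dots,g^{(m)}$ be iid draws from $\mathcal{GP}(0,k_z)$. Let $\mathcal D^{(n_1)}=\{(\tilde z_i,g^{(j)}(\tilde z_i)+\epsilon^{(j)}_i):i\le n_1,j\le m\}$ be a dataset with shared inputs whose $j$-th part, given the $j$-th draw, consists of iid observations as above; the noise of different draws may be dependent. Let $\hat g^{(j)}$ be the oracle's estimate from the $j$-th part truncated to $\min\{C_k\log n_1,\cdot\}$, where $C_k>0$ is any constant. Let $\tilde{\mathcal I}=\{\sum_j\theta_j\hat g^{(j)}:\theta\in\mathbb R^m\}$ with norm $\sqrt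 m\,\|\theta\|_2$. **Claim.** There is a universal constant $c_r>0$ such that in every such setting there are events determined by the $m$ draws and $\mathcal D^{(n_1)}$, with probability tending to $1$ as $n_1\to\infty$, on which there is a measurable map $g^*\in L_2(P)\mapsto\tilde g^*\in\tilde{\mathcal I}$ with $$\|\tilde g^*\|_{\tilde{\mathcal I}}\le c_r\|\mathrm{Proj}_{m'}g^*\|_{\mathcal I}\quad\text{for all }g^*\in L_2(P),$$ $$\mathbb E_{g^*\sim\mathcal{GP}(0,k_z)}\|\tilde g^*-g^*\|_2\le\mathbb E_{g^*\sim\mathcal{GP}(0,k_z)}\Big[c_r\|\mathrm{Proj}_{m'}g^*\|_{\mathcal I}\big(m^{-1/2}\xi_{n_1}+m^{-(\bar b+1)/2}\big)\sqrt{\log n_1}+\|g^*-\mathrm{Proj}_{m'}g^*\|_2\Big].$$ In particular, for $m=[n_1^{1/(\bar b+1)}]$, on these events $$\mathbb E_{g^*\sim\mathcal{GP}(0,k_z)}\|\tilde g^*-g^*\|_2=\tilde O\big(\xi_{n_1}+n_1^{-\bar b/(2(\bar b+1))}\big),$$ that is, for all $n_1\ge2$ it is at most $C(\log n_1)^q\big(\xi_{n_1}+n_1^{-\bar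 b/(2(\bar b+1))}\big)$ with $C,q$ that depend only on the kernel setting (not on $n_1$, the oracle, $\xi$, $C_k$ or the noise). -/

import Mathlib

open MeasureTheory ProbabilityTheory Filter Topology
open scoped NNReal ENNReal RealInnerProductSpace

noncomputable section

/-- `g` (sample points `u`, index `x`) is a version of the centred Gaussian process `GP(0, k)`,
jointly measurable in the sample point and the index. -/
structure IsCenteredGP {U X : Type*} [MeasurableSpace U] [MeasurableSpace X]
    (μ : Measure U) (k : X → X → ℝ) (g : U → X → ℝ) : Prop where
  measurable : Measurable (Function.uncurry g)
  gaussian : IsGaussianProcess (fun x u => g u x) μ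
  mean : ∀ x, ∫ u, g u x ∂μ = 0
  cov : ∀ x y, ∫ u, g u x * g u y ∂μ = k x y

/-- `(lam, psi)` is a Mercer eigensystem of the kernel `k` with respect to `P`: the integral
operator `f ↦ ∫ k(·, y) f(y) P(dy)` on `L²(P)` equals `∑ i, lam i • ⟪psi i, ·⟫ • psi i`, where the
eigenvalues are listed in nonincreasing order, with multiplicity (a finite list is padded with
zeros), and the eigenfunctions that belong to positive eigenvalues are orthonormal.
Indices start at `0`. -/
structure IsMercerSystem {X : Type*} [MeasurableSpace X] (P : Measure X) (k : X → X → ℝ)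
    (lam : ℕ → ℝ) (psi : ℕ → Lp ℝ 2 P) : Prop where
  nonneg : ∀ i, 0 ≤ lam i
  antitone : Antitone lam
  orthonormal : Orthonormal ℝ (fun i : {i : ℕ // 0 < lam i} => psi i)
  expansion : ∀ f : Lp ℝ 2 P, ∃ Tf : Lp ℝ 2 P,
    (Tf =ᵐ[P] fun x => ∫ y, k x y * f y ∂P) ∧
      HasSum (fun i => (lam i * ⟪psi i, f⟫) • psi i) Tf

/-- The projection onto the span of the top `r` eigenfunctions `psi 0, …, psi (r - 1)`. -/
def mercerProj {X : Type*} [MeasurableSpace X] {P : Measure X} (psi : ℕ → Lp ℝ 2 P) (r : ℕ)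
    (f : Lp ℝ 2 P) : Lp ℝ 2 P :=
  ∑ i ∈ Finset.range r, ⟪psi i, f⟫ • psi i

/-- The norm, in the reproducing kernel Hilbert space `H` of functions on `X`, of an element `h`
of `L²(P)` that has a representative in `H` (the smallest norm of such a representative). -/
def rkhsNorm {X : Type*} [MeasurableSpace X] (P : Measure X) (H : Type*) [NormedAddCommGroup H]
    [InnerProductSpace ℝ H] [RKHS ℝ H X ℝ] (h : Lp ℝ 2 P) : ℝ :=
  sInf {t : ℝ | ∃ F : H, (⇑F =ᵐ[P] ⇑h) ∧ t = ‖F‖}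

open Classical in
/-- The `L²(P)` class of a function (used only for functions that are square integrable). -/
def toL2 {X : Type*} [MeasurableSpace X] (P : Measure X) (f : X → ℝ) : Lp ℝ 2 P :=
  if hf : MemLp f 2 P then hf.toLp f else 0

/-- `n` independent draws from `Q u`, as a Markov kernel in `u`. -/
def iidKernel {U X : Type*} [MeasurableSpace U] [MeasurableSpace X] (Q : Kernel U X)
    [IsMarkovKernel Q] (n : ℕ) : Kernel U (Fin n → X) where
  toFun u := Measure.pi fun _ => Q u
  measurable' := by
    refine Measurable.measure_of_isPiSystem_of_isProbabilityMeasure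
      (generateFrom_pi (α := fun _ : Fin n => X)).symm isPiSystem_pi ?_
    rintro _ ⟨s, hs, rfl⟩
    simp only [Measure.pi_pi]
    exact Finset.measurable_prod _ fun i _ => Q.measurable_coe (hs i (Set.mem_univ i))

/-- The observation model. Given the sample point `u` (which determines the regression function
`g u`), one observation `(z, y)` with `y = g u z + e` has law `Q u`: its input `z` has law `P`, and
the noise `e` satisfies `E(e | z) = 0`. Averaged over `u`, the response is sub-Gaussian with
variance proxy `s`. -/
structure IsNoisyObservation {U Z : Type*} [MeasurableSpace U] [MeasurableSpace Z]
    (P : Measure Z) (μ : Measure U) (g : U → Z → ℝ) (Q : Kernel U (Z × ℝ)) (s : ℝ≥0) : Prop where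
  input : ∀ᵐ u ∂μ, (Q u).map Prod.fst = P
  noise_integrable : ∀ᵐ u ∂μ, Integrable (fun p : Z × ℝ => p.2 - g u p.1) (Q u)
  noise_mean : ∀ᵐ u ∂μ,
    (Q u)[fun p : Z × ℝ => p.2 - g u p.1 | MeasurableSpace.comap Prod.fst inferInstance]
      =ᵐ[Q u] 0
  subgaussian : HasSubgaussianMGF (fun p : Z × ℝ => p.2) s (μ.bind Q)

/-- The mean squared error `E_{g ~ GP} E_D ‖A(D) - g‖₂²` of a regression procedure `A` that is
given `n` independent noisy observations of `g`. -/
def oracleRisk {U Z : Type*} [MeasurableSpace U] [MeasurableSpace Z]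
    (P : Measure Z) (μ : Measure U) (g : U → Z → ℝ) (Q : Kernel U (Z × ℝ)) [IsMarkovKernel Q]
    (n : ℕ) (A : (Fin n → Z × ℝ) → Z → ℝ) : ℝ≥0∞ :=
  ∫⁻ u, ∫⁻ D, eLpNorm (fun z => A D z - g u z) 2 P ^ 2 ∂(iidKernel Q n u) ∂μ

/-- A shared dataset consists of `n` inputs, each with one response for every one of the `m`
draws. -/
abbrev SharedData (Z : Type*) (m n : ℕ) : Type _ := Fin n → Z × (Fin m → ℝ)

/-- The part of a shared dataset that belongs to the `j`-th draw. -/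
def SharedData.task {Z : Type*} {m n : ℕ} (D : SharedData Z m n) (j : Fin m) : Fin n → Z × ℝ :=
  fun i => ((D i).1, (D i).2 j)

/-- `ν` is the joint law of `m` independent prior draws and a shared dataset, such that for each
`j`, given the `j`-th draw, the `j`-th part of the dataset consists of `n` independent
observations from the model `Q`. The dependence between the noise terms of different draws is
arbitrary. -/
structure IsSharedSample {U Z : Type*} [MeasurableSpace U] [MeasurableSpace Z]
    (μ : Measure U) (Q : Kernel U (Z × ℝ)) [IsMarkovKernel Q] {m n : ℕ}
    (ν : Measure ((Fin m → U) × SharedData Z m n)) : Prop where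
  draws : ν.map Prod.fst = Measure.pi fun _ => μ
  data : ∀ j, ν.map (fun p => (p.1 j, SharedData.task p.2 j)) = μ ⊗ₘ iidKernel Q n

/-- The truncated estimates `min {Ck log n, A(D_j)}`, `j = 1, …, m`. They span the learned
space, whose elements are `z ↦ ∑ j, θ j * truncEst A Ck D j z`. -/
def truncEst {Z : Type*} {m n : ℕ} (A : (Fin n → Z × ℝ) → Z → ℝ) (Ck : ℝ)
    (D : SharedData Z m n) (j : Fin m) (z : Z) : ℝ :=
  min (Ck * Real.log n) (A (D.task j) z)

/-- The element of the learned space with coefficient vector `θ`. -/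
def learnedFun {Z : Type*} {m : ℕ} (G : Fin m → Z → ℝ) (θ : EuclideanSpace ℝ (Fin m)) (z : Z) :
    ℝ :=
  ∑ j, θ j * G j z

/-- The norm `√m ‖θ‖₂` on the learned space. -/
def learnedNorm {m : ℕ} (θ : EuclideanSpace ℝ (Fin m)) : ℝ := √(m : ℝ) * ‖θ‖

/-- The approximation error bound
`c ‖Proj f‖_H (x + m ^ (-(b + 1) / 2)) √(log n) + ‖f - Proj f‖₂`, where `Proj` is the projection
onto the top `[m / 2]` eigenfunctions and `x` is the contribution of the regression oracle. -/
def approxBound {Z : Type*} [MeasurableSpace Z] (P : Measure Z) (H : Type*)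
    [NormedAddCommGroup H] [InnerProductSpace ℝ H] [RKHS ℝ H Z ℝ] (psi : ℕ → Lp ℝ 2 P)
    (c b : ℝ) (m n : ℕ) (x : ℝ) (f : Lp ℝ 2 P) : ℝ :=
  c * rkhsNorm P H (mercerProj psi (m / 2) f) * (x + (m : ℝ) ^ (-(b + 1) / 2)) * √(Real.log n)
    + ‖f - mercerProj psi (m / 2) f‖

/-- The average error `E_{g* ~ GP} ‖g̃* - g*‖₂` when `g*` is approximated by the element of the
learned space with coefficient vector `Θ g*`. -/
def avgError {U Z : Type*} [MeasurableSpace U] [MeasurableSpace Z] (P : Measure Z) (μ : Measure U)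
    (g : U → Z → ℝ) {m : ℕ} (G : Fin m → Z → ℝ) (Θ : Lp ℝ 2 P → EuclideanSpace ℝ (Fin m)) :
    ℝ≥0∞ :=
  ∫⁻ u, eLpNorm (fun z => learnedFun G (Θ (toL2 P (g u))) z - g u z) 2 P ∂μ

end

noncomputable section
set_option linter.unusedSectionVars false

/-! ### Inner products of a jointly measurable Gaussian process with square integrable functions -/

namespace IsCenteredGP

variable {U Z : Type*} [MeasurableSpace U] [MeasurableSpace Z] {μ : Measure U}
  [IsProbabilityMeasure μ] {P : Measure Z} [IsProbabilityMeasure P] {k : Z → Z → ℝ}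
  {g : U → Z → ℝ} {B : ℝ}

/-! Everything is read off from the standardized Mercer coefficients `⟪psi i, g⟫ / √(lam i)` of a
path. For `i < r` they form a standard Gaussian vector, and the Euclidean norm of that vector is the
RKHS norm of the projected path (`rkhsNorm_mercerProj`). The `m` draws thus become independent
standard Gaussian vectors `a_j`. To approximate a fresh path `g*` with coefficient vector `a*`,
solve `∑ θ_j a_j = a*` and apply the same weights `θ` to the estimates `ĝ_j`.

With `r = m / 128`, a net argument (`pi_measure_exists_weak_le`) shows that, up to an exponentially
small probability, every direction is seen at constant strength by three quarters of the `a_j`.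
Hence a quarter of the draws may be discarded, namely those whose paths exceed the truncation level;
on the others truncation cannot increase the error. The surviving vectors satisfy `∑ ⟪x, a_j⟫² ≥ s²
‖x‖²` with `s` of order `√m`. So `θ` can be chosen linear in `g*` with `‖θ‖ ≤ s⁻¹ ‖a*‖`, which is
the norm bound.

For the error, write `∑ θ_j ĝ_j - g* = ∑ θ_j (ĝ_j - Proj_r g_j) - (g* - Proj_r g*)`. Since `a*` is
white, the mean square of the first sum is a squared Hilbert-Schmidt norm, at most `s⁻² ∑ ‖ĝ_j -
Proj_r g_j‖²` (`exists_coefficients_avgError_le`). This is a sum over the draws, so Markov's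
inequality needs only the risk of each single estimate, and dependence between the noises is
harmless. Its mean is of order `m (ξ² + m ^ (-b))`, where the second term is the eigenvalue tail.
The average error is therefore of order `(ξ + m ^ (-b / 2)) √(log n)`.

The claimed bound is itself an average over `g*`, and `E ‖Proj_{m/2} g*‖_H` is at least a constant
times `√m`. So it dominates the previous expression, and the loss from `m / 2` to `m / 128` is
absorbed in the constant. If `m` grows so slowly that `m ^ (b + 1) ≤ √(log n)`, concentration is
unavailable, but then `θ = 0` already meets the bound (`exists_event_of_few_draws`). -/

lemma measurable_path (hg : IsCenteredGP μ k g) (u : U) : Measurable (g u) :=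
  hg.measurable.of_uncurry_left

lemma comp_measurable {Y : Type*} [MeasurableSpace Y] (hg : IsCenteredGP μ k g) {φ : Y → Z}
    (hφ : Measurable φ) : IsCenteredGP μ (fun x y => k (φ x) (φ y)) (fun u y => g u (φ y)) where
  measurable := hg.measurable.comp (measurable_fst.prodMk (hφ.comp measurable_snd))
  gaussian := hg.gaussian.comp_right φ
  mean x := hg.mean (φ x)
  cov x y := hg.cov (φ x) (φ y)

lemma memLp_eval (hg : IsCenteredGP μ k g) (x : Z) : MemLp (fun u => g u x) 2 μ :=
  (hg.gaussian.hasGaussianLaw_eval x).memLp_two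

lemma integrable_mul (hg : IsCenteredGP μ k g) (x y : Z) :
    Integrable (fun u => g u x * g u y) μ :=
  (hg.memLp_eval x).integrable_mul (hg.memLp_eval y)

lemma measurable_kernel (hg : IsCenteredGP μ k g) : Measurable (Function.uncurry k) := by
  have h : StronglyMeasurable (fun p : Z × Z => ∫ u, g u p.1 * g u p.2 ∂μ) := by
    refine StronglyMeasurable.integral_prod_right' (f := fun q : (Z × Z) × U =>
      g q.2 q.1.1 * g q.2 q.1.2) (Measurable.stronglyMeasurable ?_)
    exact (hg.measurable.comp (measurable_snd.prodMk (measurable_fst.comp measurable_fst))).mul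
      (hg.measurable.comp (measurable_snd.prodMk (measurable_snd.comp measurable_fst)))
  convert h.measurable using 2 with p
  exact (hg.cov p.1 p.2).symm

lemma lintegral_sq_eval (hg : IsCenteredGP μ k g) (x : Z) :
    ∫⁻ u, ‖g u x‖ₑ ^ 2 ∂μ = ENNReal.ofReal (k x x) := by
  rw [← hg.cov x x, ofReal_integral_eq_lintegral_ofReal (hg.integrable_mul x x)
    (ae_of_all _ fun u => mul_self_nonneg _)]
  refine lintegral_congr fun u => ?_
  rw [← ofReal_norm, ← ENNReal.ofReal_pow (norm_nonneg _), Real.norm_eq_abs, sq_abs, sq]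

lemma lintegral_sq_path (hg : IsCenteredGP μ k g) :
    ∫⁻ u, (∫⁻ z, ‖g u z‖ₑ ^ 2 ∂P) ∂μ = ∫⁻ z, ENNReal.ofReal (k z z) ∂P := by
  rw [lintegral_lintegral_swap]
  · exact lintegral_congr fun z => hg.lintegral_sq_eval z
  · exact (hg.measurable.enorm.pow_const 2).aemeasurable

lemma lintegral_sq_path_le (hg : IsCenteredGP μ k g) (hk : ∀ x y, |k x y| ≤ B) :
    ∫⁻ u, (∫⁻ z, ‖g u z‖ₑ ^ 2 ∂P) ∂μ ≤ ENNReal.ofReal B := by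
  rw [hg.lintegral_sq_path]
  calc ∫⁻ z, ENNReal.ofReal (k z z) ∂P ≤ ∫⁻ _, ENNReal.ofReal B ∂P :=
        lintegral_mono fun z => ENNReal.ofReal_le_ofReal ((le_abs_self _).trans (hk z z))
    _ = ENNReal.ofReal B := by simp

lemma ae_memLp_path (hg : IsCenteredGP μ k g) (hk : ∀ x y, |k x y| ≤ B) :
    ∀ᵐ u ∂μ, MemLp (g u) 2 P := by
  have hm : Measurable fun u => ∫⁻ z, ‖g u z‖ₑ ^ 2 ∂P :=
    (hg.measurable.enorm.pow_const 2).lintegral_prod_right'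
  have := ae_lt_top hm ((hg.lintegral_sq_path_le (P := P) hk).trans_lt ENNReal.ofReal_lt_top).ne
  filter_upwards [this] with u hu
  refine ⟨(hg.measurable_path u).aestronglyMeasurable, ?_⟩
  rw [eLpNorm_lt_top_iff_lintegral_rpow_enorm_lt_top two_ne_zero ENNReal.ofNat_ne_top]
  simpa using hu

/-- This is the Fubini hypothesis behind all covariance computations. The bound `|g x g y| ≤ (g x² +
g y²) / 2` integrates over the sample points to at most `B`, because the kernel is bounded on the
diagonal. -/
lemma integrable_triple (hg : IsCenteredGP μ k g) (hk : ∀ x y, |k x y| ≤ B) (f h : Lp ℝ 2 P) :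
    Integrable (fun q : U × (Z × Z) => (g q.1 q.2.1 * f q.2.1) * (g q.1 q.2.2 * h q.2.2))
      (μ.prod (P.prod P)) := by
  have hf := (Lp.memLp f).integrable one_le_two
  have hh := (Lp.memLp h).integrable one_le_two
  have hfm := (Lp.stronglyMeasurable f).measurable
  have hhm := (Lp.stronglyMeasurable h).measurable
  have hgm := hg.measurable
  have m1 : Measurable fun q : U × (Z × Z) => g q.1 q.2.1 :=
    hgm.comp (measurable_fst.prodMk (measurable_fst.comp measurable_snd))
  have m2 : Measurable fun q : U × (Z × Z) => g q.1 q.2.2 :=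
    hgm.comp (measurable_fst.prodMk (measurable_snd.comp measurable_snd))
  have hm : AEStronglyMeasurable
      (fun q : U × (Z × Z) => (g q.1 q.2.1 * f q.2.1) * (g q.1 q.2.2 * h q.2.2))
      (μ.prod (P.prod P)) := by
    refine Measurable.aestronglyMeasurable ?_
    exact (m1.mul (hfm.comp (measurable_fst.comp measurable_snd))).mul
      (m2.mul (hhm.comp (measurable_snd.comp measurable_snd)))
  rw [integrable_prod_iff' hm]
  constructor
  · refine ae_of_all _ fun p => ?_
    have := (hg.integrable_mul p.1 p.2).mul_const (f p.1 * h p.2)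
    exact this.congr (ae_of_all _ fun u => by ring)
  · refine Integrable.mono' (g := fun p : Z × Z => B * (‖f p.1‖ * ‖h p.2‖))
      ((hf.norm.mul_prod hh.norm).const_mul B) ?_ (ae_of_all _ fun p => ?_)
    · exact hm.norm.prod_swap.integral_prod_right'
    · rw [Real.norm_of_nonneg (integral_nonneg fun _ => norm_nonneg _)]
      have h1 : ∀ u, ‖(g u p.1 * f p.1) * (g u p.2 * h p.2)‖
          ≤ (g u p.1 * g u p.1 + g u p.2 * g u p.2) / 2 * (‖f p.1‖ * ‖h p.2‖) := fun u => by
        rw [show (g u p.1 * f p.1) * (g u p.2 * h p.2) = (g u p.1 * g u p.2) * (f p.1 * h p.2) by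
          ring, norm_mul, norm_mul (f p.1)]
        gcongr
        rw [norm_mul, Real.norm_eq_abs, Real.norm_eq_abs]
        nlinarith [sq_nonneg (|g u p.1| - |g u p.2|), abs_mul_abs_self (g u p.1),
          abs_mul_abs_self (g u p.2)]
      have hint : Integrable (fun u => (g u p.1 * g u p.1 + g u p.2 * g u p.2) / 2 *
          (‖f p.1‖ * ‖h p.2‖)) μ :=
        (((hg.integrable_mul _ _).add (hg.integrable_mul _ _)).div_const 2).mul_const _
      refine (integral_mono_of_nonneg (ae_of_all _ fun _ => norm_nonneg _) hint
        (ae_of_all _ h1)).trans ?_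
      rw [integral_mul_const, integral_div, integral_add (hg.integrable_mul _ _)
        (hg.integrable_mul _ _), hg.cov, hg.cov]
      gcongr
      linarith [le_abs_self (k p.1 p.1), le_abs_self (k p.2 p.2), hk p.1 p.1, hk p.2 p.2]

/-- The coefficient `∫ g f dP` of a path of the process. -/
lemma measurable_coeff (hg : IsCenteredGP μ k g) (f : Lp ℝ 2 P) :
    Measurable fun u => ∫ z, g u z * f z ∂P := by
  refine (StronglyMeasurable.integral_prod_right' (f := fun q : U × Z => g q.1 q.2 * f q.2)
    (Measurable.stronglyMeasurable ?_)).measurable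
  exact hg.measurable.mul ((Lp.stronglyMeasurable f).measurable.comp measurable_snd)

lemma coeff_mul_coeff (f h : Lp ℝ 2 P) (u : U) :
    (∫ z, g u z * f z ∂P) * (∫ z, g u z * h z ∂P) =
      ∫ p : Z × Z, (g u p.1 * f p.1) * (g u p.2 * h p.2) ∂(P.prod P) :=
  (integral_prod_mul (fun z => g u z * f z) (fun z => g u z * h z)).symm

lemma integrable_coeff_mul (hg : IsCenteredGP μ k g) (hk : ∀ x y, |k x y| ≤ B)
    (f h : Lp ℝ 2 P) :
    Integrable (fun u => (∫ z, g u z * f z ∂P) * (∫ z, g u z * h z ∂P)) μ := by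
  simp_rw [coeff_mul_coeff]
  exact (hg.integrable_triple hk f h).integral_prod_left

lemma integral_coeff_mul (hg : IsCenteredGP μ k g) (hk : ∀ x y, |k x y| ≤ B)
    (f h : Lp ℝ 2 P) :
    ∫ u, (∫ z, g u z * f z ∂P) * (∫ z, g u z * h z ∂P) ∂μ =
      ∫ x, (∫ y, k x y * f y ∂P) * h x ∂P := by
  simp_rw [coeff_mul_coeff]
  have hI := hg.integrable_triple hk h f
  -- The factors are swapped so that `h` sits on the outer variable, as on the right-hand side.
  have e : ∀ u, ∫ p : Z × Z, (g u p.1 * f p.1) * (g u p.2 * h p.2) ∂(P.prod P) =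
      ∫ p : Z × Z, (g u p.1 * h p.1) * (g u p.2 * f p.2) ∂(P.prod P) := fun u => by
    rw [← coeff_mul_coeff, ← coeff_mul_coeff, mul_comm]
  simp_rw [e]
  rw [integral_integral_swap (f := fun u (p : Z × Z) => (g u p.1 * h p.1) * (g u p.2 * f p.2)) hI]
  have e2 : ∀ p : Z × Z, ∫ u, (g u p.1 * h p.1) * (g u p.2 * f p.2) ∂μ =
      k p.1 p.2 * f p.2 * h p.1 := fun p => by
    rw [← hg.cov p.1 p.2, mul_assoc, ← integral_mul_const]
    congr 1; ext u; ring
  have hI2 := hI.integral_prod_right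
  simp only [e2] at hI2 ⊢
  rw [integral_prod _ hI2]
  congr 1; ext x
  rw [← integral_mul_const]

lemma coeff_eq_inner {u : U} (hu : MemLp (g u) 2 P) (f : Lp ℝ 2 P) :
    ∫ z, g u z * f z ∂P = ⟪f, toL2 P (g u)⟫ := by
  rw [toL2, dif_pos hu, L2.inner_def]
  refine integral_congr_ae ?_
  filter_upwards [hu.coeFn_toLp] with z hz
  rw [hz]; simp

end IsCenteredGP

/-- An almost sure limit of centred Gaussian variables is centred Gaussian. -/
lemma exists_map_eq_gaussianReal_of_tendsto {U : Type*} [MeasurableSpace U] {μ : Measure U}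
    [IsProbabilityMeasure μ] {Y : ℕ → U → ℝ} {X : U → ℝ} (hX : Measurable X)
    (hY : ∀ n, Measurable (Y n)) (hG : ∀ n, ∃ v : ℝ≥0, μ.map (Y n) = gaussianReal 0 v)
    (hlim : ∀ᵐ u ∂μ, Tendsto (fun n => Y n u) atTop (𝓝 (X u))) :
    ∃ v : ℝ≥0, μ.map X = gaussianReal 0 v := by
  choose v hv using hG
  have hcf : ∀ {W : U → ℝ}, Measurable W → ∀ t : ℝ,
      charFun (μ.map W) t = ∫ u, Complex.exp (t * W u * Complex.I) ∂μ := fun {W} hW t => by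
    rw [charFun_apply_real, integral_map hW.aemeasurable]
    exact (by fun_prop : Continuous fun x : ℝ => Complex.exp (t * x * Complex.I)).aestronglyMeasurable
  have hconv : ∀ t : ℝ, Tendsto (fun n => charFun (μ.map (Y n)) t) atTop
      (𝓝 (charFun (μ.map X) t)) := fun t => by
    simp_rw [hcf (hY _), hcf hX]
    refine tendsto_integral_of_dominated_convergence (fun _ => 1) (fun n => ?_)
      (integrable_const 1) (fun n => ae_of_all _ fun u => ?_) ?_
    · exact (by have := hY n; fun_prop :
        Measurable fun u => Complex.exp (t * Y n u * Complex.I)).aestronglyMeasurable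
    · rw [← Complex.ofReal_mul, Complex.norm_exp_ofReal_mul_I]
    · filter_upwards [hlim] with u hu
      have hc : Continuous fun x : ℝ => Complex.exp (t * x * Complex.I) := by fun_prop
      exact (hc.tendsto _).comp hu
  -- the real numbers `exp (- v n / 2)` determine the characteristic functions
  have hform : ∀ (n : ℕ) (t : ℝ), charFun (μ.map (Y n)) t =
      ((Real.exp (-(v n : ℝ) / 2) ^ (t ^ 2) : ℝ) : ℂ) := fun n t => by
    rw [hv, charFun_gaussianReal, ← Real.exp_mul]
    push_cast
    congr 1
    ring
  obtain ⟨c, hc⟩ : ∃ c : ℝ, Tendsto (fun n => Real.exp (-(v n : ℝ) / 2)) atTop (𝓝 c) := by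
    refine ⟨(charFun (μ.map X) 1).re, ?_⟩
    have h1 := (Complex.continuous_re.tendsto _).comp (hconv 1)
    refine h1.congr fun n => ?_
    rw [Function.comp_apply, hform, Complex.ofReal_re]
    simp
  have hc0 : 0 ≤ c := ge_of_tendsto' hc fun n => (Real.exp_pos _).le
  have hc1 : c ≤ 1 := le_of_tendsto' hc fun n => by
    rw [Real.exp_le_one_iff]; have := (v n).2; simp only [NNReal.val_eq_coe] at this; linarith
  have hXform : ∀ t : ℝ, charFun (μ.map X) t = ((c ^ (t ^ 2) : ℝ) : ℂ) := fun t => by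
    refine tendsto_nhds_unique (hconv t) ?_
    simp_rw [hform]
    exact (Complex.continuous_ofReal.tendsto _).comp
      ((Real.continuousAt_rpow_const _ _ (Or.inr (sq_nonneg t))).tendsto.comp hc)
  have hprob : IsProbabilityMeasure (μ.map X) := Measure.isProbabilityMeasure_map hX.aemeasurable
  -- The case `c = 0` means that the variances diverge. The limiting characteristic function would
  -- then vanish off the origin, contradicting its continuity at `0`.
  have hcpos : 0 < c := by
    refine lt_of_le_of_ne hc0 fun h0 => ?_
    have hcont : Tendsto (fun n : ℕ => charFun (μ.map X) (1 / ((n : ℝ) + 1))) atTop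
        (𝓝 (charFun (μ.map X) 0)) := by
      simp_rw [hcf hX]
      refine tendsto_integral_of_dominated_convergence (fun _ => 1) (fun n => ?_)
        (integrable_const 1) (fun n => ae_of_all _ fun u => ?_) (ae_of_all _ fun u => ?_)
      · exact (by fun_prop : Measurable fun u =>
          Complex.exp ((1 / ((n : ℝ) + 1) : ℝ) * X u * Complex.I)).aestronglyMeasurable
      · rw [← Complex.ofReal_mul, Complex.norm_exp_ofReal_mul_I]
      · have hc : Continuous fun s : ℝ => Complex.exp (s * X u * Complex.I) := by fun_prop
        exact (hc.tendsto _).comp tendsto_one_div_add_atTop_nhds_zero_nat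
    have hz : ∀ n : ℕ, charFun (μ.map X) (1 / ((n : ℝ) + 1)) = 0 := fun n => by
      rw [hXform, ← h0, Real.zero_rpow (by positivity)]; simp
    simp_rw [hz] at hcont
    have := tendsto_nhds_unique hcont tendsto_const_nhds
    rw [charFun_zero] at this
    simp at this
  refine ⟨(-2 * Real.log c).toNNReal, Measure.ext_of_charFun ?_⟩
  ext t
  have hl : 0 ≤ -2 * Real.log c := by have := Real.log_nonpos hc0 hc1; linarith
  rw [hXform, charFun_gaussianReal, Real.rpow_def_of_pos hcpos, Real.coe_toNNReal _ hl]
  push_cast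
  congr 1
  ring

/-- The strong law of large numbers on the product space. -/
lemma ae_tendsto_average {Z : Type*} [MeasurableSpace Z] {P : Measure Z} [IsProbabilityMeasure P]
    {h : Z → ℝ} (hm : Measurable h) (hint : Integrable h P) :
    ∀ᵐ ω ∂(Measure.infinitePi fun _ : ℕ => P),
      Tendsto (fun n : ℕ => (n : ℝ)⁻¹ • ∑ i ∈ Finset.range n, h (ω i)) atTop (𝓝 (∫ z, h z ∂P)) := by
  have hmp := fun i => measurePreserving_eval_infinitePi (fun _ : ℕ => P) i
  have key := strong_law_ae (μ := Measure.infinitePi fun _ : ℕ => P)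
    (fun (i : ℕ) (ω : ℕ → Z) => h (ω i)) ((hmp 0).integrable_comp_of_integrable hint)
    (fun i j hij => (iIndepFun_infinitePi (P := fun _ : ℕ => P) (X := fun _ z => h z)
        fun _ => hm).indepFun hij)
    (fun i => ⟨(hm.comp (measurable_pi_apply i)).aemeasurable,
      (hm.comp (measurable_pi_apply 0)).aemeasurable, by
        have e : ∀ i, (Measure.infinitePi fun _ : ℕ => P).map (fun ω : ℕ → Z => h (ω i)) =
            P.map h := fun i => by
          conv_rhs => rw [← (hmp i).map_eq, Measure.map_map hm (measurable_pi_apply i)]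
          rfl
        rw [e, e]⟩)
  have e : ∫ ω, h (ω 0) ∂(Measure.infinitePi fun _ : ℕ => P) = ∫ z, h z ∂P := by
    conv_rhs => rw [← (hmp 0).map_eq, integral_map (measurable_pi_apply 0).aemeasurable
      hm.aestronglyMeasurable]
  rwa [e] at key

namespace IsCenteredGP

variable {U Z : Type*} [MeasurableSpace U] [MeasurableSpace Z] {μ : Measure U}
  [IsProbabilityMeasure μ] {P : Measure Z} [IsProbabilityMeasure P] {k : Z → Z → ℝ}
  {g : U → Z → ℝ} {B : ℝ}

lemma exists_map_sum_eq_gaussianReal (hg : IsCenteredGP μ k g) (s : Finset ℕ) (z : ℕ → Z)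
    (c : ℕ → ℝ) : ∃ v : ℝ≥0, μ.map (fun u => ∑ i ∈ s, c i * g u (z i)) = gaussianReal 0 v := by
  have h1 : IsGaussianProcess (fun i u => c i • g u (z i)) μ :=
    (hg.gaussian.comp_right z).smul c
  have h2 : HasGaussianLaw (fun u => ∑ i ∈ s, c i * g u (z i)) μ := by
    simpa using h1.hasGaussianLaw_fun_sum (I := s)
  have h0 : ∫ u, ∑ i ∈ s, c i * g u (z i) ∂μ = 0 := by
    rw [integral_finsetSum]
    · refine Finset.sum_eq_zero fun i _ => ?_
      rw [integral_const_mul, hg.mean, mul_zero]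
    · exact fun i _ => ((hg.memLp_eval (z i)).integrable one_le_two).const_mul _
  rw [h2.map_eq_gaussianReal, h0]
  exact ⟨_, rfl⟩

/-- Only finite-dimensional marginals are known to be Gaussian, so the integral is written as a
limit of Monte Carlo averages at random points drawn from `P`. By the law of large numbers and
Fubini, some fixed sequence of points works for almost every path. Along it the averages are finite
linear combinations of values of the process. -/
lemma exists_map_coeff_eq_gaussianReal (hg : IsCenteredGP μ k g) (hk : ∀ x y, |k x y| ≤ B)
    (f : Lp ℝ 2 P) : ∃ v : ℝ≥0, μ.map (fun u => ∫ z, g u z * f z ∂P) = gaussianReal 0 v := by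
  have hfm := (Lp.stronglyMeasurable f).measurable
  let S : Measure (ℕ → Z) := Measure.infinitePi fun _ : ℕ => P
  let Y : ℕ → U → (ℕ → Z) → ℝ := fun n u ω =>
    (n : ℝ)⁻¹ • ∑ i ∈ Finset.range n, g u (ω i) * f (ω i)
  have hYm : ∀ n, Measurable fun q : U × (ℕ → Z) => Y n q.1 q.2 := fun n => by
    have hs : Measurable fun q : U × (ℕ → Z) =>
        ∑ i ∈ Finset.range n, g q.1 (q.2 i) * f (q.2 i) := by
      refine Finset.measurable_fun_sum _ fun i _ => ?_
      have h2 : Measurable fun q : U × (ℕ → Z) => q.2 i :=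
        (measurable_pi_apply i).comp measurable_snd
      exact (hg.measurable.comp (measurable_fst.prodMk h2)).mul (hfm.comp h2)
    exact hs.const_mul (n : ℝ)⁻¹
  have hXm := hg.measurable_coeff f
  have hset : MeasurableSet {q : U × (ℕ → Z) |
      Tendsto (fun n => Y n q.1 q.2) atTop (𝓝 (∫ z, g q.1 z * f z ∂P))} :=
    measurableSet_tendsto_fun hYm (hXm.comp measurable_fst)
  have hlln : ∀ᵐ u ∂μ, ∀ᵐ ω ∂S, Tendsto (fun n => Y n u ω) atTop (𝓝 (∫ z, g u z * f z ∂P)) := by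
    filter_upwards [hg.ae_memLp_path (P := P) hk] with u hu
    have hm : Measurable fun z => g u z * f z := (hg.measurable_path u).mul hfm
    have hint : Integrable (fun z => g u z * f z) P := hu.integrable_mul (Lp.memLp f)
    exact ae_tendsto_average hm hint
  obtain ⟨ω, hω⟩ := ((Measure.ae_ae_comm hset).1 hlln).exists
  refine exists_map_eq_gaussianReal_of_tendsto hXm
    (fun n => (hYm n).comp (measurable_id.prodMk measurable_const)) (fun n => ?_) hω
  obtain ⟨v, hv⟩ := hg.exists_map_sum_eq_gaussianReal (Finset.range n) ω
    fun i => (n : ℝ)⁻¹ * f (ω i)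
  refine ⟨v, hv ▸ ?_⟩
  congr 1
  ext u
  simp only [id, Y, smul_eq_mul, Finset.mul_sum]
  exact Finset.sum_congr rfl fun i _ => by ring

/-- The coefficient of the process along `f ∈ L²(P)` is centred Gaussian. -/
lemma map_coeff_eq_gaussianReal (hg : IsCenteredGP μ k g) (hk : ∀ x y, |k x y| ≤ B)
    (f : Lp ℝ 2 P) : μ.map (fun u => ∫ z, g u z * f z ∂P) =
      gaussianReal 0 (∫ x, (∫ y, k x y * f y ∂P) * f x ∂P).toNNReal := by
  obtain ⟨v, hv⟩ := hg.exists_map_coeff_eq_gaussianReal (P := P) hk f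
  rw [hv, ← hg.integral_coeff_mul hk]
  have hm := hg.measurable_coeff f
  have h1 : ∫ x, x * x ∂(gaussianReal 0 v) =
      ∫ u, (∫ z, g u z * f z ∂P) * (∫ z, g u z * f z ∂P) ∂μ := by
    rw [← hv, integral_map hm.aemeasurable]
    exact (continuous_id.mul continuous_id).aestronglyMeasurable
  have h2 := variance_fun_id_gaussianReal (μ := 0) (v := v)
  rw [variance_of_integral_eq_zero aemeasurable_id' integral_id_gaussianReal] at h2
  simp_rw [sq] at h2
  rw [← h1, h2, Real.toNNReal_coe]

end IsCenteredGP

/-! ### Mercer expansions of the covariance -/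

lemma norm_toL2_sq {X : Type*} [MeasurableSpace X] {P : Measure X} {f : X → ℝ}
    (hf : Measurable f) : ‖toL2 P f‖ ^ 2 = (∫⁻ x, ‖f x‖ₑ ^ 2 ∂P).toReal := by
  have e : ∫⁻ x, ‖f x‖ₑ ^ 2 ∂P = eLpNorm f 2 P ^ 2 := by
    rw [eLpNorm_eq_lintegral_rpow_enorm_toReal two_ne_zero ENNReal.ofNat_ne_top]
    simp only [ENNReal.toReal_ofNat, ENNReal.rpow_ofNat, one_div]
    rw [← ENNReal.rpow_ofNat, ← ENNReal.rpow_mul]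
    simp
  rw [e, ENNReal.toReal_pow]
  by_cases h : MemLp f 2 P
  · rw [toL2, dif_pos h, Lp.norm_toLp]
  · rw [toL2, dif_neg h]
    have : eLpNorm f 2 P = ⊤ := by
      by_contra h'
      exact h ⟨hf.aestronglyMeasurable, lt_top_iff_ne_top.2 h'⟩
    simp [this]

namespace IsMercerSystem

variable {X : Type*} [MeasurableSpace X] {P : Measure X} {k : X → X → ℝ} {lam : ℕ → ℝ}
  {psi : ℕ → Lp ℝ 2 P}

/-- The expansion is used only through this bilinear form, which by `integral_inner_mul` is the
covariance of the coefficients of the process along `f` and `h`. -/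
lemma hasSum_inner (hM : IsMercerSystem P k lam psi) (f h : Lp ℝ 2 P) :
    HasSum (fun i => lam i * ⟪psi i, f⟫ * ⟪psi i, h⟫)
      (∫ x, (∫ y, k x y * f y ∂P) * h x ∂P) := by
  obtain ⟨Tf, hTf, hs⟩ := hM.expansion f
  have h1 := hs.mapL (innerSL ℝ h)
  have e : innerSL ℝ h Tf = ∫ x, (∫ y, k x y * f y ∂P) * h x ∂P := by
    rw [innerSL_apply_apply, L2.inner_def]
    refine integral_congr_ae ?_
    filter_upwards [hTf] with x hx
    rw [hx]; simp
  rw [e] at h1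
  have e2 : (fun i => lam i * ⟪psi i, f⟫ * ⟪psi i, h⟫) =
      fun i => innerSL ℝ h ((lam i * ⟪psi i, f⟫) • psi i) := funext fun i => by
    rw [innerSL_apply_apply, inner_smul_right, real_inner_comm h]
  rw [e2]
  exact h1

lemma inner_psi_of_pos (hM : IsMercerSystem P k lam psi) {i j : ℕ} (hi : 0 < lam i)
    (hj : 0 < lam j) : ⟪psi i, psi j⟫ = if i = j then (1 : ℝ) else 0 := by
  have := orthonormal_iff_ite.1 hM.orthonormal ⟨i, hi⟩ ⟨j, hj⟩
  simpa using this

lemma integral_psi (hM : IsMercerSystem P k lam psi) {j : ℕ} (hj : 0 < lam j) (h : Lp ℝ 2 P) :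
    ∫ x, (∫ y, k x y * psi j y ∂P) * h x ∂P = lam j * ⟪psi j, h⟫ := by
  refine (hM.hasSum_inner (psi j) h).unique ?_
  convert hasSum_single (f := fun i => lam i * ⟪psi i, psi j⟫ * ⟪psi i, h⟫) j ?_ using 1
  · rw [hM.inner_psi_of_pos hj hj, if_pos rfl, mul_one]
  · intro i hi
    rcases (hM.nonneg i).eq_or_lt with h0 | h0
    · simp [← h0]
    · simp [hM.inner_psi_of_pos h0 hj, hi]

lemma orthonormal_fin (hM : IsMercerSystem P k lam psi) {r : ℕ} (hr : ∀ i < r, 0 < lam i) :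
    Orthonormal ℝ fun i : Fin r => psi i := by
  rw [orthonormal_iff_ite]
  intro i j
  rw [hM.inner_psi_of_pos (hr i i.2) (hr j j.2)]
  simp [Fin.ext_iff]

lemma mercerProj_eq_sum_fin (r : ℕ) (f : Lp ℝ 2 P) :
    mercerProj psi r f = ∑ i : Fin r, ⟪psi i, f⟫ • psi i :=
  Finset.sum_range fun i => ⟪psi i, f⟫ • psi i

lemma norm_mercerProj_sq (hM : IsMercerSystem P k lam psi) {r : ℕ} (hr : ∀ i < r, 0 < lam i)
    (f : Lp ℝ 2 P) : ‖mercerProj psi r f‖ ^ 2 = ∑ i : Fin r, ⟪psi i, f⟫ ^ 2 := by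
  have ho := hM.orthonormal_fin hr
  rw [mercerProj_eq_sum_fin, ← real_inner_self_eq_norm_sq, ho.inner_sum]
  simp [sq]

lemma norm_sub_mercerProj_sq (hM : IsMercerSystem P k lam psi) {r : ℕ}
    (hr : ∀ i < r, 0 < lam i) (f : Lp ℝ 2 P) :
    ‖f - mercerProj psi r f‖ ^ 2 = ‖f‖ ^ 2 - ∑ i : Fin r, ⟪psi i, f⟫ ^ 2 := by
  rw [norm_sub_sq_real, hM.norm_mercerProj_sq hr, mercerProj_eq_sum_fin, inner_sum]
  have : ∑ i : Fin r, ⟪f, ⟪psi i, f⟫ • psi i⟫ = ∑ i : Fin r, ⟪psi i, f⟫ ^ 2 :=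
    Finset.sum_congr rfl fun i _ => by rw [inner_smul_right, real_inner_comm, sq]
  rw [this]; ring

end IsMercerSystem

/-- An orthonormal basis of a separable Hilbert space is countable. -/
lemma Orthonormal.countable_of_separable {E ι : Type*} [NormedAddCommGroup E]
    [InnerProductSpace ℝ E] [TopologicalSpace.SeparableSpace E] {v : ι → E}
    (hv : Orthonormal ℝ v) : Countable ι := by
  have hd : (Set.univ : Set ι).PairwiseDisjoint fun i => Metric.ball (v i) (1 / 2) := by
    intro i _ j _ hij
    refine Metric.ball_disjoint_ball ?_
    have h2 : ‖v i - v j‖ ^ 2 = 2 := by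
      rw [norm_sub_sq_real, hv.1, hv.1, hv.2 hij]; norm_num
    rw [dist_eq_norm]
    nlinarith [norm_nonneg (v i - v j)]
  have := hd.countable_of_isOpen (fun i _ => Metric.isOpen_ball)
    (fun i _ => ⟨v i, Metric.mem_ball_self (by norm_num)⟩)
  exact Set.countable_univ_iff.1 this

namespace IsCenteredGP

variable {U Z : Type*} [MeasurableSpace U] [MeasurableSpace Z] {μ : Measure U}
  [IsProbabilityMeasure μ] {P : Measure Z} [IsProbabilityMeasure P] {k : Z → Z → ℝ}
  {g : U → Z → ℝ} {B : ℝ}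

lemma integrable_norm_path_sq (hg : IsCenteredGP μ k g) (hk : ∀ x y, |k x y| ≤ B) :
    Integrable (fun u => ‖toL2 P (g u)‖ ^ 2) μ := by
  simp_rw [norm_toL2_sq (hg.measurable_path _)]
  exact integrable_toReal_of_lintegral_ne_top
    ((hg.measurable.enorm.pow_const 2).lintegral_prod_right').aemeasurable
    ((hg.lintegral_sq_path_le (P := P) hk).trans_lt ENNReal.ofReal_lt_top).ne

lemma ae_coeff_eq_inner (hg : IsCenteredGP μ k g) (hk : ∀ x y, |k x y| ≤ B) :
    ∀ᵐ u ∂μ, ∀ f : Lp ℝ 2 P, ∫ z, g u z * f z ∂P = ⟪f, toL2 P (g u)⟫ := by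
  filter_upwards [hg.ae_memLp_path (P := P) hk] with u hu f
  exact coeff_eq_inner hu f

lemma aemeasurable_inner (hg : IsCenteredGP μ k g) (hk : ∀ x y, |k x y| ≤ B) (f : Lp ℝ 2 P) :
    AEMeasurable (fun u => ⟪f, toL2 P (g u)⟫) μ :=
  (hg.measurable_coeff f).aemeasurable.congr
    ((hg.ae_coeff_eq_inner hk).mono fun _ h => h f)

lemma integrable_inner_mul (hg : IsCenteredGP μ k g) (hk : ∀ x y, |k x y| ≤ B)
    (f h : Lp ℝ 2 P) : Integrable (fun u => ⟪f, toL2 P (g u)⟫ * ⟪h, toL2 P (g u)⟫) μ := by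
  refine (hg.integrable_coeff_mul hk f h).congr ?_
  filter_upwards [hg.ae_coeff_eq_inner (P := P) hk] with u hu
  rw [hu, hu]

lemma integral_inner_mul (hg : IsCenteredGP μ k g) (hk : ∀ x y, |k x y| ≤ B)
    (f h : Lp ℝ 2 P) : ∫ u, ⟪f, toL2 P (g u)⟫ * ⟪h, toL2 P (g u)⟫ ∂μ =
      ∫ x, (∫ y, k x y * f y ∂P) * h x ∂P := by
  rw [← hg.integral_coeff_mul hk f h]
  refine integral_congr_ae ?_
  filter_upwards [hg.ae_coeff_eq_inner (P := P) hk] with u hu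
  rw [hu, hu]

lemma map_inner_eq_gaussianReal (hg : IsCenteredGP μ k g) (hk : ∀ x y, |k x y| ≤ B)
    (f : Lp ℝ 2 P) : μ.map (fun u => ⟪f, toL2 P (g u)⟫) =
      gaussianReal 0 (∫ x, (∫ y, k x y * f y ∂P) * f x ∂P).toNNReal := by
  rw [← hg.map_coeff_eq_gaussianReal hk f]
  refine Measure.map_congr ?_
  filter_upwards [hg.ae_coeff_eq_inner (P := P) hk] with u hu
  rw [hu]

variable {lam : ℕ → ℝ} {psi : ℕ → Lp ℝ 2 P}

lemma integral_inner_psi_sq (hg : IsCenteredGP μ k g) (hk : ∀ x y, |k x y| ≤ B)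
    (hM : IsMercerSystem P k lam psi) {j : ℕ} (hj : 0 < lam j) :
    ∫ u, ⟪psi j, toL2 P (g u)⟫ ^ 2 ∂μ = lam j := by
  simp_rw [sq]
  rw [hg.integral_inner_mul hk, hM.integral_psi hj, hM.inner_psi_of_pos hj hj]
  simp

/-! ### Kernels pulled back along a feature map: total variance and comparison of eigenvalues -/

section Pullback

variable {W : Type*} [MeasurableSpace W] {Φ : Z → W} {kbar : W → W → ℝ} {gbar : U → W → ℝ}

lemma toL2_comp (hΦ : MeasurePreserving Φ P (P.map Φ)) {h : W → ℝ}
    (hh : MemLp h 2 (P.map Φ)) :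
    toL2 P (fun z => h (Φ z)) = Lp.compMeasurePreserving Φ hΦ (toL2 (P.map Φ) h) := by
  have h2 : MemLp (fun z => h (Φ z)) 2 P := hh.comp_measurePreserving hΦ
  rw [toL2, toL2, dif_pos hh, dif_pos h2, Lp.toLp_compMeasurePreserving]
  rfl

/-- The total variance of the process is at most the sum of the Mercer eigenvalues, if the process
is a pullback from a space with separable `L²`. -/
lemma integral_norm_path_sq_le [MeasurableSpace.CountablyGenerated W] (hΦ : Measurable Φ)
    (hg : IsCenteredGP μ kbar gbar) (hk : ∀ x y, |kbar x y| ≤ B)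
    (hM : IsMercerSystem P (fun x y => kbar (Φ x) (Φ y)) lam psi) (hs : Summable lam) :
    ∫ u, ‖toL2 P (fun z => gbar u (Φ z))‖ ^ 2 ∂μ ≤ ∑' i, lam i := by
  have hmp : MeasurePreserving Φ P (P.map Φ) := ⟨hΦ, rfl⟩
  have hprob : IsProbabilityMeasure (P.map Φ) := Measure.isProbabilityMeasure_map hΦ.aemeasurable
  have hg' := hg.comp_measurable hΦ
  have hk' : ∀ x y, |kbar (Φ x) (Φ y)| ≤ B := fun x y => hk _ _
  -- The space `L²(P)` need not be separable and the eigenfunctions need not span it. The paths,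
  -- however, lie in the isometric image of the separable space `L²(P.map Φ)`. Parseval there is a
  -- countable sum, which may be exchanged with the expectation.
  obtain ⟨w, e, -⟩ := exists_hilbertBasis ℝ (Lp ℝ 2 (P.map Φ))
  have hfact : Fact ((2 : ℝ≥0∞) ≠ ⊤) := ⟨ENNReal.ofNat_ne_top⟩
  have hcount : Countable w := e.orthonormal.countable_of_separable
  let J := Lp.compMeasurePreservingₗᵢ ℝ (E := ℝ) (p := 2) Φ hmp
  have hJo : Orthonormal ℝ fun i => J (e i) := e.orthonormal.comp_linearIsometry J
  have hpar : ∀ᵐ u ∂μ, ENNReal.ofReal (‖toL2 P (fun z => gbar u (Φ z))‖ ^ 2) =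
      ∑' i, ENNReal.ofReal (⟪J (e i), toL2 P (fun z => gbar u (Φ z))⟫ ^ 2) := by
    filter_upwards [hg.ae_memLp_path (P := P.map Φ) hk] with u hu
    have e1 : toL2 P (fun z => gbar u (Φ z)) = J (toL2 (P.map Φ) (gbar u)) := toL2_comp hmp hu
    have h1 := e.hasSum_inner_mul_inner (toL2 (P.map Φ) (gbar u)) (toL2 (P.map Φ) (gbar u))
    have h2 : HasSum (fun i => ⟪J (e i), toL2 P (fun z => gbar u (Φ z))⟫ ^ 2)
        (‖toL2 P (fun z => gbar u (Φ z))‖ ^ 2) := by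
      rw [e1, J.norm_map, ← real_inner_self_eq_norm_sq]
      have e2 : (fun i => ⟪J (e i), J (toL2 (P.map Φ) (gbar u))⟫ ^ 2) = fun i =>
          ⟪toL2 (P.map Φ) (gbar u), e i⟫ * ⟪e i, toL2 (P.map Φ) (gbar u)⟫ := funext fun i => by
        rw [J.inner_map_map, real_inner_comm (e i), sq]
      rw [e2]
      exact h1
    rw [← h2.tsum_eq, ENNReal.ofReal_tsum_of_nonneg (fun i => sq_nonneg _) h2.summable]
  have hI : ∀ f : Lp ℝ 2 P, ∫⁻ u, ENNReal.ofReal (⟪f, toL2 P (fun z => gbar u (Φ z))⟫ ^ 2) ∂μ =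
      ∑' i, ENNReal.ofReal (lam i * ⟪psi i, f⟫ ^ 2) := fun f => by
    have h0 := hM.hasSum_inner f f
    rw [← hg'.integral_inner_mul hk'] at h0
    have h1 : ∀ i, lam i * ⟪psi i, f⟫ * ⟪psi i, f⟫ = lam i * ⟪psi i, f⟫ ^ 2 := fun i => by ring
    simp_rw [h1, ← sq] at h0
    rw [← ofReal_integral_eq_lintegral_ofReal, ← h0.tsum_eq,
      ENNReal.ofReal_tsum_of_nonneg (fun i => mul_nonneg (hM.nonneg i) (sq_nonneg _)) h0.summable]
    · simpa only [sq] using hg'.integrable_inner_mul hk' f f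
    · exact ae_of_all _ fun u => sq_nonneg _
  -- Bessel for the unit vector `psi i` against the orthonormal family `J (e j)`. Eigenfunctions
  -- with eigenvalue zero are arbitrary but carry weight zero.
  have hlam : ∀ i, ∑' j, ENNReal.ofReal (lam i * ⟪psi i, J (e j)⟫ ^ 2) ≤
      ENNReal.ofReal (lam i) := fun i => by
    rcases (hM.nonneg i).eq_or_lt with h0 | h0
    · simp [← h0]
    · have hn : ‖psi i‖ = 1 := hM.orthonormal.1 ⟨i, h0⟩
      have hb := hJo.tsum_inner_products_le (x := psi i)
      have hsum := hJo.inner_products_summable (x := psi i)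
      simp_rw [Real.norm_eq_abs, sq_abs, hn] at hb hsum
      rw [← ENNReal.ofReal_tsum_of_nonneg (fun j => mul_nonneg h0.le (sq_nonneg _))]
      · refine ENNReal.ofReal_le_ofReal ?_
        rw [tsum_mul_left]
        simp_rw [real_inner_comm _ (psi i)] at hb ⊢
        nlinarith
      · simp_rw [real_inner_comm _ (psi i)] at hsum ⊢
        exact hsum.mul_left _
  have hfin : ∫⁻ u, ENNReal.ofReal (‖toL2 P (fun z => gbar u (Φ z))‖ ^ 2) ∂μ ≤
      ENNReal.ofReal (∑' i, lam i) := by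
    rw [lintegral_congr_ae hpar, lintegral_tsum]
    · simp_rw [hI]
      rw [ENNReal.tsum_comm, ENNReal.ofReal_tsum_of_nonneg hM.nonneg hs]
      exact ENNReal.tsum_le_tsum hlam
    · exact fun i => ((hg'.aemeasurable_inner hk' _).pow_const 2).ennreal_ofReal
  rw [← ofReal_integral_eq_lintegral_ofReal (hg'.integrable_norm_path_sq hk')
    (ae_of_all _ fun u => sq_nonneg _)] at hfin
  exact (ENNReal.ofReal_le_ofReal_iff (tsum_nonneg hM.nonneg)).1 hfin

/-- The Mercer eigenvalues of a pulled back kernel are at most those of the kernel. -/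
lemma eigenvalue_le (hΦ : Measurable Φ)
    (hg : IsCenteredGP μ kbar gbar) (hk : ∀ x y, |kbar x y| ≤ B)
    (hM : IsMercerSystem P (fun x y => kbar (Φ x) (Φ y)) lam psi)
    {lambar : ℕ → ℝ} {psibar : ℕ → Lp ℝ 2 (P.map Φ)}
    (hMbar : IsMercerSystem (P.map Φ) kbar lambar psibar) (r : ℕ) : lam r ≤ lambar r := by
  have hmp : MeasurePreserving Φ P (P.map Φ) := ⟨hΦ, rfl⟩
  have hprob : IsProbabilityMeasure (P.map Φ) := Measure.isProbabilityMeasure_map hΦ.aemeasurable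
  have hg' := hg.comp_measurable hΦ
  have hk' : ∀ x y, |kbar (Φ x) (Φ y)| ≤ B := fun x y => hk _ _
  rcases (hM.nonneg r).eq_or_lt with h0 | hr
  · rw [← h0]; exact hMbar.nonneg r
  have hpos : ∀ i < r + 1, 0 < lam i := fun i hi => hr.trans_le (hM.antitone (by lia))
  have ho := hM.orthonormal_fin hpos
  let J : Lp ℝ 2 (P.map Φ) →L[ℝ] Lp ℝ 2 P :=
    (Lp.compMeasurePreservingₗᵢ ℝ (E := ℝ) (p := 2) Φ hmp).toContinuousLinearMap
  have hJ : ∀ x, ‖J x‖ = ‖x‖ := fun x => LinearIsometry.norm_map _ x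
  let V : EuclideanSpace ℝ (Fin (r + 1)) →ₗ[ℝ] Lp ℝ 2 P :=
    { toFun := fun x => ∑ i, x i • psi i
      map_add' := fun x y => by simp [add_smul, Finset.sum_add_distrib]
      map_smul' := fun c x => by simp [mul_smul, Finset.smul_sum] }
  let F : EuclideanSpace ℝ (Fin (r + 1)) →ₗ[ℝ] (Fin r → ℝ) :=
    LinearMap.pi fun j => (innerSL ℝ (J (psibar j))).toLinearMap ∘ₗ V
  -- Courant-Fischer dimension count: the span of `r + 1` pulled-back eigenfunctions contains a
  -- nonzero `f` with `J.adjoint f` orthogonal to the first `r` latent eigenfunctions. The variance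
  -- of the process along `f` is then at least `lam r * ‖f‖ ^ 2` and at most `lambar r * ‖f‖ ^ 2`.
  have hker : LinearMap.ker F ≠ ⊥ := LinearMap.ker_ne_bot_of_finrank_lt (by simp)
  obtain ⟨x, hx, hx0⟩ := (Submodule.ne_bot_iff _).1 hker
  have hFx : ∀ j < r, ⟪psibar j, J.adjoint (V x)⟫ = 0 := fun j hj => by
    have := congr_fun (LinearMap.mem_ker.1 hx) ⟨j, hj⟩
    rw [ContinuousLinearMap.adjoint_inner_right]
    simpa [F] using this
  have hin : ∀ i : Fin (r + 1), ⟪psi i, V x⟫ = x i := fun i => by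
    exact ho.inner_right_fintype (fun i => x i) i
  have hVx : ‖V x‖ ^ 2 = ∑ i, x i ^ 2 := by
    rw [← real_inner_self_eq_norm_sq]
    change ⟪∑ i, x i • psi i, ∑ i, x i • psi i⟫ = _
    rw [ho.inner_sum]; simp [sq]
  have hxpos : 0 < ‖V x‖ ^ 2 := by
    rw [hVx, ← EuclideanSpace.real_norm_sq_eq]
    have := norm_pos_iff.2 hx0
    positivity
  set f := V x with hf
  set h := J.adjoint f with hh
  have hle : ‖h‖ ≤ ‖f‖ := by
    have h1 : ‖h‖ ^ 2 = ⟪J h, f⟫ := by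
      rw [← real_inner_self_eq_norm_sq]; nth_rewrite 2 [hh]
      rw [ContinuousLinearMap.adjoint_inner_right]
    have h2 : ⟪J h, f⟫ ≤ ‖h‖ * ‖f‖ := (real_inner_le_norm _ _).trans_eq (by rw [hJ])
    by_contra hlt
    push Not at hlt
    nlinarith [norm_nonneg f]
  have hsame : ∫ u, ⟪f, toL2 P (fun z => gbar u (Φ z))⟫ * ⟪f, toL2 P (fun z => gbar u (Φ z))⟫ ∂μ =
      ∫ u, ⟪h, toL2 (P.map Φ) (gbar u)⟫ * ⟪h, toL2 (P.map Φ) (gbar u)⟫ ∂μ := by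
    refine integral_congr_ae ?_
    filter_upwards [hg.ae_memLp_path (P := P.map Φ) hk] with u hu
    have e1 : toL2 P (fun z => gbar u (Φ z)) = J (toL2 (P.map Φ) (gbar u)) := toL2_comp hmp hu
    rw [e1, hh, ContinuousLinearMap.adjoint_inner_left]
  have hlow : lam r * ‖f‖ ^ 2 ≤
      ∫ u, ⟪f, toL2 P (fun z => gbar u (Φ z))⟫ * ⟪f, toL2 P (fun z => gbar u (Φ z))⟫ ∂μ := by
    rw [hg'.integral_inner_mul hk']
    have hs := hM.hasSum_inner f f
    have h1 := sum_le_hasSum (Finset.range (r + 1)) (fun i _ => by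
      have := hM.nonneg i
      nlinarith [mul_nonneg this (mul_self_nonneg ⟪psi i, f⟫)]) hs
    refine le_trans ?_ h1
    rw [hVx, Finset.mul_sum, Finset.sum_range]
    refine Finset.sum_le_sum fun i _ => ?_
    rw [hf, hin, mul_assoc, ← sq]
    exact mul_le_mul_of_nonneg_right (hM.antitone (by lia)) (sq_nonneg _)
  have hup : ∫ u, ⟪h, toL2 (P.map Φ) (gbar u)⟫ * ⟪h, toL2 (P.map Φ) (gbar u)⟫ ∂μ ≤
      lambar r * ‖h‖ ^ 2 := by
    rw [hg.integral_inner_mul hk]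
    have hs := hMbar.hasSum_inner h h
    refine hasSum_le_of_sum_le hs fun s => ?_
    classical
    have hbes := hMbar.orthonormal.sum_inner_products_le (x := h)
      (s := (s.subtype fun i => 0 < lambar i))
    calc ∑ i ∈ s, lambar i * ⟪psibar i, h⟫ * ⟪psibar i, h⟫
        = ∑ i ∈ s.filter (fun i => 0 < lambar i), lambar i * ⟪psibar i, h⟫ * ⟪psibar i, h⟫ := by
          rw [Finset.sum_filter_of_ne]
          intro i _ hi
          refine lt_of_le_of_ne (hMbar.nonneg i) fun h0 => hi ?_
          rw [← h0]; ring
      _ ≤ ∑ i ∈ s.filter (fun i => 0 < lambar i), lambar r * ‖⟪psibar i, h⟫‖ ^ 2 := by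
          refine Finset.sum_le_sum fun i _ => ?_
          rw [Real.norm_eq_abs, sq_abs, mul_assoc, ← sq]
          rcases lt_or_ge i r with hi | hi
          · rw [hFx i hi]; simp
          · exact mul_le_mul_of_nonneg_right (hMbar.antitone hi) (sq_nonneg _)
      _ = lambar r * ∑ i ∈ s.subtype (fun i => 0 < lambar i), ‖⟪psibar i, h⟫‖ ^ 2 := by
          rw [← Finset.mul_sum, ← Finset.sum_subtype_eq_sum_filter]
      _ ≤ lambar r * ‖h‖ ^ 2 := mul_le_mul_of_nonneg_left hbes (hMbar.nonneg r)
  have h3 : lambar r * ‖h‖ ^ 2 ≤ lambar r * ‖f‖ ^ 2 :=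
    mul_le_mul_of_nonneg_left (pow_le_pow_left₀ (norm_nonneg _) hle 2) (hMbar.nonneg r)
  rw [hsame] at hlow
  exact le_of_mul_le_mul_right (hlow.trans (hup.trans h3)) hxpos

end Pullback

end IsCenteredGP

/-! ### Tails of polynomially decaying eigenvalues -/

/-- A discrete form of comparing `∑ i ^ (-(b + 1))` with the integral: the right-hand side
telescopes in `sum_tail_le`. It follows from `log x ≤ x - 1` and `1 + x ≤ exp x`. -/
lemma mul_rpow_neg_le_sub {a b : ℝ} (ha : 0 < a) (hb : 0 < b) :
    b * (a + 1) ^ (-(b + 1)) ≤ a ^ (-b) - (a + 1) ^ (-b) := by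
  have hx : 0 < a + 1 := by linarith
  have hq : 0 < a / (a + 1) := div_pos ha hx
  have h1 : a ^ (-b) = (a + 1) ^ (-b) * (a / (a + 1)) ^ (-b) := by
    rw [← Real.mul_rpow hx.le hq.le, mul_div_cancel₀ _ hx.ne']
  have hlog : Real.log (a / (a + 1)) ≤ -(1 / (a + 1)) := by
    refine (Real.log_le_sub_one_of_pos hq).trans_eq ?_
    field_simp
    ring
  have h2 : 1 + b / (a + 1) ≤ (a / (a + 1)) ^ (-b) := by
    rw [Real.rpow_def_of_pos hq]
    have h3 := Real.add_one_le_exp (Real.log (a / (a + 1)) * -b)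
    have h4 : b / (a + 1) ≤ Real.log (a / (a + 1)) * -b := by
      calc b / (a + 1) = (1 / (a + 1)) * b := by ring
        _ ≤ -Real.log (a / (a + 1)) * b := mul_le_mul_of_nonneg_right (by linarith) hb.le
        _ = _ := by ring
    linarith
  have h5 : (a + 1) ^ (-(b + 1)) = (a + 1) ^ (-b) / (a + 1) := by
    rw [show -(b + 1) = -b - 1 by ring, Real.rpow_sub_one hx.ne']
  have h6 : 0 < (a + 1) ^ (-b) := Real.rpow_pos_of_pos hx _
  rw [h1, h5]
  have h7 := mul_le_mul_of_nonneg_left h2 h6.le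
  have h8 : (a + 1) ^ (-b) * (1 + b / (a + 1)) =
      (a + 1) ^ (-b) + b * ((a + 1) ^ (-b) / (a + 1)) := by ring
  linarith

lemma sum_tail_le {b K : ℝ} (hb : 0 < b) (hK : 0 ≤ K) {lam : ℕ → ℝ}
    (hdecay : ∀ i : ℕ, lam i ≤ K * ((i : ℝ) + 1) ^ (-(b + 1))) {r : ℕ} (hr : 0 < r) (N : ℕ) :
    ∑ i ∈ Finset.range N, lam (i + r) ≤ K / b * (r : ℝ) ^ (-b) := by
  have hr' : (0 : ℝ) < r := by exact_mod_cast hr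
  have key : ∑ i ∈ Finset.range N, lam (i + r) ≤
      K / b * ((r : ℝ) ^ (-b) - ((N : ℝ) + r) ^ (-b)) := by
    induction N with
    | zero => simp
    | succ N ih =>
      rw [Finset.sum_range_succ]
      have h1 := hdecay (N + r)
      have h2 := mul_rpow_neg_le_sub (a := (N : ℝ) + r) (by positivity) hb
      push_cast at h1 ⊢
      have h3 : K * ((N : ℝ) + r + 1) ^ (-(b + 1)) ≤
          K / b * (((N : ℝ) + r) ^ (-b) - ((N : ℝ) + r + 1) ^ (-b)) := by
        rw [div_mul_eq_mul_div, le_div_iff₀ hb]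
        calc _ = K * (b * ((N : ℝ) + r + 1) ^ (-(b + 1))) := by ring
          _ ≤ _ := mul_le_mul_of_nonneg_left h2 hK
      rw [show (N : ℝ) + 1 + r = N + r + 1 by ring]
      linarith
  refine key.trans (mul_le_mul_of_nonneg_left ?_ (by positivity))
  have : 0 ≤ ((N : ℝ) + r) ^ (-b) := by positivity
  linarith

lemma summable_of_decay {b K : ℝ} (hb : 0 < b) (hK : 0 ≤ K) {lam : ℕ → ℝ} (h0 : ∀ i, 0 ≤ lam i)
    (hdecay : ∀ i : ℕ, lam i ≤ K * ((i : ℝ) + 1) ^ (-(b + 1))) : Summable lam :=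
  (summable_nat_add_iff 1).1
    (summable_of_sum_range_le (fun _ => h0 _) (sum_tail_le hb hK hdecay one_pos))

lemma tsum_tail_le {b K : ℝ} (hb : 0 < b) (hK : 0 ≤ K) {lam : ℕ → ℝ} (h0 : ∀ i, 0 ≤ lam i)
    (hdecay : ∀ i : ℕ, lam i ≤ K * ((i : ℝ) + 1) ^ (-(b + 1))) {r : ℕ} (hr : 0 < r) :
    ∑' i, lam (i + r) ≤ K / b * (r : ℝ) ^ (-b) :=
  Real.tsum_le_of_sum_range_le (fun _ => h0 _) (sum_tail_le hb hK hdecay hr)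

/-! ### Standardized Mercer coefficients -/

/-- The coefficients `⟪psi i, f⟫ / √(lam i)`, `i < r`, of `f ∈ L²(P)`. -/
def stdCoeff {X : Type*} [MeasurableSpace X] {P : Measure X} (lam : ℕ → ℝ) (psi : ℕ → Lp ℝ 2 P)
    (r : ℕ) : Lp ℝ 2 P →L[ℝ] EuclideanSpace ℝ (Fin r) :=
  (EuclideanSpace.equiv (Fin r) ℝ).symm.toContinuousLinearMap ∘L
    ContinuousLinearMap.pi fun i : Fin r => (√(lam i))⁻¹ • innerSL ℝ (psi i)

section

variable {X : Type*} [MeasurableSpace X] {P : Measure X} {k : X → X → ℝ} {lam : ℕ → ℝ}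
  {psi : ℕ → Lp ℝ 2 P}

@[simp]
lemma stdCoeff_apply (r : ℕ) (f : Lp ℝ 2 P) (i : Fin r) :
    stdCoeff lam psi r f i = (√(lam i))⁻¹ * ⟪psi i, f⟫ := rfl

lemma norm_stdCoeff_sq (r : ℕ) (h0 : ∀ i, 0 ≤ lam i) (f : Lp ℝ 2 P) :
    ‖stdCoeff lam psi r f‖ ^ 2 = ∑ i : Fin r, ⟪psi i, f⟫ ^ 2 / lam i := by
  rw [EuclideanSpace.real_norm_sq_eq]
  refine Finset.sum_congr rfl fun i _ => ?_
  rw [stdCoeff_apply, mul_pow, inv_pow, Real.sq_sqrt (h0 _)]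
  ring

lemma norm_stdCoeff_mono (h0 : ∀ i, 0 ≤ lam i) {r s : ℕ} (hrs : r ≤ s) (f : Lp ℝ 2 P) :
    ‖stdCoeff lam psi r f‖ ≤ ‖stdCoeff lam psi s f‖ := by
  refine (sq_le_sq₀ (norm_nonneg _) (norm_nonneg _)).1 ?_
  rw [norm_stdCoeff_sq r h0, norm_stdCoeff_sq s h0,
    ← Finset.sum_range fun i => ⟪psi i, f⟫ ^ 2 / lam i,
    ← Finset.sum_range fun i => ⟪psi i, f⟫ ^ 2 / lam i]
  exact Finset.sum_le_sum_of_subset_of_nonneg (Finset.range_mono hrs)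
    fun i _ _ => div_nonneg (sq_nonneg _) (h0 i)

lemma mercerProj_eq_stdCoeff {r : ℕ} (hr : ∀ i < r, 0 < lam i) (f : Lp ℝ 2 P) :
    mercerProj psi r f = ∑ i : Fin r, (√(lam i) * stdCoeff lam psi r f i) • psi i := by
  rw [IsMercerSystem.mercerProj_eq_sum_fin]
  refine Finset.sum_congr rfl fun i _ => ?_
  rw [stdCoeff_apply, mul_inv_cancel_left₀ (Real.sqrt_pos.2 (hr i i.2)).ne']

lemma norm_mercerProj_le (hM : IsMercerSystem P k lam psi) {r : ℕ} (hr : ∀ i < r, 0 < lam i)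
    (f : Lp ℝ 2 P) : ‖mercerProj psi r f‖ ≤ √(lam 0) * ‖stdCoeff lam psi r f‖ := by
  refine (sq_le_sq₀ (norm_nonneg _) (by positivity)).1 ?_
  rw [hM.norm_mercerProj_sq hr, mul_pow, Real.sq_sqrt (hM.nonneg 0), norm_stdCoeff_sq r hM.nonneg,
    Finset.mul_sum]
  refine Finset.sum_le_sum fun i _ => ?_
  rw [mul_div_assoc', le_div_iff₀ (hr i i.2), mul_comm]
  exact mul_le_mul_of_nonneg_right (hM.antitone (Nat.zero_le _)) (sq_nonneg _)

end

namespace IsCenteredGP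

variable {U Z : Type*} [MeasurableSpace U] [MeasurableSpace Z] {μ : Measure U}
  [IsProbabilityMeasure μ] {P : Measure Z} [IsProbabilityMeasure P] {k : Z → Z → ℝ}
  {g : U → Z → ℝ} {B : ℝ} {lam : ℕ → ℝ} {psi : ℕ → Lp ℝ 2 P}

lemma integrable_residual_sq (hg : IsCenteredGP μ k g) (hk : ∀ x y, |k x y| ≤ B)
    (hM : IsMercerSystem P k lam psi) {r : ℕ} (hr : ∀ i < r, 0 < lam i) :
    Integrable (fun u => ‖toL2 P (g u) - mercerProj psi r (toL2 P (g u))‖ ^ 2) μ := by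
  simp_rw [hM.norm_sub_mercerProj_sq hr, sq ⟪_, _⟫]
  exact (hg.integrable_norm_path_sq hk).sub
    (integrable_finsetSum _ fun i _ => hg.integrable_inner_mul hk _ _)

lemma integral_residual_sq (hg : IsCenteredGP μ k g) (hk : ∀ x y, |k x y| ≤ B)
    (hM : IsMercerSystem P k lam psi) {r : ℕ} (hr : ∀ i < r, 0 < lam i) :
    ∫ u, ‖toL2 P (g u) - mercerProj psi r (toL2 P (g u))‖ ^ 2 ∂μ =
      ∫ u, ‖toL2 P (g u)‖ ^ 2 ∂μ - ∑ i ∈ Finset.range r, lam i := by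
  have hi : ∀ i : Fin r, Integrable (fun u => ⟪psi i, toL2 P (g u)⟫ ^ 2) μ := fun i => by
    simp_rw [sq]; exact hg.integrable_inner_mul hk _ _
  simp_rw [hM.norm_sub_mercerProj_sq hr]
  rw [integral_sub (hg.integrable_norm_path_sq hk) (integrable_finsetSum _ fun i _ => hi i),
    integral_finsetSum _ fun i _ => hi i, Finset.sum_range]
  congr 1
  exact Finset.sum_congr rfl fun i _ => hg.integral_inner_psi_sq hk hM (hr i i.2)

lemma integrable_stdCoeff_mul (hg : IsCenteredGP μ k g) (hk : ∀ x y, |k x y| ≤ B) (r : ℕ)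
    (i j : Fin r) : Integrable (fun u => stdCoeff lam psi r (toL2 P (g u)) i *
      stdCoeff lam psi r (toL2 P (g u)) j) μ := by
  have := (hg.integrable_inner_mul hk (psi i) (psi j)).const_mul ((√(lam i))⁻¹ * (√(lam j))⁻¹)
  refine this.congr (ae_of_all _ fun u => ?_)
  simp only [stdCoeff_apply]; ring

/-- The standardized coefficients are uncorrelated with unit variance. -/
lemma integral_stdCoeff_mul (hg : IsCenteredGP μ k g) (hk : ∀ x y, |k x y| ≤ B)
    (hM : IsMercerSystem P k lam psi) {r : ℕ} (hr : ∀ i < r, 0 < lam i) (i j : Fin r) :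
    ∫ u, stdCoeff lam psi r (toL2 P (g u)) i * stdCoeff lam psi r (toL2 P (g u)) j ∂μ =
      if i = j then 1 else 0 := by
  have e : ∀ u, stdCoeff lam psi r (toL2 P (g u)) i * stdCoeff lam psi r (toL2 P (g u)) j =
      ((√(lam i))⁻¹ * (√(lam j))⁻¹) * (⟪psi i, toL2 P (g u)⟫ * ⟪psi j, toL2 P (g u)⟫) := fun u => by
    simp only [stdCoeff_apply]; ring
  simp_rw [e]
  rw [integral_const_mul, hg.integral_inner_mul hk, hM.integral_psi (hr i i.2),
    hM.inner_psi_of_pos (hr i i.2) (hr j j.2)]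
  by_cases h : i = j
  · subst h
    have h1 := Real.sqrt_pos.2 (hr i i.2)
    have h2 := Real.sq_sqrt (hr i i.2).le
    simp only [if_true, mul_one]
    rw [← h2, Real.sqrt_sq h1.le]
    field_simp
  · have : (i : ℕ) ≠ j := fun h' => h (Fin.ext h')
    simp [h, this]

/-- Linear combinations of the standardized coefficients are Gaussian. -/
lemma map_inner_stdCoeff (hg : IsCenteredGP μ k g) (hk : ∀ x y, |k x y| ≤ B)
    (hM : IsMercerSystem P k lam psi) {r : ℕ} (hr : ∀ i < r, 0 < lam i)
    (x : EuclideanSpace ℝ (Fin r)) :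
    μ.map (fun u => ⟪x, stdCoeff lam psi r (toL2 P (g u))⟫) =
      gaussianReal 0 (‖x‖ ^ 2).toNNReal := by
  let f : Lp ℝ 2 P := ∑ i : Fin r, (x i * (√(lam i))⁻¹) • psi i
  have e : ∀ h : Lp ℝ 2 P, ⟪x, stdCoeff lam psi r h⟫ = ⟪f, h⟫ := fun h => by
    simp only [PiLp.inner_apply, stdCoeff_apply, f, sum_inner, inner_smul_left]
    refine Finset.sum_congr rfl fun i _ => ?_
    simp; ring
  have hv : ∫ u, ⟪f, toL2 P (g u)⟫ * ⟪f, toL2 P (g u)⟫ ∂μ = ‖x‖ ^ 2 := by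
    simp_rw [← e, PiLp.inner_apply, Finset.sum_mul_sum]
    rw [integral_finsetSum]
    · rw [EuclideanSpace.real_norm_sq_eq]
      refine Finset.sum_congr rfl fun i _ => ?_
      rw [integral_finsetSum]
      · rw [Finset.sum_eq_single i]
        · have h1 := hg.integral_stdCoeff_mul hk hM hr i i
          rw [if_pos rfl] at h1
          have h2 : ∀ a : ℝ, ⟪x i, a⟫ * ⟪x i, a⟫ = x i ^ 2 * (a * a) := fun a => by
            simp; ring
          simp_rw [h2]
          rw [integral_const_mul, h1, mul_one]
        · intro j _ hji
          have h1 := hg.integral_stdCoeff_mul hk hM hr i j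
          rw [if_neg (Ne.symm hji)] at h1
          have h2 : ∀ a a' : ℝ, ⟪x i, a⟫ * ⟪x j, a'⟫ = x i * x j * (a * a') := fun a a' => by
            simp; ring
          simp_rw [h2]
          rw [integral_const_mul, h1, mul_zero]
        · simp
      · intro j _
        refine ((hg.integrable_stdCoeff_mul (lam := lam) (psi := psi) hk r i j).const_mul
          (x i * x j)).congr (ae_of_all _ fun u => ?_)
        simp; ring
    · intro i _
      refine integrable_finsetSum _ fun j _ => ?_
      refine ((hg.integrable_stdCoeff_mul (lam := lam) (psi := psi) hk r i j).const_mul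
        (x i * x j)).congr (ae_of_all _ fun u => ?_)
      simp; ring
  simp_rw [e]
  rw [hg.map_inner_eq_gaussianReal hk, ← hg.integral_inner_mul hk, hv]

lemma aemeasurable_stdCoeff (hg : IsCenteredGP μ k g) (hk : ∀ x y, |k x y| ≤ B) (r : ℕ) :
    AEMeasurable (fun u => stdCoeff lam psi r (toL2 P (g u))) μ := by
  have h : AEMeasurable (fun u => fun i : Fin r => (√(lam i))⁻¹ * ⟪psi i, toL2 P (g u)⟫) μ :=
    aemeasurable_pi_lambda _ fun i => (hg.aemeasurable_inner hk (psi i)).const_mul _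
  exact (EuclideanSpace.equiv (Fin r) ℝ).symm.continuous.measurable.comp_aemeasurable h

end IsCenteredGP

/-! ### The norm of a projection in the reproducing kernel Hilbert space -/

section RKHSNorm

variable {X : Type*} [MeasurableSpace X] {P : Measure X} [IsProbabilityMeasure P]
  {H : Type*} [NormedAddCommGroup H] [InnerProductSpace ℝ H] [CompleteSpace H] [RKHS ℝ H X ℝ]
  {k : X → X → ℝ} {B : ℝ} {lam : ℕ → ℝ} {psi : ℕ → Lp ℝ 2 P}

lemma RKHS.apply_eq_inner_kerFun (F : H) (x : X) : F x = ⟪RKHS.kerFun H x 1, F⟫ := by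
  rw [RKHS.kerFun_inner]; simp

/-- Kernel sections are measurable and span a dense subspace, and convergence in the space implies
pointwise convergence. -/
lemma RKHS.measurable_coe (hker : ∀ x y, RKHS.kernel H x y 1 = k x y)
    (hkm : Measurable (Function.uncurry k)) (F : H) : Measurable ⇑F := by
  have hF : F ∈ (Submodule.span ℝ {RKHS.kerFun H x v | (x : X) (v : ℝ)}).topologicalClosure := by
    rw [RKHS.kerFun_dense]; trivial
  rw [← SetLike.mem_coe, Submodule.topologicalClosure_coe, mem_closure_iff_seq_limit] at hF
  obtain ⟨G, hG, hlim⟩ := hF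
  have hGm : ∀ n, Measurable ⇑(G n) := fun n => by
    refine Submodule.span_induction (p := fun (h : H) _ => Measurable ⇑h) ?_ ?_ ?_ ?_ (hG n)
    · rintro _ ⟨y, v, rfl⟩
      have e : ⇑(RKHS.kerFun H y v) = fun x => v * k x y := funext fun x => by
        rw [RKHS.kerFun_apply, ← hker x y, ← smul_eq_mul, ← map_smul]; simp
      rw [e]
      exact hkm.of_uncurry_right.const_mul v
    · rw [RKHS.coe_zero]; exact measurable_const
    · intro a b _ _ ha hb
      rw [RKHS.coe_add]; exact ha.add hb
    · intro c a _ ha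
      rw [RKHS.coe_smul]; exact ha.const_smul c
  refine measurable_of_tendsto_metrizable hGm (tendsto_pi_nhds.2 fun x => ?_)
  exact ((RKHS.continuous_eval x).tendsto F).comp hlim

lemma RKHS.abs_apply_le (hker : ∀ x y, RKHS.kernel H x y 1 = k x y)
    (hk : ∀ x y, |k x y| ≤ B) (F : H) (x : X) : |F x| ≤ ‖F‖ * √B := by
  have h1 := RKHS.norm_apply_le F x
  have h2 : ‖RKHS.kernel H x x‖ ≤ B := by
    refine ContinuousLinearMap.opNorm_le_bound _ ((abs_nonneg _).trans (hk x x)) fun v => ?_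
    have e : RKHS.kernel H x x v = v * k x x := by
      rw [← hker x x, ← smul_eq_mul, ← map_smul]; simp
    rw [e, norm_mul, mul_comm, Real.norm_eq_abs]
    exact mul_le_mul_of_nonneg_right (hk x x) (norm_nonneg _)
  exact h1.trans (mul_le_mul_of_nonneg_left (Real.sqrt_le_sqrt h2) (norm_nonneg _))

/-- The adjoint of the inclusion of the reproducing kernel Hilbert space into `L²(P)`. -/
lemma RKHS.exists_inner_eq_integral (hker : ∀ x y, RKHS.kernel H x y 1 = k x y)
    (hkm : Measurable (Function.uncurry k)) (hk : ∀ x y, |k x y| ≤ B) (f : Lp ℝ 2 P) :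
    ∃ S : H, ∀ F : H, ⟪S, F⟫ = ∫ x, f x * F x ∂P := by
  have hf := (Lp.memLp f).integrable one_le_two
  have hint : ∀ F : H, Integrable (fun x => f x * F x) P := fun F =>
    hf.mul_bdd (c := ‖F‖ * √B) (RKHS.measurable_coe hker hkm F).aestronglyMeasurable
      (ae_of_all _ fun x => RKHS.abs_apply_le hker hk F x)
  let ℓ : H →ₗ[ℝ] ℝ :=
    { toFun := fun F => ∫ x, f x * F x ∂P
      map_add' := fun F G => by
        rw [← integral_add (hint F) (hint G)]
        simp [RKHS.coe_add, mul_add]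
      map_smul' := fun c F => by
        simp only [RKHS.coe_smul, Pi.smul_apply, smul_eq_mul, RingHom.id_apply]
        rw [← integral_const_mul]
        congr 1; ext x; ring }
  let L : H →L[ℝ] ℝ := ℓ.mkContinuous (√B * ∫ x, ‖f x‖ ∂P) fun F => by
    change ‖∫ x, f x * F x ∂P‖ ≤ _
    refine (norm_integral_le_integral_norm _).trans ?_
    calc ∫ x, ‖f x * F x‖ ∂P ≤ ∫ x, ‖f x‖ * (‖F‖ * √B) ∂P := by
          refine integral_mono (hint F).norm (hf.norm.mul_const _) fun x => ?_
          rw [norm_mul]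
          exact mul_le_mul_of_nonneg_left (RKHS.abs_apply_le hker hk F x) (norm_nonneg _)
      _ = √B * (∫ x, ‖f x‖ ∂P) * ‖F‖ := by rw [integral_mul_const]; ring
  refine ⟨(InnerProductSpace.toDual ℝ H).symm L, fun F => ?_⟩
  rw [InnerProductSpace.toDual_symm_apply]
  rfl

/-- The adjoint of the inclusion into `L²(P)` sends `psi i` to a function `S i` that equals `lam i *
psi i` almost everywhere, and the `S i / √(lam i)` are orthonormal in `H`. Expanding in them gives a
representative of norm `‖stdCoeff lam psi r f‖`. Every other representative has the same
coefficients, so Bessel makes this norm minimal. -/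
lemma rkhsNorm_mercerProj (hker : ∀ x y, RKHS.kernel H x y 1 = k x y)
    (hkm : Measurable (Function.uncurry k)) (hk : ∀ x y, |k x y| ≤ B)
    (hM : IsMercerSystem P k lam psi) {r : ℕ} (hr : ∀ i < r, 0 < lam i) (f : Lp ℝ 2 P) :
    rkhsNorm P H (mercerProj psi r f) = ‖stdCoeff lam psi r f‖ := by
  choose S hS using fun i => RKHS.exists_inner_eq_integral (H := H) (P := P) hker hkm hk (psi i)
  have hSx : ∀ i x, (S i) x = ∫ y, k x y * psi i y ∂P := fun i x => by
    rw [RKHS.apply_eq_inner_kerFun, real_inner_comm, hS]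
    congr 1; ext y
    rw [RKHS.kerFun_apply, mul_comm]
    congr 1
    have h1 := hker x y
    rw [← hker x y]
    have h2 : ∀ a b : X, RKHS.kernel H a b 1 = ⟪RKHS.kerFun H a 1, RKHS.kerFun H b 1⟫ := fun a b => by
      rw [RKHS.kerFun_inner, RKHS.kerFun_apply]; simp
    rw [h2, h2, real_inner_comm]
  -- the functions `S i / lam i` represent the eigenfunctions
  have hSae : ∀ i, 0 < lam i → ⇑(S i) =ᵐ[P] fun x => lam i * psi i x := fun i hi => by
    obtain ⟨Tf, hTf, hs⟩ := hM.expansion (psi i)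
    have hT : Tf = lam i • psi i := by
      refine hs.unique ?_
      convert hasSum_single (f := fun j => (lam j * ⟪psi j, psi i⟫) • psi j) i ?_ using 1
      · rw [hM.inner_psi_of_pos hi hi, if_pos rfl, mul_one]
      · intro j hj
        rcases (hM.nonneg j).eq_or_lt with h0 | h0
        · simp [← h0]
        · simp [hM.inner_psi_of_pos h0 hi, hj]
    subst hT
    filter_upwards [hTf, Lp.coeFn_smul (lam i) (psi i)] with x h1 h2
    rw [hSx, ← h1, h2]; rfl
  have hSin : ∀ i, 0 < lam i → ∀ j, ⟪S j, S i⟫ = lam i * ⟪psi j, psi i⟫ := fun i hi j => by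
    rw [hS, L2.inner_def, ← integral_const_mul]
    refine integral_congr_ae ?_
    filter_upwards [hSae i hi] with x hx
    rw [hx]; simp; ring
  let e : Fin r → H := fun i => (√(lam i))⁻¹ • S i
  have he : Orthonormal ℝ e := by
    rw [orthonormal_iff_ite]
    intro i j
    have hi := hr i i.2
    have hj := hr j j.2
    simp only [e, inner_smul_left, inner_smul_right, RCLike.conj_to_real]
    rw [hSin j hj, hM.inner_psi_of_pos hi hj]
    by_cases h : i = j
    · subst h
      have h1 := Real.sqrt_pos.2 hi
      have h2 := Real.sq_sqrt hi.le
      simp only [if_true, mul_one]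
      nth_rewrite 3 [← h2]
      field_simp
    · have : (i : ℕ) ≠ j := fun h' => h (Fin.ext h')
      simp [h, this]
  set a := stdCoeff lam psi r f with ha
  have hproj := mercerProj_eq_stdCoeff (psi := psi) hr f
  have hmem : ‖a‖ ∈ {t : ℝ | ∃ F : H, (⇑F =ᵐ[P] ⇑(mercerProj psi r f)) ∧ t = ‖F‖} := by
    refine ⟨∑ i, a i • e i, ?_, ?_⟩
    · have h1 : ∀ᵐ x ∂P, ∀ i : Fin r, S i x = lam i * psi i x := by
        rw [ae_all_iff]; exact fun i => hSae i (hr i i.2)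
      have h2 : ∀ᵐ x ∂P, ∀ i : Fin r, ((√(lam i) * a i) • psi i : Lp ℝ 2 P) x =
          (√(lam i) * a i) * psi i x := by
        rw [ae_all_iff]; exact fun i => Lp.coeFn_smul _ _
      have h3 : ⇑(mercerProj psi r f) =ᵐ[P]
          fun x => ∑ i : Fin r, ((√(lam i) * a i) • psi i : Lp ℝ 2 P) x := by
        rw [hproj]
        exact Lp.coeFn_fun_finsetSum _ _
      have h4 : ∀ x, (∑ i, a i • e i : H) x = ∑ i, a i * ((√(lam i))⁻¹ * S i x) := fun x => by
        rw [RKHS.apply_eq_inner_kerFun, inner_sum]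
        refine Finset.sum_congr rfl fun i _ => ?_
        rw [inner_smul_right, inner_smul_right, ← RKHS.apply_eq_inner_kerFun]
      filter_upwards [h1, h2, h3] with x h1 h2 h3
      rw [h3, h4]
      refine Finset.sum_congr rfl fun i _ => ?_
      rw [h2, h1]
      have h5 := Real.sqrt_pos.2 (hr i i.2)
      have h6 := Real.sq_sqrt (hr i i.2).le
      nth_rewrite 2 [← h6]
      field_simp
    · have h1 : ‖∑ i, a i • e i‖ ^ 2 = ‖a‖ ^ 2 := by
        rw [← real_inner_self_eq_norm_sq, he.inner_sum, EuclideanSpace.real_norm_sq_eq]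
        simp [sq]
      exact ((sq_eq_sq₀ (norm_nonneg _) (norm_nonneg _)).1 h1).symm
  have hlow : ‖a‖ ∈ lowerBounds
      {t : ℝ | ∃ F : H, (⇑F =ᵐ[P] ⇑(mercerProj psi r f)) ∧ t = ‖F‖} := by
    rintro _ ⟨F, hF, rfl⟩
    have hin : ∀ i : Fin r, ⟪e i, F⟫ = a i := fun i => by
      have h1 : ⟪S i, F⟫ = ⟪psi i, f⟫ := by
        rw [hS]
        have h2 : ⟪psi i, mercerProj psi r f⟫ = ⟪psi i, f⟫ := by
          rw [IsMercerSystem.mercerProj_eq_sum_fin]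
          exact (hM.orthonormal_fin hr).inner_right_fintype (fun i : Fin r => ⟪psi i, f⟫) i
        rw [← h2, L2.inner_def]
        refine integral_congr_ae ?_
        filter_upwards [hF] with x hx
        rw [hx]; simp; ring
      simp only [e, inner_smul_left, RCLike.conj_to_real, h1, ha, stdCoeff_apply]
    refine (sq_le_sq₀ (norm_nonneg _) (norm_nonneg _)).1 ?_
    have hb := he.sum_inner_products_le (x := F) (s := Finset.univ)
    simp_rw [hin, Real.norm_eq_abs, sq_abs] at hb
    rwa [EuclideanSpace.real_norm_sq_eq]
  exact (IsLeast.csInf_eq ⟨hmem, hlow⟩)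

end RKHSNorm

/-! ### Nets of the unit ball -/

section Net

variable {E : Type*} [NormedAddCommGroup E] [NormedSpace ℝ E] [FiniteDimensional ℝ E]

/-- A half-separated subset of the unit ball of maximal cardinality is a half-net. Volume comparison
bounds the cardinality of all separated subsets. -/
lemma exists_half_net : ∃ N : Finset E, N.card ≤ 5 ^ Module.finrank ℝ E ∧ (∀ y ∈ N, ‖y‖ ≤ 1) ∧
    ∀ x : E, ‖x‖ ≤ 1 → ∃ y ∈ N, ‖x - y‖ ≤ 1 / 2 := by
  classical
  let V : Finset E → Prop := fun s => (∀ c ∈ s, ‖c‖ ≤ 1) ∧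
    ∀ c ∈ s, ∀ d ∈ s, c ≠ d → 1 / 2 ≤ ‖c - d‖
  have hV : ∀ s, V s → s.card ≤ 5 ^ Module.finrank ℝ E := fun s hs => by
    have hinj : Function.Injective fun c : E => (2 : ℝ) • c :=
      smul_right_injective E (two_ne_zero)
    rw [← Finset.card_image_of_injective s hinj]
    refine Besicovitch.card_le_of_separated _ ?_ ?_
    · intro c' hc'
      obtain ⟨c, hc, rfl⟩ := Finset.mem_image.1 hc'
      rw [norm_smul, Real.norm_two]
      linarith [hs.1 c hc]
    · intro c' hc' d' hd' hcd
      obtain ⟨c, hc, rfl⟩ := Finset.mem_image.1 hc'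
      obtain ⟨d, hd, rfl⟩ := Finset.mem_image.1 hd'
      rw [← smul_sub, norm_smul, Real.norm_two]
      linarith [hs.2 c hc d hd fun h => hcd (by rw [h])]
  let p : ℕ → Prop := fun n => ∃ s, V s ∧ s.card = n
  have hp0 : p 0 := ⟨∅, ⟨by simp, by simp⟩, rfl⟩
  obtain ⟨s, hs, hcard⟩ : p (Nat.findGreatest p (5 ^ Module.finrank ℝ E)) :=
    Nat.findGreatest_spec (Nat.zero_le _) hp0
  refine ⟨s, hV s hs, hs.1, fun x hx => ?_⟩
  by_contra! hcon
  have hxs : x ∉ s := fun h => by have := hcon x h; norm_num at this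
  have hins : V (insert x s) := by
    constructor
    · intro c hc
      rcases Finset.mem_insert.1 hc with rfl | hc
      exacts [hx, hs.1 c hc]
    · intro c hc d hd hcd
      rcases Finset.mem_insert.1 hc with rfl | hc' <;> rcases Finset.mem_insert.1 hd with rfl | hd'
      · exact absurd rfl hcd
      · exact (hcon d hd').le
      · rw [norm_sub_rev]; exact (hcon c hc').le
      · exact hs.2 c hc' d hd' hcd
  have h1 := Nat.le_findGreatest (P := p) (hV _ hins) ⟨_, hins, rfl⟩
  rw [Finset.card_insert_of_notMem hxs, hcard] at h1
  lia

/-- Rescale the half-net and add it to the previous net: each refinement halves the radius and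
multiplies the cardinality by at most `5 ^ finrank`. -/
lemma exists_dyadic_net (n : ℕ) : ∃ N : Finset E, N.card ≤ 5 ^ (n * Module.finrank ℝ E) ∧
    ∀ x : E, ‖x‖ ≤ 1 → ∃ y ∈ N, ‖x - y‖ ≤ (1 / 2) ^ n := by
  classical
  obtain ⟨M, hM, -, hMnet⟩ := exists_half_net (E := E)
  induction n with
  | zero => exact ⟨{0}, by simp, fun x hx => ⟨0, by simp, by simpa using hx⟩⟩
  | succ n ih =>
    obtain ⟨N, hN, hnet⟩ := ih
    refine ⟨Finset.image₂ (fun y w => y + ((1 : ℝ) / 2) ^ n • w) N M, ?_, fun x hx => ?_⟩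
    · refine (Finset.card_image₂_le _ _ _).trans ((Nat.mul_le_mul hN hM).trans_eq ?_)
      rw [← pow_add]; congr 1; ring
    · obtain ⟨y, hy, hxy⟩ := hnet x hx
      have hpos : (0 : ℝ) < (1 / 2) ^ n := by positivity
      obtain ⟨w, hw, hxw⟩ := hMnet (((1 / 2 : ℝ) ^ n)⁻¹ • (x - y)) (by
        rw [norm_smul, norm_inv, Real.norm_of_nonneg hpos.le]
        exact (inv_mul_le_one₀ hpos).2 hxy)
      refine ⟨_, Finset.mem_image₂_of_mem hy hw, ?_⟩
      have e : x - (y + ((1 : ℝ) / 2) ^ n • w) =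
          ((1 : ℝ) / 2) ^ n • ((((1 : ℝ) / 2) ^ n)⁻¹ • (x - y) - w) := by
        rw [smul_sub, smul_inv_smul₀ hpos.ne']; abel
      rw [e, norm_smul, Real.norm_of_nonneg hpos.le, pow_succ]
      exact mul_le_mul_of_nonneg_left hxw hpos.le

end Net

/-! ### Gaussian estimates -/

lemma gaussianReal_abs_lt_le (a : ℝ) :
    gaussianReal 0 1 {x | |x| < a} ≤ ENNReal.ofReal (2 * a) := by
  rw [gaussianReal_apply 0 one_ne_zero]
  calc ∫⁻ x in {x | |x| < a}, gaussianPDF 0 1 x ≤ ∫⁻ _ in {x | |x| < a}, 1 := by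
        refine lintegral_mono fun x => ?_
        rw [gaussianPDF, gaussianPDFReal_def]
        refine ENNReal.ofReal_le_one.2 (mul_le_one₀ ?_ (by positivity) ?_)
        · refine inv_le_one_of_one_le₀ (Real.one_le_sqrt.2 ?_)
          have := Real.pi_gt_three
          simp; linarith
        · rw [Real.exp_le_one_iff]
          exact div_nonpos_of_nonpos_of_nonneg (by nlinarith [sq_nonneg (x - 0)]) (by positivity)
    _ = ENNReal.ofReal (2 * a) := by
        have e : {x : ℝ | |x| < a} = Set.Ioo (-a) a := by
          ext x; simp [abs_lt]
        rw [setLIntegral_one, e, Real.volume_Ioo]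
        congr 1; ring

/-- Tilting by `exp (x ^ 2 / 4)` turns the standard density into `√2` times the density of variance
`2`. -/
lemma lintegral_exp_sq_gaussianReal_le :
    ∫⁻ x, ENNReal.ofReal (Real.exp (x ^ 2 / 4)) ∂(gaussianReal 0 1) ≤ 2 := by
  rw [gaussianReal_of_var_ne_zero 0 one_ne_zero,
    lintegral_withDensity_eq_lintegral_mul _ (measurable_gaussianPDF 0 1) (by fun_prop)]
  have e : ∀ x : ℝ, (gaussianPDF 0 1 * fun x => ENNReal.ofReal (Real.exp (x ^ 2 / 4))) x =
      ENNReal.ofReal (√2) * gaussianPDF 0 2 x := fun x => by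
    rw [Pi.mul_apply, gaussianPDF, gaussianPDF, ← ENNReal.ofReal_mul (gaussianPDFReal_nonneg _ _ _),
      ← ENNReal.ofReal_mul (Real.sqrt_nonneg _)]
    congr 1
    rw [gaussianPDFReal_def, gaussianPDFReal_def]
    simp only [sub_zero, NNReal.coe_one, mul_one, NNReal.coe_ofNat]
    rw [mul_assoc, ← Real.exp_add, ← mul_assoc]
    congr 1
    · rw [show 2 * Real.pi * 2 = 2 * (2 * Real.pi) by ring, Real.sqrt_mul (by norm_num) (2 * _),
        mul_inv, ← mul_assoc, mul_inv_cancel₀ (by positivity), one_mul]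
    · congr 1; ring
  simp_rw [e]
  rw [lintegral_const_mul _ (measurable_gaussianPDF 0 2), lintegral_gaussianPDF_eq_one 0 two_ne_zero,
    mul_one]
  refine ENNReal.ofReal_le_of_le_toReal ?_
  rw [ENNReal.toReal_ofNat]
  exact Real.sqrt_le_iff.2 ⟨by norm_num, by norm_num⟩

section Gaussian

variable {U : Type*} [MeasurableSpace U] {μ : Measure U} [IsProbabilityMeasure μ] {Y : U → ℝ}
  {s : ℝ}

lemma map_eq_of_gaussianReal_sq (s : ℝ)
    (hG : μ.map Y = gaussianReal 0 (s ^ 2).toNNReal) :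
    μ.map Y = (gaussianReal 0 1).map (s * ·) := by
  rw [hG, gaussianReal_map_const_mul, mul_zero, mul_one]
  congr 1
  ext
  rw [Real.coe_toNNReal _ (sq_nonneg s)]; rfl

lemma measure_abs_lt_le (hY : Measurable Y) (hs : 1 / 2 ≤ s)
    (hG : μ.map Y = gaussianReal 0 (s ^ 2).toNNReal) (a : ℝ) :
    μ {u | |Y u| < a} ≤ ENNReal.ofReal (4 * a) := by
  have hm : MeasurableSet {x : ℝ | |x| < a} := measurableSet_lt (by fun_prop) measurable_const
  have e : μ {u | |Y u| < a} = μ.map Y {x | |x| < a} := (Measure.map_apply hY hm).symm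
  rw [e, map_eq_of_gaussianReal_sq s hG, Measure.map_apply (by fun_prop) hm]
  refine (measure_mono ?_).trans ((gaussianReal_abs_lt_le (2 * a)).trans_eq ?_)
  · intro x hx
    simp only [Set.mem_preimage, Set.mem_ofPred_eq, abs_mul] at hx ⊢
    rw [abs_of_nonneg (by linarith : 0 ≤ s)] at hx
    nlinarith [abs_nonneg x]
  · congr 1; ring

lemma lintegral_exp_sq_le (hY : Measurable Y) (hs : 0 ≤ s) (hs1 : s ≤ 1)
    (hG : μ.map Y = gaussianReal 0 (s ^ 2).toNNReal) :
    ∫⁻ u, ENNReal.ofReal (Real.exp (Y u ^ 2 / 4)) ∂μ ≤ 2 := by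
  have hm : Measurable fun x : ℝ => ENNReal.ofReal (Real.exp (x ^ 2 / 4)) := by fun_prop
  rw [← lintegral_map hm hY, map_eq_of_gaussianReal_sq s hG, lintegral_map hm (by fun_prop)]
  refine le_trans (lintegral_mono fun x => ?_) lintegral_exp_sq_gaussianReal_le
  refine ENNReal.ofReal_le_ofReal (Real.exp_le_exp.2 ?_)
  rw [mul_pow]
  have : s ^ 2 ≤ 1 := pow_le_one₀ hs hs1
  nlinarith [sq_nonneg x]

end Gaussian

/-! ### Empirical lower bounds for Gaussian vectors -/

section RandomMatrix

variable {U : Type*} [MeasurableSpace U] {μ : Measure U} [IsProbabilityMeasure μ] {m r : ℕ}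

/-- The Chernoff bound used for both nets: by independence the mean of the product is at most `2 ^
m`. -/
lemma pi_measure_prod_ge_le {f : U → ℝ≥0∞} (hf : Measurable f) (h2 : ∫⁻ u, f u ∂μ ≤ 2)
    {a : ℝ≥0∞} (ha : a ≠ 0) (ha' : a ≠ ⊤) :
    (Measure.pi fun _ : Fin m => μ) {u | a ≤ ∏ j, f (u j)} ≤ 2 ^ m / a := by
  have hm : ∀ j : Fin m, Measurable fun u : Fin m → U => f (u j) :=
    fun j => hf.comp (measurable_pi_apply j)
  refine (meas_ge_le_lintegral_div (Finset.measurable_fun_prod _ fun j _ => hm j).aemeasurable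
    ha ha').trans ?_
  gcongr
  rw [lintegral_prod_eq_prod_lintegral_of_indepFun Finset.univ (fun (j : Fin m) (u : Fin m → U) => f (u j))
    (iIndepFun_pi (X := fun _ => f) fun _ => hf.aemeasurable) hm]
  calc ∏ j : Fin m, ∫⁻ u, f (u j) ∂(Measure.pi fun _ : Fin m => μ) ≤ ∏ _j : Fin m, 2 := by
        refine Finset.prod_le_prod' fun j _ => ?_
        rw [(measurePreserving_eval (fun _ : Fin m => μ) j).lintegral_comp hf]
        exact h2
    _ = 2 ^ m := by simp

/-- If all points of a half-net and of a fine net behave well, then no direction is hit weakly by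
more than a quarter of the vectors. -/
lemma card_weak_le_of_nets {v : Fin m → EuclideanSpace ℝ (Fin r)}
    {N₁ N₂ : Finset (EuclideanSpace ℝ (Fin r))}
    (hN₁ : ∀ x : EuclideanSpace ℝ (Fin r), ‖x‖ ≤ 1 → ∃ y ∈ N₁, ‖x - y‖ ≤ 1 / 2)
    (hN₂ : ∀ x : EuclideanSpace ℝ (Fin r), ‖x‖ ≤ 1 → ∃ y ∈ N₂, ‖x - y‖ ≤ (1 / 2) ^ 48)
    (h₁ : ∀ y ∈ N₁, ∑ j, ⟪y, v j⟫ ^ 2 ≤ 16 * m)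
    (h₂ : ∀ y ∈ N₂, 1 / 2 ≤ ‖y‖ →
      8 * (Finset.univ.filter fun j => |⟪y, v j⟫| < 2 * (1 / 2) ^ 43).card ≤ m)
    (x : EuclideanSpace ℝ (Fin r)) :
    4 * (Finset.univ.filter fun j => |⟪x, v j⟫| < (1 / 2) ^ 43 * ‖x‖).card ≤ m := by
  let L : EuclideanSpace ℝ (Fin r) →L[ℝ] EuclideanSpace ℝ (Fin m) :=
    (EuclideanSpace.equiv (Fin m) ℝ).symm.toContinuousLinearMap ∘L
      ContinuousLinearMap.pi fun j => innerSL ℝ (v j)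
  have hL : ∀ x, ‖L x‖ ^ 2 = ∑ j, ⟪x, v j⟫ ^ 2 := fun x => by
    rw [EuclideanSpace.real_norm_sq_eq]
    refine Finset.sum_congr rfl fun j _ => ?_
    rw [real_inner_comm]; rfl
  -- The usual net bound for an operator norm: the error of a half-net is at most `‖L‖ / 2`, which
  -- is absorbed on the left.
  have hLN : ‖L‖ ≤ 8 * √m := by
    have h0 : ‖L‖ ≤ 4 * √m + ‖L‖ / 2 := by
      refine ContinuousLinearMap.opNorm_le_of_unit_norm (by positivity) fun x hx => ?_
      obtain ⟨y, hy, hxy⟩ := hN₁ x hx.le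
      have h3 : ‖L y‖ ≤ 4 * √m := by
        refine (sq_le_sq₀ (norm_nonneg _) (by positivity)).1 ?_
        rw [hL, mul_pow, Real.sq_sqrt (by positivity)]
        linarith [h₁ y hy]
      calc ‖L x‖ = ‖L y + L (x - y)‖ := by rw [← map_add]; congr 2; abel
        _ ≤ ‖L y‖ + ‖L (x - y)‖ := norm_add_le _ _
        _ ≤ 4 * √m + ‖L‖ * (1 / 2) := add_le_add h3
            ((L.le_opNorm _).trans (mul_le_mul_of_nonneg_left hxy (norm_nonneg _)))
        _ = _ := by ring
    linarith
  have hunit : ∀ x : EuclideanSpace ℝ (Fin r), ‖x‖ = 1 →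
      4 * (Finset.univ.filter fun j => |⟪x, v j⟫| < (1 / 2) ^ 43).card ≤ m := fun x hx => by
    obtain ⟨y, hy, hxy⟩ := hN₂ x hx.le
    have hy2 : 1 / 2 ≤ ‖y‖ := by
      have h3 : ‖x‖ ≤ ‖x - y‖ + ‖y‖ := by simpa using norm_add_le (x - y) y
      have h4 : ((1 : ℝ) / 2) ^ 48 ≤ 1 / 2 := by norm_num
      linarith
    have h5 := h₂ y hy hy2
    set S₂ := Finset.univ.filter fun j => |⟪y, v j⟫| < 2 * (1 / 2) ^ 43 with hS₂
    set S₃ := Finset.univ.filter fun j => ((1 : ℝ) / 2) ^ 43 ≤ |⟪x - y, v j⟫| with hS₃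
    -- The sum of the squares `⟪x - y, v j⟫ ^ 2` is at most `64 * m * 2 ^ (-96)`, so at most `m /
    -- 16` of them reach `2 ^ (-86)`. This is why the net radius is `2 ^ (-48)` when the threshold
    -- is `2 ^ (-43)`.
    have h6 : 8 * S₃.card ≤ m := by
      have h7 : (S₃.card : ℝ) * ((1 / 2) ^ 43) ^ 2 ≤ ‖L (x - y)‖ ^ 2 := by
        rw [hL, ← nsmul_eq_mul, ← Finset.sum_const]
        refine (Finset.sum_le_sum fun j hj => ?_).trans
          (Finset.sum_le_sum_of_subset_of_nonneg (Finset.subset_univ S₃)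
            fun j _ _ => sq_nonneg ⟪x - y, v j⟫)
        rw [← sq_abs ⟪x - y, v j⟫]
        exact pow_le_pow_left₀ (by positivity) (Finset.mem_filter.1 hj).2 2
      have h8 : ‖L (x - y)‖ ≤ 8 * √m * (1 / 2) ^ 48 :=
        (L.le_opNorm _).trans (mul_le_mul hLN hxy (norm_nonneg _) (by positivity))
      have h9 : ‖L (x - y)‖ ^ 2 ≤ 64 * m * ((1 / 2) ^ 48) ^ 2 := by
        refine (pow_le_pow_left₀ (norm_nonneg _) h8 2).trans_eq ?_
        rw [mul_pow, mul_pow, Real.sq_sqrt (by positivity)]; ring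
      have h10 := h7.trans h9
      have h11 : (8 * S₃.card : ℝ) ≤ m := by
        norm_num at h10 ⊢
        have : (0 : ℝ) ≤ m := Nat.cast_nonneg m
        linarith
      exact_mod_cast h11
    have hsub : (Finset.univ.filter fun j => |⟪x, v j⟫| < (1 / 2) ^ 43) ⊆
        S₂ ∪ S₃ := by
      intro j hj
      rw [Finset.mem_union, hS₂, hS₃, Finset.mem_filter, Finset.mem_filter]
      have hj := (Finset.mem_filter.1 hj).2
      by_contra! hc
      have h1 := hc.1 (Finset.mem_univ _)
      have h2 := hc.2 (Finset.mem_univ _)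
      have h3 : ⟪x, v j⟫ = ⟪y, v j⟫ + ⟪x - y, v j⟫ := by rw [← inner_add_left]; congr 1; abel
      have h4 : |⟪y, v j⟫| ≤ |⟪x, v j⟫| + |⟪x - y, v j⟫| := by
        have h5 : ⟪y, v j⟫ = ⟪x, v j⟫ - ⟪x - y, v j⟫ := by rw [h3]; ring
        rw [h5]; exact abs_sub _ _
      linarith
    exact (Nat.mul_le_mul_left 4 ((Finset.card_le_card hsub).trans
      (Finset.card_union_le _ _))).trans (by lia)
  rcases eq_or_ne x 0 with rfl | hx
  · simp
  · have hxn : 0 < ‖x‖ := norm_pos_iff.2 hx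
    have h := hunit (‖x‖⁻¹ • x) (by rw [norm_smul, norm_inv, norm_norm, inv_mul_cancel₀ hxn.ne'])
    have e : (Finset.univ.filter fun j => |⟪x, v j⟫| < (1 / 2) ^ 43 * ‖x‖) =
        Finset.univ.filter fun j => |⟪‖x‖⁻¹ • x, v j⟫| < (1 / 2) ^ 43 :=
      Finset.filter_congr fun j _ => by
        rw [inner_smul_left, abs_mul, RCLike.conj_to_real, abs_of_pos (inv_pos.2 hxn),
          inv_mul_lt_iff₀ hxn, mul_comm]
    rwa [e]

/-- With probability at least `1 - 2 * 2 ^ (-m)`, no direction is hit weakly by more than a quarter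
of `m` independent Gaussian vectors in dimension at most `m / 128`. -/
lemma pi_measure_exists_weak_le {X : U → EuclideanSpace ℝ (Fin r)} (hX : Measurable X)
    (hG : ∀ x, μ.map (fun u => ⟪x, X u⟫) = gaussianReal 0 (‖x‖ ^ 2).toNNReal)
    (hrm : 128 * r ≤ m) :
    (Measure.pi fun _ : Fin m => μ) {u | ¬ ∀ x : EuclideanSpace ℝ (Fin r),
      4 * (Finset.univ.filter fun j => |⟪x, X (u j)⟫| < (1 / 2) ^ 43 * ‖x‖).card ≤ m} ≤
      2 * (2 ^ m)⁻¹ := by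
  have hmeas : ∀ x, Measurable fun u => ⟪x, X u⟫ := fun x => by fun_prop
  obtain ⟨N₁, hN₁, hN₁', hnet₁⟩ := exists_half_net (E := EuclideanSpace ℝ (Fin r))
  obtain ⟨N₂, hN₂, hnet₂⟩ := exists_dyadic_net (E := EuclideanSpace ℝ (Fin r)) 48
  rw [finrank_euclideanSpace_fin] at hN₁ hN₂
  -- The ratio `128` comes from here: `5 ^ 3 ≤ 2 ^ 7` makes the fine net at most `2 ^ (112 * r)`, so
  -- a union bound over it costs a factor of at most `2 ^ m`.
  have hpow : ((5 : ℕ) ^ (48 * r) : ℕ) ≤ 2 ^ m :=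
    calc (5 : ℕ) ^ (48 * r) = (5 ^ 3) ^ (16 * r) := by rw [← pow_mul]; congr 1; ring
      _ ≤ (2 ^ 7) ^ (16 * r) := Nat.pow_le_pow_left (by norm_num) _
      _ = 2 ^ (112 * r) := by rw [← pow_mul]; congr 1; ring
      _ ≤ 2 ^ m := Nat.pow_le_pow_right (by norm_num) (by lia)
  have hc₂ : N₂.card ≤ 2 ^ m := hN₂.trans hpow
  have hc₁ : N₁.card ≤ 2 ^ m :=
    hN₁.trans ((Nat.pow_le_pow_right (by norm_num) (by lia)).trans hpow)
  let S₁ : EuclideanSpace ℝ (Fin r) → Set (Fin m → U) := fun y =>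
    {u | ¬ ∑ j, ⟪y, X (u j)⟫ ^ 2 ≤ 16 * m}
  let S₂ : EuclideanSpace ℝ (Fin r) → Set (Fin m → U) := fun y => {u | ¬ (1 / 2 ≤ ‖y‖ →
    8 * (Finset.univ.filter fun j => |⟪y, X (u j)⟫| < 2 * (1 / 2) ^ 43).card ≤ m)}
  have hS₁ : ∀ y ∈ N₁, (Measure.pi fun _ : Fin m => μ) (S₁ y) ≤ 2 ^ m / (2 ^ m) ^ 4 := fun y hyN => by
    have hy := hN₁' y hyN
    refine (measure_mono ?_).trans (pi_measure_prod_ge_le (m := m)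
      (f := fun u => ENNReal.ofReal (Real.exp (⟪y, X u⟫ ^ 2 / 4))) (by fun_prop)
      (lintegral_exp_sq_le (hmeas y) (norm_nonneg y) hy (hG y)) (by simp) (by finiteness))
    intro u hu
    have hu' : 16 * (m : ℝ) < ∑ j, ⟪y, X (u j)⟫ ^ 2 := not_le.1 hu
    simp only [Set.mem_ofPred_eq]
    rw [← ENNReal.ofReal_prod_of_nonneg fun j _ => (Real.exp_pos _).le, ← Real.exp_sum,
      ← Finset.sum_div]
    have e : ((2 : ℝ≥0∞) ^ m) ^ 4 = ENNReal.ofReal (((2 : ℝ) ^ m) ^ 4) := by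
      rw [ENNReal.ofReal_pow (by positivity), ENNReal.ofReal_pow (by positivity),
        ENNReal.ofReal_ofNat]
    rw [e]
    refine ENNReal.ofReal_le_ofReal ?_
    rw [← pow_mul]
    calc (2 : ℝ) ^ (m * 4) ≤ Real.exp 1 ^ (m * 4) :=
          pow_le_pow_left₀ (by norm_num) (by linarith [Real.add_one_le_exp 1]) _
      _ = Real.exp (m * 4 : ℕ) := (Real.exp_one_pow _)
      _ ≤ _ := Real.exp_le_exp.2 (by push_cast; linarith)
  have hS₂ : ∀ y ∈ N₂, (Measure.pi fun _ : Fin m => μ) (S₂ y) ≤ 2 ^ m / (2 ^ m) ^ 4 := fun y _ => by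
    by_cases hy : 1 / 2 ≤ ‖y‖
    · set T : Set U := {u | |⟪y, X u⟫| < 2 * (1 / 2) ^ 43} with hT
      have hTm : MeasurableSet T := measurableSet_lt (hmeas y).abs measurable_const
      have hTle : μ T ≤ ENNReal.ofReal ((1 / 2) ^ 40) :=
        (measure_abs_lt_le (hmeas y) hy (hG y) _).trans
          (ENNReal.ofReal_le_ofReal (by norm_num))
      -- A weak hit has probability at most `2 ^ (-40)`, so this weight has mean at most `2`. If an
      -- eighth of the vectors hit weakly, the product of the weights is at least `2 ^ (5 * m)`,
      -- beyond the level `2 ^ (4 * m)`.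
      have hfm : Measurable fun u => 1 + T.indicator (fun _ => (2 : ℝ≥0∞) ^ 40) u :=
        (measurable_const.indicator hTm).const_add 1
      refine (measure_mono ?_).trans (pi_measure_prod_ge_le (m := m) hfm ?_ (by simp)
        (by finiteness))
      · intro u hu
        have hu' : m ≤ 8 * (Finset.univ.filter fun j => u j ∈ T).card := by
          by_contra hc
          exact hu fun _ => (not_le.1 hc).le
        simp only [Set.mem_ofPred_eq]
        calc ((2 : ℝ≥0∞) ^ m) ^ 4 = 2 ^ (m * 4) := (pow_mul _ _ _).symm
          _ ≤ 2 ^ (40 * (Finset.univ.filter fun j => u j ∈ T).card) :=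
              pow_le_pow_right₀ (by norm_num) (by lia)
          _ = ∏ j : Fin m, if u j ∈ T then (2 : ℝ≥0∞) ^ 40 else 1 := by
              rw [Finset.prod_ite, Finset.prod_const, Finset.prod_const_one, mul_one, pow_mul]
          _ ≤ _ := by
              refine Finset.prod_le_prod' fun j _ => ?_
              by_cases h : u j ∈ T <;> simp [h]
      · rw [lintegral_add_left measurable_const, lintegral_indicator_const hTm, lintegral_const,
          measure_univ, mul_one]
        refine (add_le_add_right (b := 2 ^ 40 * μ T) (c := 1) ?_ 1).trans_eq one_add_one_eq_two
        calc (2 : ℝ≥0∞) ^ 40 * μ T ≤ 2 ^ 40 * ENNReal.ofReal ((1 / 2) ^ 40) := by gcongr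
          _ = 1 := by
            rw [← ENNReal.ofReal_ofNat 2, ← ENNReal.ofReal_pow (by norm_num),
              ← ENNReal.ofReal_mul (by positivity)]
            norm_num
    · have e : S₂ y = ∅ := by
        ext u; simp only [S₂, hy, Set.mem_ofPred_eq]; simp
      rw [e, measure_empty]; exact zero_le
  have hunion : ∀ (N : Finset (EuclideanSpace ℝ (Fin r)))
      (S : EuclideanSpace ℝ (Fin r) → Set (Fin m → U)), N.card ≤ 2 ^ m →
      (∀ y ∈ N, (Measure.pi fun _ : Fin m => μ) (S y) ≤ 2 ^ m / (2 ^ m) ^ 4) →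
      (Measure.pi fun _ : Fin m => μ) (⋃ y ∈ N, S y) ≤ (2 ^ m)⁻¹ := fun N S hN hS => by
    have h1 : (1 : ℝ≥0∞) ≤ 2 ^ m := one_le_pow₀ (by norm_num)
    have h0 : (2 : ℝ≥0∞) ^ m ≠ 0 := by positivity
    have ht : (2 : ℝ≥0∞) ^ m ≠ ⊤ := by finiteness
    calc _ ≤ ∑ y ∈ N, (Measure.pi fun _ : Fin m => μ) (S y) := measure_biUnion_finset_le _ _
      _ ≤ ∑ _y ∈ N, (2 : ℝ≥0∞) ^ m / (2 ^ m) ^ 4 := Finset.sum_le_sum fun y hy => hS y hy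
      _ = N.card * ((2 : ℝ≥0∞) ^ m / (2 ^ m) ^ 4) := by rw [Finset.sum_const, nsmul_eq_mul]
      _ ≤ 2 ^ m * (2 ^ m / (2 ^ m) ^ 3) := by
          gcongr
          · exact_mod_cast hN
          · norm_num
      _ = (2 ^ m)⁻¹ := by
          generalize (2 : ℝ≥0∞) ^ m = a at h0 ht
          rw [← mul_div_assoc, ENNReal.div_eq_inv_mul, pow_succ, ← sq,
            ENNReal.mul_inv (Or.inl (pow_ne_zero 2 h0)) (Or.inl (ENNReal.pow_ne_top ht)),
            mul_comm (a ^ 2)⁻¹, mul_assoc,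
            ENNReal.inv_mul_cancel (pow_ne_zero 2 h0) (ENNReal.pow_ne_top ht), mul_one]
  calc _ ≤ (Measure.pi fun _ : Fin m => μ) ((⋃ y ∈ N₁, S₁ y) ∪ ⋃ y ∈ N₂, S₂ y) := by
        refine measure_mono fun u hu => ?_
        by_contra hc
        simp only [Set.mem_union, Set.mem_iUnion, not_or, not_exists] at hc
        exact hu fun x => card_weak_le_of_nets hnet₁ hnet₂ (fun y hy => not_not.1 (hc.1 y hy))
          (fun y hy => not_not.1 (hc.2 y hy)) x
    _ ≤ (2 ^ m)⁻¹ + (2 ^ m)⁻¹ := (measure_union_le _ _).trans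
        (add_le_add (hunion _ _ hc₁ hS₁) (hunion _ _ hc₂ hS₂))
    _ = 2 * (2 ^ m)⁻¹ := (two_mul _).symm

end RandomMatrix

/-! ### Linear algebra -/

/-- Project orthogonally onto the range of `L` and invert there. The norm of the inverse is
controlled by the lower bound on `L`. -/
lemma exists_leftInverse_of_lower_bound {E F : Type*} [NormedAddCommGroup E]
    [InnerProductSpace ℝ E] [FiniteDimensional ℝ E] [NormedAddCommGroup F] [InnerProductSpace ℝ F]
    [FiniteDimensional ℝ F] (L : E →L[ℝ] F) {s : ℝ} (hs : 0 < s) (hL : ∀ x, s * ‖x‖ ≤ ‖L x‖) :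
    ∃ N : F →L[ℝ] E, (∀ x, N (L x) = x) ∧ ∀ y, ‖N y‖ ≤ s⁻¹ * ‖y‖ := by
  have hinj : Function.Injective (L : E →ₗ[ℝ] F) := by
    rw [injective_iff_map_eq_zero]
    intro x hx
    have h := hL x
    rw [show L x = 0 from hx, norm_zero] at h
    exact norm_le_zero_iff.1 (nonpos_of_mul_nonpos_right h hs)
  let e := LinearEquiv.ofInjective (L : E →ₗ[ℝ] F) hinj
  let R := LinearMap.range (L : E →ₗ[ℝ] F)
  let N : F →ₗ[ℝ] E := e.symm.toLinearMap ∘ₗ (R.orthogonalProjectionOnto : F →L[ℝ] R).toLinearMap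
  have hLN : ∀ y, L (N y) = (R.orthogonalProjectionOnto y : F) := fun y => by
    have h := e.apply_symm_apply (R.orthogonalProjectionOnto y)
    exact congrArg Subtype.val h
  refine ⟨N.toContinuousLinearMap, fun x => ?_, fun y => ?_⟩
  · apply hinj
    change L (N (L x)) = L x
    rw [hLN]
    exact congrArg Subtype.val
      (Submodule.orthogonalProjectionOnto_mem_subspace_eq_self (K := R) ⟨L x, x, rfl⟩)
  · change ‖N y‖ ≤ _
    rw [← div_eq_inv_mul, le_div_iff₀ hs, mul_comm]
    refine (hL _).trans ?_
    rw [hLN]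
    exact R.norm_orthogonalProjectionOnto_apply_le y

/-- A bounded change of coefficients does not increase the Hilbert-Schmidt norm by more than the
square of its bound. -/
lemma sum_norm_sum_smul_sq_le {E : Type*} [NormedAddCommGroup E] [InnerProductSpace ℝ E] {m r : ℕ}
    (N : EuclideanSpace ℝ (Fin m) →L[ℝ] EuclideanSpace ℝ (Fin r)) {C : ℝ}
    (hN : ∀ y, ‖N y‖ ≤ C * ‖y‖) (d : Fin m → E) :
    ∑ i, ‖∑ j, N (EuclideanSpace.single j 1) i • d j‖ ^ 2 ≤ C ^ 2 * ∑ j, ‖d j‖ ^ 2 := by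
  let W := Submodule.span ℝ (Set.range d)
  have hd : ∀ j, d j ∈ W := fun j => Submodule.subset_span ⟨j, rfl⟩
  have : FiniteDimensional ℝ W := FiniteDimensional.span_of_finite ℝ (Set.finite_range d)
  -- In an orthonormal basis of the span of the `d j`, the sum of squares is taken row by row on one
  -- side and column by column on the other. Each column of coordinates is mapped by `N`.
  let b := stdOrthonormalBasis ℝ W
  have hb : ∀ v ∈ W, ‖v‖ ^ 2 = ∑ k, ⟪(b k : E), v⟫ ^ 2 := fun v hv => by
    have h := b.sum_sq_norm_inner_right ⟨v, hv⟩
    simp only [Real.norm_eq_abs, sq_abs] at h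
    exact h.symm
  let y : Fin (Module.finrank ℝ W) → EuclideanSpace ℝ (Fin m) := fun k =>
    WithLp.toLp 2 fun j => ⟪(b k : E), d j⟫
  have hy : ∀ k i, N (y k) i = ⟪(b k : E), ∑ j, N (EuclideanSpace.single j 1) i • d j⟫ :=
    fun k i => by
      have h1 : y k = ∑ j, ⟪(b k : E), d j⟫ • EuclideanSpace.single j (1 : ℝ) := by
        ext j
        simp [y, Pi.single_apply]
      rw [h1, map_sum, inner_sum]
      simp only [map_smul, WithLp.ofLp_sum, WithLp.ofLp_smul, Finset.sum_apply, Pi.smul_apply, smul_eq_mul,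
        inner_smul_right]
      exact Finset.sum_congr rfl fun j _ => mul_comm _ _
  calc ∑ i, ‖∑ j, N (EuclideanSpace.single j 1) i • d j‖ ^ 2
      = ∑ i, ∑ k, N (y k) i ^ 2 := by
        refine Finset.sum_congr rfl fun i _ => ?_
        rw [hb _ (Submodule.sum_mem _ fun j _ => W.smul_mem _ (hd j))]
        simp_rw [hy]
    _ = ∑ k, ‖N (y k)‖ ^ 2 := by
        rw [Finset.sum_comm]
        exact Finset.sum_congr rfl fun k _ => (EuclideanSpace.real_norm_sq_eq _).symm
    _ ≤ ∑ k, C ^ 2 * ‖y k‖ ^ 2 := by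
        refine Finset.sum_le_sum fun k _ => ?_
        rw [← mul_pow]
        exact pow_le_pow_left₀ (norm_nonneg _) (hN _) 2
    _ = C ^ 2 * ∑ k, ∑ j, ⟪(b k : E), d j⟫ ^ 2 := by
        rw [Finset.mul_sum]
        simp_rw [EuclideanSpace.real_norm_sq_eq]
        rfl
    _ = C ^ 2 * ∑ j, ‖d j‖ ^ 2 := by
        rw [Finset.sum_comm]
        congr 1
        exact Finset.sum_congr rfl fun j _ => (hb _ (hd j)).symm

/-! ### First and second moments -/

section Moments

variable {U : Type*} [MeasurableSpace U] {μ : Measure U} [IsProbabilityMeasure μ]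

lemma integrable_of_sq {A : U → ℝ} (h0 : ∀ u, 0 ≤ A u) (hA : Integrable (fun u => A u ^ 2) μ) :
    Integrable A μ := by
  have hm : AEStronglyMeasurable A μ := by
    have h := (Real.continuous_sqrt.comp_aestronglyMeasurable hA.aestronglyMeasurable)
    simpa [Real.sqrt_sq (h0 _)] using h
  refine ((integrable_const 1).add hA).mono' hm (ae_of_all _ fun u => ?_)
  rw [Real.norm_of_nonneg (h0 u), Pi.add_apply]
  nlinarith [sq_nonneg (A u - 1)]

lemma integral_le_sqrt_integral_sq {A : U → ℝ} (h0 : ∀ u, 0 ≤ A u)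
    (hA : Integrable (fun u => A u ^ 2) μ) : ∫ u, A u ∂μ ≤ √(∫ u, A u ^ 2 ∂μ) := by
  have hA1 := integrable_of_sq h0 hA
  refine Real.le_sqrt_of_sq_le ?_
  set c := ∫ u, A u ∂μ with hc
  have h1 : 0 ≤ ∫ u, (A u ^ 2 - 2 * c * A u + c ^ 2) ∂μ :=
    integral_nonneg fun u => by
      change 0 ≤ A u ^ 2 - 2 * c * A u + c ^ 2
      nlinarith [sq_nonneg (A u - c)]
  have h2 : Integrable (fun u => A u ^ 2 - 2 * c * A u) μ := hA.sub (hA1.const_mul _)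
  rw [integral_add h2 (integrable_const _),
    integral_sub hA (hA1.const_mul _), integral_const_mul, ← hc, integral_const] at h1
  simp at h1
  nlinarith

lemma lintegral_ofReal_add_le {A R : U → ℝ} (hA0 : ∀ u, 0 ≤ A u) (hR0 : ∀ u, 0 ≤ R u)
    (hA : Integrable (fun u => A u ^ 2) μ) (hR : Integrable (fun u => R u ^ 2) μ) :
    ∫⁻ u, ENNReal.ofReal (A u + R u) ∂μ ≤
      ENNReal.ofReal (√(∫ u, A u ^ 2 ∂μ) + √(∫ u, R u ^ 2 ∂μ)) := by
  have hA1 := integrable_of_sq hA0 hA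
  have hR1 := integrable_of_sq hR0 hR
  have hAR : Integrable (fun u => A u + R u) μ := hA1.add hR1
  rw [← ofReal_integral_eq_lintegral_ofReal hAR
    (ae_of_all _ fun u => add_nonneg (hA0 u) (hR0 u)), integral_add hA1 hR1]
  exact ENNReal.ofReal_le_ofReal (add_le_add (integral_le_sqrt_integral_sq hA0 hA)
    (integral_le_sqrt_integral_sq hR0 hR))

/-- The cross terms vanish because the coefficients are uncorrelated. This turns an average over
fresh paths into a deterministic sum, which a bound for each fixed path would not give. -/
lemma integral_norm_sum_smul_sq {E : Type*} [NormedAddCommGroup E] [InnerProductSpace ℝ E] {r : ℕ}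
    {a : U → EuclideanSpace ℝ (Fin r)}
    (hint : ∀ i j, Integrable (fun u => a u i * a u j) μ)
    (hcov : ∀ i j, ∫ u, a u i * a u j ∂μ = if i = j then 1 else 0) (v : Fin r → E) :
    Integrable (fun u => ‖∑ i, a u i • v i‖ ^ 2) μ ∧
      ∫ u, ‖∑ i, a u i • v i‖ ^ 2 ∂μ = ∑ i, ‖v i‖ ^ 2 := by
  have e : ∀ u, ‖∑ i, a u i • v i‖ ^ 2 = ∑ i, ∑ j, (a u i * a u j) * ⟪v i, v j⟫ := fun u => by
    rw [← real_inner_self_eq_norm_sq, sum_inner]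
    refine Finset.sum_congr rfl fun i _ => ?_
    rw [inner_sum]
    refine Finset.sum_congr rfl fun j _ => ?_
    rw [inner_smul_left, inner_smul_right, RCLike.conj_to_real]; ring
  simp_rw [e]
  have hI := fun i j => (hint i j).mul_const ⟪v i, v j⟫
  refine ⟨integrable_finsetSum _ fun i _ => integrable_finsetSum _ fun j _ => hI i j, ?_⟩
  rw [integral_finsetSum _ fun i _ => integrable_finsetSum _ fun j _ => hI i j]
  refine Finset.sum_congr rfl fun i _ => ?_
  rw [integral_finsetSum _ fun j _ => hI i j]
  simp_rw [integral_mul_const, hcov]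
  simp

end Moments

/-! ### The approximation error for given draws and estimates -/

namespace IsCenteredGP

variable {U Z : Type*} [MeasurableSpace U] [MeasurableSpace Z] {μ : Measure U}
  [IsProbabilityMeasure μ] {P : Measure Z} [IsProbabilityMeasure P] {k : Z → Z → ℝ}
  {g : U → Z → ℝ} {B : ℝ} {lam : ℕ → ℝ} {psi : ℕ → Lp ℝ 2 P}

/-- The weights are the adjoint of a left inverse `N` of the analysis map `x ↦ (⟪x, a_j⟫)_j`, which
solves `∑ θ_j a_j = a` with `‖θ‖ ≤ s⁻¹ ‖a‖`. They reproduce the projection of the fresh path exactly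
from the projected draws. What remains is the deviation `d j` of each estimate from its projected
draw, plus the residual of the fresh path. -/
lemma exists_coefficients_avgError_le (hg : IsCenteredGP μ k g) (hk : ∀ x y, |k x y| ≤ B)
    (hM : IsMercerSystem P k lam psi) {r m : ℕ} (hr : ∀ i < r, 0 < lam i) {G : Fin m → Z → ℝ}
    (J : Finset (Fin m)) (hG : ∀ j ∈ J, MemLp (G j) 2 P) (w : Fin m → Lp ℝ 2 P) {s D : ℝ}
    (hs : 0 < s)
    (hlow : ∀ x, s ^ 2 * ‖x‖ ^ 2 ≤ ∑ j ∈ J, ⟪x, stdCoeff lam psi r (w j)⟫ ^ 2)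
    (hD : ∑ j ∈ J, ‖toL2 P (G j) - mercerProj psi r (w j)‖ ^ 2 ≤ D) :
    ∃ Θ : Lp ℝ 2 P →L[ℝ] EuclideanSpace ℝ (Fin m),
      (∀ f, ‖Θ f‖ ≤ s⁻¹ * ‖stdCoeff lam psi r f‖) ∧
      avgError P μ g G Θ ≤ ENNReal.ofReal (s⁻¹ * √D +
        √(∫ u, ‖toL2 P (g u) - mercerProj psi r (toL2 P (g u))‖ ^ 2 ∂μ)) := by
  classical
  let L : EuclideanSpace ℝ (Fin r) →L[ℝ] EuclideanSpace ℝ (Fin m) :=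
    (EuclideanSpace.equiv (Fin m) ℝ).symm.toContinuousLinearMap ∘L
      ContinuousLinearMap.pi fun j =>
        if j ∈ J then innerSL ℝ (stdCoeff lam psi r (w j)) else 0
  let R : EuclideanSpace ℝ (Fin m) →L[ℝ] EuclideanSpace ℝ (Fin m) :=
    (EuclideanSpace.equiv (Fin m) ℝ).symm.toContinuousLinearMap ∘L
      ContinuousLinearMap.pi fun j => if j ∈ J then EuclideanSpace.proj j else 0
  have hLj : ∀ x j, L x j = if j ∈ J then ⟪x, stdCoeff lam psi r (w j)⟫ else 0 := fun x j => by
    by_cases h : j ∈ J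
    · simp [L, h, real_inner_comm]
    · simp [L, h]
  have hRj : ∀ y j, R y j = if j ∈ J then y j else 0 := fun y j => by
    by_cases h : j ∈ J <;> simp [R, h]
  have hRL : ∀ x, R (L x) = L x := fun x => by
    ext j; rw [hRj, hLj]; by_cases h : j ∈ J <;> simp [h]
  have hRn : ∀ y, ‖R y‖ ≤ ‖y‖ := fun y => by
    refine (sq_le_sq₀ (norm_nonneg _) (norm_nonneg _)).1 ?_
    rw [EuclideanSpace.real_norm_sq_eq, EuclideanSpace.real_norm_sq_eq]
    refine Finset.sum_le_sum fun j _ => ?_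
    rw [hRj]; by_cases h : j ∈ J
    · simp [h]
    · simp [h, sq_nonneg]
  have hLlow : ∀ x, s * ‖x‖ ≤ ‖L x‖ := fun x => by
    refine (sq_le_sq₀ (by positivity) (norm_nonneg _)).1 ?_
    rw [mul_pow, EuclideanSpace.real_norm_sq_eq (L x)]
    refine (hlow x).trans_eq ?_
    simp_rw [hLj, ite_pow]
    simp
  obtain ⟨N₀, hN₀L, hN₀n⟩ := exists_leftInverse_of_lower_bound L hs hLlow
  -- Restricting to the coordinates in `J` first makes the weights vanish outside `J`, where `G j`
  -- is not assumed square integrable.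
  let N := N₀ ∘L R
  have hs' : 0 ≤ s⁻¹ := inv_nonneg.2 hs.le
  have hNL : ∀ x, N (L x) = x := fun x => by
    change N₀ (R (L x)) = x
    rw [hRL, hN₀L]
  have hNn : ∀ y, ‖N y‖ ≤ s⁻¹ * ‖y‖ := fun y =>
    (hN₀n _).trans (mul_le_mul_of_nonneg_left (hRn y) hs')
  have hNJ : ∀ j ∉ J, N (EuclideanSpace.single j 1) = 0 := fun j hj => by
    change N₀ (R _) = 0
    have : R (EuclideanSpace.single j 1) = 0 := by
      ext i; rw [hRj]
      by_cases h : i ∈ J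
      · have : i ≠ j := fun h' => hj (h' ▸ h)
        simp [this]
      · simp [h]
    rw [this, map_zero]
  let M := N.adjoint
  have hMj : ∀ a j, M a j = ∑ i, a i * N (EuclideanSpace.single j 1) i := fun a j => by
    have h1 : ⟪EuclideanSpace.single j (1 : ℝ), M a⟫ = M a j := by
      rw [EuclideanSpace.inner_single_left]; simp
    rw [← h1, ContinuousLinearMap.adjoint_inner_right, PiLp.inner_apply]
    simp
  have hMJ : ∀ a, ∀ j ∉ J, M a j = 0 := fun a j hj => by
    rw [hMj, hNJ j hj]; simp
  have hMn : ∀ a, ‖M a‖ ≤ s⁻¹ * ‖a‖ := fun a => by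
    refine (M.le_opNorm a).trans (mul_le_mul_of_nonneg_right ?_ (norm_nonneg _))
    rw [LinearIsometryEquiv.norm_map]
    exact N.opNorm_le_bound hs' hNn
  have hsolve : ∀ a, ∑ j ∈ J, M a j • stdCoeff lam psi r (w j) = a := fun a => by
    refine ext_inner_left ℝ fun x => ?_
    have h1 : ⟪L x, M a⟫ = ⟪x, a⟫ := by
      rw [ContinuousLinearMap.adjoint_inner_right, hNL]
    rw [← h1, inner_sum, PiLp.inner_apply]
    simp_rw [hLj]
    rw [← Finset.sum_subset (Finset.subset_univ J) fun j _ hj => by simp [hj]]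
    refine Finset.sum_congr rfl fun j hj => ?_
    rw [inner_smul_right]
    simp [hj]
  refine ⟨M ∘L stdCoeff lam psi r, fun f => hMn _, ?_⟩
  set d : Fin m → Lp ℝ 2 P := fun j =>
    if j ∈ J then toL2 P (G j) - mercerProj psi r (w j) else 0 with hd
  let a : U → EuclideanSpace ℝ (Fin r) := fun u => stdCoeff lam psi r (toL2 P (g u))
  let v : Fin r → Lp ℝ 2 P := fun i => ∑ j, N (EuclideanSpace.single j 1) i • d j
  have hv : ∑ i, ‖v i‖ ^ 2 ≤ (s⁻¹) ^ 2 * D := by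
    refine (sum_norm_sum_smul_sq_le N hNn d).trans (mul_le_mul_of_nonneg_left ?_ (sq_nonneg _))
    refine le_trans (le_of_eq ?_) hD
    rw [← Finset.sum_subset (Finset.subset_univ J) fun j _ hj => by simp [hd, hj]]
    exact Finset.sum_congr rfl fun j hj => by simp [hd, hj]
  obtain ⟨hvI, hvE⟩ := integral_norm_sum_smul_sq (μ := μ) (a := a)
    (fun i j => hg.integrable_stdCoeff_mul hk r i j)
    (fun i j => hg.integral_stdCoeff_mul hk hM hr i j) v
  have hproj : ∀ f : Lp ℝ 2 P,
      ∑ j ∈ J, M (stdCoeff lam psi r f) j • mercerProj psi r (w j) = mercerProj psi r f :=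
    fun f => by
      simp_rw [mercerProj_eq_stdCoeff hr, Finset.smul_sum]
      rw [Finset.sum_comm]
      refine Finset.sum_congr rfl fun i _ => ?_
      simp_rw [smul_smul]
      rw [← Finset.sum_smul]
      congr 1
      have h1 := congrArg (fun x : EuclideanSpace ℝ (Fin r) => x i) (hsolve (stdCoeff lam psi r f))
      simp only [WithLp.ofLp_sum, WithLp.ofLp_smul, Finset.sum_apply, Pi.smul_apply, smul_eq_mul] at h1
      rw [← h1, Finset.mul_sum]
      exact Finset.sum_congr rfl fun j _ => by ring
  have hbound : ∀ᵐ u ∂μ,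
      eLpNorm (fun z => learnedFun G ((M ∘L stdCoeff lam psi r) (toL2 P (g u))) z - g u z) 2 P ≤
        ENNReal.ofReal (‖∑ i, a u i • v i‖ +
          ‖toL2 P (g u) - mercerProj psi r (toL2 P (g u))‖) := by
    filter_upwards [hg.ae_memLp_path (P := P) hk] with u hu
    set f := toL2 P (g u) with hf
    set θ := M (stdCoeff lam psi r f) with hθ
    have hfe : f = hu.toLp := by rw [hf, toL2, dif_pos hu]
    let F : Lp ℝ 2 P := ∑ j ∈ J, θ j • toL2 P (G j) - f
    -- The weighted deviations are regrouped by the coordinates of the fresh path. The vectors `v i`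
    -- do not depend on `u`, so the second-moment identity applies.
    have hFeq : F = ∑ i, a u i • v i - (f - mercerProj psi r f) := by
      have h1 : ∑ i, a u i • v i = ∑ j ∈ J, θ j • (toL2 P (G j) - mercerProj psi r (w j)) := by
        simp only [v, Finset.smul_sum]
        rw [Finset.sum_comm,
          ← Finset.sum_subset (Finset.subset_univ J) fun j _ hj => by simp [hd, hj]]
        refine Finset.sum_congr rfl fun j hj => ?_
        simp_rw [smul_smul]
        rw [← Finset.sum_smul, hθ, hMj]
        simp [hd, hj, a, hf]
      rw [h1]
      simp_rw [smul_sub]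
      rw [Finset.sum_sub_distrib, hproj f]
      simp only [F]; abel
    have hFae : (fun z => learnedFun G θ z - g u z) =ᵐ[P] F := by
      have h1 : ∀ᵐ z ∂P, ∀ j ∈ J, toL2 P (G j) z = G j z := by
        refine (Finset.eventually_all J).2 fun j hj => ?_
        rw [toL2, dif_pos (hG j hj)]
        exact (hG j hj).coeFn_toLp
      have h2 : ∀ᵐ z ∂P, ∀ j ∈ J, (θ j • toL2 P (G j) : Lp ℝ 2 P) z = θ j * toL2 P (G j) z :=
        (Finset.eventually_all J).2 fun j hj => Lp.coeFn_smul _ _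
      have h3 := Lp.coeFn_sub (∑ j ∈ J, θ j • toL2 P (G j)) f
      have h4 := Lp.coeFn_fun_finsetSum J fun j => θ j • toL2 P (G j)
      have h5 : f =ᵐ[P] g u := by rw [hfe]; exact hu.coeFn_toLp
      filter_upwards [h1, h2, h3, h4, h5] with z h1 h2 h3 h4 h5
      rw [h3, Pi.sub_apply, h4, h5, learnedFun,
        ← Finset.sum_subset (Finset.subset_univ J) fun j _ hj => by
          rw [hθ, hMJ _ j hj, zero_mul]]
      congr 1
      exact Finset.sum_congr rfl fun j hj => by rw [h2 j hj, h1 j hj]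
    change eLpNorm (fun z => learnedFun G θ z - g u z) 2 P ≤ _
    rw [eLpNorm_congr_ae hFae, ← Lp.enorm_def, ← ofReal_norm]
    refine ENNReal.ofReal_le_ofReal ?_
    rw [hFeq]
    exact norm_sub_le _ _
  refine (lintegral_mono_ae hbound).trans ((lintegral_ofReal_add_le (fun u => norm_nonneg _)
    (fun u => norm_nonneg _) hvI (hg.integrable_residual_sq hk hM hr)).trans ?_)
  refine ENNReal.ofReal_le_ofReal (add_le_add_left ?_ _)
  rw [hvE]
  refine (Real.sqrt_le_sqrt hv).trans_eq ?_
  rw [Real.sqrt_mul (sq_nonneg _), Real.sqrt_sq hs']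

end IsCenteredGP

/-! ### Consequences of the kernel setting -/

lemma one_div_sixteen_le_integral_abs_gaussianReal :
    1 / 16 ≤ ∫ x, |x| ∂(gaussianReal 0 1) := by
  have hi : Integrable (fun x : ℝ => |x|) (gaussianReal 0 1) :=
    ((memLp_id_gaussianReal 1).integrable le_rfl).abs
  have h1 : gaussianReal 0 1 {x : ℝ | |x| < 1 / 8} ≤ ENNReal.ofReal (1 / 2) :=
    (measure_abs_lt_le (Y := fun x : ℝ => x) (s := 1) measurable_id (by norm_num)
      (by simp) _).trans (ENNReal.ofReal_le_ofReal (by norm_num))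
  have hm : MeasurableSet {x : ℝ | |x| < 1 / 8} := measurableSet_lt (by fun_prop) measurable_const
  have h2 : (gaussianReal 0 1).real {x : ℝ | |x| < 1 / 8} ≤ 1 / 2 :=
    ENNReal.toReal_le_of_le_ofReal (by norm_num) h1
  -- Markov at level `1 / 8`, which is exceeded with probability at least `1 / 2`.
  have h3 := mul_meas_ge_le_integral_of_nonneg (ae_of_all _ fun x : ℝ => abs_nonneg x) hi (1 / 8)
  have h4 : {x : ℝ | 1 / 8 ≤ |x|} = {x : ℝ | |x| < 1 / 8}ᶜ := by ext; simp
  rw [h4, probReal_compl_eq_one_sub hm] at h3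
  linarith

namespace IsCenteredGP

section

variable {U Z : Type*} [MeasurableSpace U] [MeasurableSpace Z] {μ : Measure U}
  [IsProbabilityMeasure μ] {P : Measure Z} [IsProbabilityMeasure P] {k : Z → Z → ℝ}
  {g : U → Z → ℝ} {B : ℝ} {lam : ℕ → ℝ} {psi : ℕ → Lp ℝ 2 P}

lemma integrable_norm_stdCoeff (hg : IsCenteredGP μ k g) (hk : ∀ x y, |k x y| ≤ B) (r : ℕ) :
    Integrable (fun u => ‖stdCoeff lam psi r (toL2 P (g u))‖) μ := by
  refine integrable_of_sq (fun _ => norm_nonneg _) ?_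
  simp_rw [EuclideanSpace.real_norm_sq_eq, sq]
  exact integrable_finsetSum _ fun i _ => hg.integrable_stdCoeff_mul hk r i i

lemma integrable_residual (hg : IsCenteredGP μ k g) (hk : ∀ x y, |k x y| ≤ B)
    (hM : IsMercerSystem P k lam psi) {r : ℕ} (hr : ∀ i < r, 0 < lam i) :
    Integrable (fun u => ‖toL2 P (g u) - mercerProj psi r (toL2 P (g u))‖) μ :=
  integrable_of_sq (fun _ => norm_nonneg _) (hg.integrable_residual_sq hk hM hr)

/-- The Euclidean norm is at least the `ℓ¹` norm divided by `√r`, and each coordinate is standard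
Gaussian with first absolute moment at least `1 / 16`. -/
lemma sqrt_le_integral_norm_stdCoeff (hg : IsCenteredGP μ k g) (hk : ∀ x y, |k x y| ≤ B)
    (hM : IsMercerSystem P k lam psi) {r : ℕ} (hr : ∀ i < r, 0 < lam i) :
    √r / 16 ≤ ∫ u, ‖stdCoeff lam psi r (toL2 P (g u))‖ ∂μ := by
  rcases Nat.eq_zero_or_pos r with rfl | hr0
  · simpa using integral_nonneg fun _ => norm_nonneg _
  have hr1 : (0 : ℝ) < r := by exact_mod_cast hr0
  set a : U → EuclideanSpace ℝ (Fin r) := fun u => stdCoeff lam psi r (toL2 P (g u)) with ha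
  have ham : AEMeasurable a μ := hg.aemeasurable_stdCoeff hk r
  have hcoord : ∀ i : Fin r, Integrable (fun u => |a u i|) μ ∧ 1 / 16 ≤ ∫ u, |a u i| ∂μ := fun i => by
    have e : ∀ u, ⟪EuclideanSpace.single i (1 : ℝ), a u⟫ = a u i := fun u => by
      rw [EuclideanSpace.inner_single_left]; simp
    have hmap := hg.map_inner_stdCoeff hk hM hr (EuclideanSpace.single i (1 : ℝ))
    have hm : AEMeasurable (fun u => a u i) μ := by
      have := ham.const_inner (𝕜 := ℝ) (c := EuclideanSpace.single i (1 : ℝ))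
      simpa only [e] using this
    change μ.map (fun u => ⟪EuclideanSpace.single i (1 : ℝ), a u⟫) = _ at hmap
    simp only [e, PiLp.norm_single, norm_one, one_pow, Real.toNNReal_one] at hmap
    have hgi : Integrable (fun x : ℝ => |x|) (μ.map fun u => a u i) := by
      rw [hmap]; exact ((memLp_id_gaussianReal 1).integrable le_rfl).abs
    refine ⟨hgi.comp_aemeasurable hm, ?_⟩
    have := integral_map hm hgi.aestronglyMeasurable
    rw [← this, hmap]
    exact one_div_sixteen_le_integral_abs_gaussianReal
  have hle : ∀ u, ∑ i, |a u i| ≤ √r * ‖a u‖ := fun u => by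
    refine (sq_le_sq₀ (Finset.sum_nonneg fun i _ => abs_nonneg _) (by positivity)).1 ?_
    rw [mul_pow, Real.sq_sqrt hr1.le, EuclideanSpace.real_norm_sq_eq]
    have := sq_sum_le_card_mul_sum_sq (s := Finset.univ) (f := fun i => |a u i|)
    simpa using this
  have h1 : ∫ u, ∑ i, |a u i| ∂μ ≤ ∫ u, √r * ‖a u‖ ∂μ :=
    integral_mono (integrable_finsetSum _ fun i _ => (hcoord i).1)
      ((hg.integrable_norm_stdCoeff hk r).const_mul _) hle
  rw [integral_finsetSum _ fun i _ => (hcoord i).1, integral_const_mul] at h1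
  have h2 : (r : ℝ) * (1 / 16) ≤ ∑ i : Fin r, ∫ u, |a u i| ∂μ := by
    have := Finset.card_nsmul_le_sum Finset.univ (fun i : Fin r => ∫ u, |a u i| ∂μ) (1 / 16)
      fun i _ => (hcoord i).2
    simpa using this
  have h3 : √(r : ℝ) * (√r / 16) ≤ √r * ∫ u, ‖a u‖ ∂μ := by
    rw [← mul_div_assoc, Real.mul_self_sqrt hr1.le]
    linarith
  exact le_of_mul_le_mul_left h3 (Real.sqrt_pos.2 hr1)

lemma measurableSet_not_ae_le (hg : IsCenteredGP μ k g) (T : ℝ) :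
    MeasurableSet {u | ¬ ∀ᵐ z ∂P, g u z ≤ T} := by
  have h1 : MeasurableSet {p : U × Z | ¬ g p.1 p.2 ≤ T} :=
    (measurableSet_le hg.measurable measurable_const).compl
  have h2 := measurable_measure_prodMk_left (ν := P) h1
  exact (h2 (measurableSet_singleton 0)).compl

/-- Paths that are almost surely essentially bounded exceed a high level with small
probability. -/
lemma tendsto_measure_not_ae_le (hg : IsCenteredGP μ k g)
    (hbdd : ∀ᵐ u ∂μ, eLpNorm (g u) ⊤ P < ⊤) :
    Tendsto (fun T : ℝ => μ {u | ¬ ∀ᵐ z ∂P, g u z ≤ T}) atTop (𝓝 0) := by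
  have h := tendsto_measure_iInter_atTop (μ := μ) (s := fun T : ℝ => {u | ¬ ∀ᵐ z ∂P, g u z ≤ T})
    (fun T => (hg.measurableSet_not_ae_le T).nullMeasurableSet)
    (fun S T hST u hu h => hu (h.mono fun z hz => hz.trans hST)) ⟨0, measure_ne_top _ _⟩
  suffices h0 : μ (⋂ T : ℝ, {u | ¬ ∀ᵐ z ∂P, g u z ≤ T}) = 0 by
    rwa [h0] at h
  refine measure_mono_null (t := {u | ¬ eLpNorm (g u) ⊤ P < ⊤}) (fun u hu hlt => ?_) hbdd
  rw [Set.mem_iInter] at hu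
  refine hu (eLpNorm (g u) ⊤ P).toReal ?_
  have := ae_le_eLpNormEssSup (f := g u) (μ := P)
  filter_upwards [this] with z hz
  rw [eLpNorm_exponent_top] at hlt ⊢
  refine (le_abs_self _).trans ?_
  rw [← Real.norm_eq_abs, ← toReal_enorm]
  exact ENNReal.toReal_mono hlt.ne hz

end

section Pullback

variable {U Z W : Type*} [MeasurableSpace U] [MeasurableSpace Z] [MeasurableSpace W]
  {μ : Measure U} [IsProbabilityMeasure μ] {P : Measure Z} [IsProbabilityMeasure P]
  {Φ : Z → W} {kbar : W → W → ℝ} {gbar : U → W → ℝ} {B : ℝ} {lam : ℕ → ℝ} {psi : ℕ → Lp ℝ 2 P}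

lemma exists_integral_residual_sq_le [MeasurableSpace.CountablyGenerated W] (hΦ : Measurable Φ)
    (hg : IsCenteredGP μ kbar gbar) (hk : ∀ x y, |kbar x y| ≤ B)
    (hM : IsMercerSystem P (fun x y => kbar (Φ x) (Φ y)) lam psi) {b K : ℝ} (hb : 0 < b)
    (hdecay : ∀ i : ℕ, lam i ≤ K * ((i : ℝ) + 1) ^ (-(b + 1))) :
    ∃ K' : ℝ, 0 ≤ K' ∧ ∀ m : ℕ, 0 < m → (∀ i < m / 128, 0 < lam i) →
      ∫ u, ‖toL2 P (fun z => gbar u (Φ z)) -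
        mercerProj psi (m / 128) (toL2 P fun z => gbar u (Φ z))‖ ^ 2 ∂μ ≤ K' * (m : ℝ) ^ (-b) := by
  have hK : 0 ≤ K := by
    have h1 := hdecay 0
    simp at h1
    exact (hM.nonneg 0).trans h1
  have hs := summable_of_decay hb hK hM.nonneg hdecay
  have hL : 0 ≤ ∑' i, lam i := tsum_nonneg hM.nonneg
  have htot := hg.integral_norm_path_sq_le hΦ hk hM hs
  -- The first term is the eigenvalue tail beyond `m / 128 ≥ m / 256`. The second covers `m < 128`,
  -- where the quotient is `0` and the residual is the whole path.
  refine ⟨K / b * 256 ^ b + (∑' i, lam i) * 128 ^ b, by positivity, fun m hm hr => ?_⟩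
  have hm' : (0 : ℝ) < m := by exact_mod_cast hm
  have hpow : ∀ c : ℝ, 0 < c → (m / c : ℝ) ^ (-b) = c ^ b * (m : ℝ) ^ (-b) := fun c hc => by
    rw [Real.div_rpow hm'.le hc.le, Real.rpow_neg hc.le, div_inv_eq_mul, mul_comm]
  have hmb : 0 ≤ (m : ℝ) ^ (-b) := by positivity
  rw [(hg.comp_measurable hΦ).integral_residual_sq (fun x y => hk _ _) hM hr]
  rcases Nat.eq_zero_or_pos (m / 128) with h0 | h0
  · rw [h0, Finset.sum_range_zero, sub_zero]
    have h1 : m < 128 := by omega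
    have h2 : (1 : ℝ) ≤ (m / 128 : ℝ) ^ (-b) := by
      refine Real.one_le_rpow_of_pos_of_le_one_of_nonpos (by positivity) ?_ (by linarith)
      rw [div_le_one (by norm_num)]
      exact_mod_cast h1.le
    rw [hpow _ (by norm_num)] at h2
    have h3 := mul_le_mul_of_nonneg_left h2 hL
    have h4 : 0 ≤ K / b * 256 ^ b * (m : ℝ) ^ (-b) := by positivity
    linarith
  · have h1 := tsum_tail_le hb hK hM.nonneg hdecay h0
    have h2 := hs.sum_add_tsum_nat_add (m / 128)
    have h3 : ((m / 128 : ℕ) : ℝ) ^ (-b) ≤ (m / 256 : ℝ) ^ (-b) := by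
      refine Real.rpow_le_rpow_of_nonpos (by positivity) ?_ (by linarith)
      rw [div_le_iff₀ (by norm_num)]
      exact_mod_cast (by omega : m ≤ m / 128 * 256)
    rw [hpow _ (by norm_num)] at h3
    have h4 := mul_le_mul_of_nonneg_left h3 (div_nonneg hK hb.le)
    have h5 : 0 ≤ (∑' i, lam i) * 128 ^ b * (m : ℝ) ^ (-b) := by positivity
    linarith

end Pullback

end IsCenteredGP

/-! ### Good samples -/

instance {U X : Type*} [MeasurableSpace U] [MeasurableSpace X] (Q : Kernel U X)
    [IsMarkovKernel Q] (n : ℕ) : IsMarkovKernel (iidKernel Q n) :=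
  ⟨fun u => by
    change IsProbabilityMeasure (Measure.pi fun _ : Fin n => Q u)
    infer_instance⟩

lemma eLpNorm_two_sq {X : Type*} [MeasurableSpace X] {P : Measure X} (f : X → ℝ) :
    eLpNorm f 2 P ^ 2 = ∫⁻ x, ‖f x‖ₑ ^ 2 ∂P := by
  rw [eLpNorm_eq_lintegral_rpow_enorm_toReal two_ne_zero ENNReal.ofNat_ne_top]
  simp only [ENNReal.toReal_ofNat, ENNReal.rpow_ofNat, one_div]
  rw [← ENNReal.rpow_ofNat, ← ENNReal.rpow_mul]
  simp

section

variable {U Z : Type*} [MeasurableSpace U] [MeasurableSpace Z] {μ : Measure U}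
  [IsProbabilityMeasure μ] {P : Measure Z} [IsProbabilityMeasure P] {k : Z → Z → ℝ}
  {g : U → Z → ℝ} {B : ℝ} {lam : ℕ → ℝ} {psi : ℕ → Lp ℝ 2 P} {m n : ℕ}

lemma SharedData.measurable_task (j : Fin m) :
    Measurable fun D : SharedData Z m n => D.task j :=
  measurable_pi_lambda _ fun i =>
    ((measurable_pi_apply i).fst).prodMk ((measurable_pi_apply j).comp (measurable_pi_apply i).snd)

lemma measurable_sq_error (hg : Measurable (Function.uncurry g)) {A : (Fin n → Z × ℝ) → Z → ℝ}
    (hA : Measurable (Function.uncurry A)) :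
    Measurable fun p : U × (Fin n → Z × ℝ) => eLpNorm (fun z => A p.2 z - g p.1 z) 2 P ^ 2 := by
  simp_rw [eLpNorm_two_sq]
  have h1 : Measurable fun q : (U × (Fin n → Z × ℝ)) × Z => A q.1.2 q.2 :=
    hA.comp (measurable_fst.snd.prodMk measurable_snd)
  have h2 : Measurable fun q : (U × (Fin n → Z × ℝ)) × Z => g q.1.1 q.2 :=
    hg.comp (measurable_fst.fst.prodMk measurable_snd)
  exact ((h1.sub h2).enorm.pow_const 2).lintegral_prod_right'

lemma measurable_sq_error_task (hg : Measurable (Function.uncurry g))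
    {A : (Fin n → Z × ℝ) → Z → ℝ} (hA : Measurable (Function.uncurry A)) (j : Fin m) :
    Measurable fun p : (Fin m → U) × SharedData Z m n =>
      eLpNorm (fun z => A (p.2.task j) z - g (p.1 j) z) 2 P ^ 2 := by
  have hm : Measurable fun p : (Fin m → U) × SharedData Z m n => (p.1 j, p.2.task j) :=
    ((measurable_pi_apply j).comp measurable_fst).prodMk
      ((SharedData.measurable_task j).comp measurable_snd)
  have h := measurable_sq_error (P := P) hg hA
  generalize hF : (fun p : U × (Fin n → Z × ℝ) => eLpNorm (fun z => A p.2 z - g p.1 z) 2 P ^ 2) = F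
    at h
  have e : (fun p : (Fin m → U) × SharedData Z m n =>
      eLpNorm (fun z => A (p.2.task j) z - g (p.1 j) z) 2 P ^ 2) =
      fun p => F (p.1 j, p.2.task j) := by
    subst hF; rfl
  rw [e]
  exact h.comp hm

lemma measure_lt_sum_le {Ω : Type*} [MeasurableSpace Ω] {ν : Measure Ω} {F : Fin m → Ω → ℝ≥0∞}
    (hF : ∀ j, AEMeasurable (F j) ν) {c : ℝ≥0∞} (hc : ∀ j, ∫⁻ p, F j p ∂ν ≤ c) {D : ℝ}
    (hD : 0 < D) :
    ν {p | ¬ ∑ j, F j p ≤ ENNReal.ofReal D} ≤ m * c / ENNReal.ofReal D := by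
  calc _ ≤ ν {p | ENNReal.ofReal D ≤ ∑ j, F j p} := measure_mono fun p hp => (not_le.1 hp).le
    _ ≤ (∫⁻ p, ∑ j, F j p ∂ν) / ENNReal.ofReal D :=
        meas_ge_le_lintegral_div (Finset.aemeasurable_fun_sum _ fun j _ => hF j)
          (ENNReal.ofReal_pos.2 hD).ne' ENNReal.ofReal_ne_top
    _ ≤ _ := by
        refine ENNReal.div_le_div_right ?_ _
        rw [lintegral_finsetSum' _ fun j _ => hF j]
        refine (Finset.sum_le_sum fun j _ => hc j).trans_eq ?_
        rw [Finset.sum_const, Finset.card_univ, Fintype.card_fin, nsmul_eq_mul]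

namespace IsSharedSample

variable {Q : Kernel U (Z × ℝ)} [IsMarkovKernel Q] {ν : Measure ((Fin m → U) × SharedData Z m n)}

lemma isProbabilityMeasure (hν : IsSharedSample μ Q ν) : IsProbabilityMeasure ν :=
  ⟨by rw [← Set.preimage_univ (f := Prod.fst), ← Measure.map_apply measurable_fst .univ, hν.draws,
    measure_univ]⟩

lemma measurePreserving_draw (hν : IsSharedSample μ Q ν) (j : Fin m) :
    MeasurePreserving (fun p => p.1 j) ν μ :=
  (measurePreserving_eval (fun _ : Fin m => μ) j).comp ⟨measurable_fst, hν.draws⟩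

lemma lintegral_sq_error (hν : IsSharedSample μ Q ν) (hg : Measurable (Function.uncurry g))
    {A : (Fin n → Z × ℝ) → Z → ℝ} (hA : Measurable (Function.uncurry A)) (j : Fin m) :
    ∫⁻ p, eLpNorm (fun z => A (p.2.task j) z - g (p.1 j) z) 2 P ^ 2 ∂ν = oracleRisk P μ g Q n A := by
  have hF := measurable_sq_error (P := P) hg hA
  have hm : Measurable fun p : (Fin m → U) × SharedData Z m n => (p.1 j, p.2.task j) :=
    ((measurable_pi_apply j).comp measurable_fst).prodMk
      ((SharedData.measurable_task j).comp measurable_snd)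
  rw [oracleRisk, ← Measure.lintegral_compProd hF, ← hν.data j, lintegral_map hF hm]

end IsSharedSample

/-- A sample for which the standardized coefficients of the draws are spread over all directions,
few draws exceed the level `T`, and the sum of the squared errors is at most `D`. -/
structure IsGoodSample (P : Measure Z) (g : U → Z → ℝ) (lam : ℕ → ℝ) (psi : ℕ → Lp ℝ 2 P)
    (A : (Fin n → Z × ℝ) → Z → ℝ) (T : ℝ) (r : ℕ) (D : ℝ)
    (p : (Fin m → U) × SharedData Z m n) : Prop where
  memLp : ∀ j, MemLp (g (p.1 j)) 2 P
  spread : ∀ x : EuclideanSpace ℝ (Fin r), 4 * (Finset.univ.filter fun j =>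
    |⟪x, stdCoeff lam psi r (toL2 P (g (p.1 j)))⟫| < (1 / 2) ^ 43 * ‖x‖).card ≤ m
  exceed : 4 * ∑ j, {u | ¬ ∀ᵐ z ∂P, g u z ≤ T}.indicator 1 (p.1 j) ≤ (m : ℝ≥0∞)
  error : ∑ j, (eLpNorm (fun z => A (p.2.task j) z - g (p.1 j) z) 2 P ^ 2 +
    ENNReal.ofReal (‖toL2 P (g (p.1 j)) - mercerProj psi r (toL2 P (g (p.1 j)))‖ ^ 2)) ≤
      ENNReal.ofReal D

namespace IsSharedSample

variable {Q : Kernel U (Z × ℝ)} [IsMarkovKernel Q] {ν : Measure ((Fin m → U) × SharedData Z m n)}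

lemma measure_not_spread_le (hν : IsSharedSample μ Q ν) (hg : IsCenteredGP μ k g)
    (hk : ∀ x y, |k x y| ≤ B) (hM : IsMercerSystem P k lam psi) {r : ℕ} (hr : ∀ i < r, 0 < lam i)
    (hrm : 128 * r ≤ m) :
    ν {p | ¬ ∀ x : EuclideanSpace ℝ (Fin r), 4 * (Finset.univ.filter fun j =>
      |⟪x, stdCoeff lam psi r (toL2 P (g (p.1 j)))⟫| < (1 / 2) ^ 43 * ‖x‖).card ≤ m} ≤
        2 * (2 ^ m)⁻¹ := by
  -- The coefficients are only almost everywhere measurable in the draw. The net estimate is applied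
  -- to a measurable version.
  obtain ⟨X, hXm, hX⟩ := hg.aemeasurable_stdCoeff (P := P) (lam := lam) (psi := psi) hk r
  have hXG : ∀ x, μ.map (fun u => ⟪x, X u⟫) = gaussianReal 0 (‖x‖ ^ 2).toNNReal := fun x => by
    rw [← hg.map_inner_stdCoeff hk hM hr x]
    refine Measure.map_congr ?_
    filter_upwards [hX] with u hu
    rw [hu]
  have hae : ∀ᵐ p ∂ν, ∀ j, stdCoeff lam psi r (toL2 P (g (p.1 j))) = X (p.1 j) :=
    ae_all_iff.2 fun j => (hν.measurePreserving_draw j).quasiMeasurePreserving.ae hX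
  let S : Set (Fin m → U) := {u | ¬ ∀ x : EuclideanSpace ℝ (Fin r),
      4 * (Finset.univ.filter fun j => |⟪x, X (u j)⟫| < (1 / 2) ^ 43 * ‖x‖).card ≤ m}
  calc _ ≤ ν (Prod.fst ⁻¹' S) := by
        refine measure_mono_ae ?_
        filter_upwards [hae] with p hp h hS
        refine h ?_
        simp_rw [hp]
        exact hS
    _ ≤ ν.map Prod.fst S := Measure.le_map_apply measurable_fst.aemeasurable _
    _ ≤ _ := by
        rw [hν.draws]
        exact pi_measure_exists_weak_le hXm hXG hrm

lemma measure_lt_sum_indicator_le (hν : IsSharedSample μ Q ν) {V : Set U} (hV : MeasurableSet V)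
    (hm : 0 < m) :
    ν {p | ¬ 4 * ∑ j, V.indicator 1 (p.1 j) ≤ (m : ℝ≥0∞)} ≤ 4 * μ V := by
  have hm0 : (m : ℝ≥0∞) ≠ 0 := by exact_mod_cast hm.ne'
  have hmt : (m : ℝ≥0∞) ≠ ⊤ := ENNReal.natCast_ne_top m
  have hind : Measurable (V.indicator (1 : U → ℝ≥0∞)) := measurable_one.indicator hV
  have hterm : ∀ j, Measurable fun p : (Fin m → U) × SharedData Z m n =>
      V.indicator (1 : U → ℝ≥0∞) (p.1 j) := fun j =>
    hind.comp ((measurable_pi_apply j).comp measurable_fst)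
  have hsum : Measurable fun p : (Fin m → U) × SharedData Z m n =>
      ∑ j, V.indicator (1 : U → ℝ≥0∞) (p.1 j) := Finset.measurable_fun_sum _ fun j _ => hterm j
  have e : ∀ j, ∫⁻ p, V.indicator (1 : U → ℝ≥0∞) (p.1 j) ∂ν = μ V := fun j => by
    rw [(hν.measurePreserving_draw j).lintegral_comp hind, lintegral_indicator_one hV]
  calc _ ≤ ν {p | (m : ℝ≥0∞) ≤ 4 * ∑ j, V.indicator 1 (p.1 j)} :=
        measure_mono fun p hp => (not_le.1 hp).le
    _ ≤ (∫⁻ p, 4 * ∑ j, V.indicator 1 (p.1 j) ∂ν) / m :=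
        meas_ge_le_lintegral_div (hsum.const_mul 4).aemeasurable hm0 hmt
    _ = 4 * (m * μ V) / m := by
        rw [lintegral_const_mul _ hsum, lintegral_finsetSum _ fun j _ => hterm j]
        simp_rw [e]
        rw [Finset.sum_const, Finset.card_univ, Fintype.card_fin, nsmul_eq_mul]
    _ = 4 * μ V := by
        rw [mul_left_comm, mul_comm, mul_div_assoc, ENNReal.div_self hm0 hmt, mul_one]

/-- Markov's inequality with linearity of the expectation. Each summand involves one draw and its
own data, so no joint information about the noise enters. -/
lemma measure_lt_sum_error_le (hν : IsSharedSample μ Q ν) (hg : Measurable (Function.uncurry g))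
    {A : (Fin n → Z × ℝ) → Z → ℝ} (hA : Measurable (Function.uncurry A)) {ξ τ : ℝ}
    (hrisk : oracleRisk P μ g Q n A ≤ ENNReal.ofReal (ξ ^ 2)) {ρ : U → ℝ} (hρ0 : ∀ u, 0 ≤ ρ u)
    (hρ : Integrable ρ μ) (hτ : ∫ u, ρ u ∂μ ≤ τ) {D : ℝ} (hD : 0 < D) :
    ν {p | ¬ ∑ j, (eLpNorm (fun z => A (p.2.task j) z - g (p.1 j) z) 2 P ^ 2 +
      ENNReal.ofReal (ρ (p.1 j))) ≤ ENNReal.ofReal D} ≤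
        m * (ENNReal.ofReal (ξ ^ 2) + ENNReal.ofReal τ) / ENNReal.ofReal D := by
  have hρm : AEMeasurable (fun u => ENNReal.ofReal (ρ u)) μ :=
    hρ.aestronglyMeasurable.aemeasurable.ennreal_ofReal
  have hρi : ∫⁻ u, ENNReal.ofReal (ρ u) ∂μ ≤ ENNReal.ofReal τ := by
    rw [← ofReal_integral_eq_lintegral_ofReal hρ (ae_of_all _ hρ0)]
    exact ENNReal.ofReal_le_ofReal hτ
  refine measure_lt_sum_le (fun j => ?_) (fun j => ?_) hD
  · exact (measurable_sq_error_task hg hA j).aemeasurable.add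
      (hρm.comp_quasiMeasurePreserving (hν.measurePreserving_draw j).quasiMeasurePreserving)
  · have hmp := hν.measurePreserving_draw j
    have e : ∫⁻ p, ENNReal.ofReal (ρ (p.1 j)) ∂ν = ∫⁻ u, ENNReal.ofReal (ρ u) ∂μ := by
      conv_rhs => rw [← hmp.map_eq]
      rw [lintegral_map' (by rw [hmp.map_eq]; exact hρm) hmp.measurable.aemeasurable]
    rw [lintegral_add_left (measurable_sq_error_task hg hA j), e]
    exact add_le_add ((hν.lintegral_sq_error hg hA j).trans_le hrisk) hρi

lemma measure_not_isGoodSample_le (hν : IsSharedSample μ Q ν) (hg : IsCenteredGP μ k g)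
    (hk : ∀ x y, |k x y| ≤ B) (hM : IsMercerSystem P k lam psi) {r : ℕ} (hr : ∀ i < r, 0 < lam i)
    (hrm : 128 * r ≤ m) (hm : 0 < m) {A : (Fin n → Z × ℝ) → Z → ℝ}
    (hA : Measurable (Function.uncurry A)) {ξ τ : ℝ}
    (hrisk : oracleRisk P μ g Q n A ≤ ENNReal.ofReal (ξ ^ 2))
    (hτ : ∫ u, ‖toL2 P (g u) - mercerProj psi r (toL2 P (g u))‖ ^ 2 ∂μ ≤ τ)
    (T : ℝ) {D : ℝ} (hD : 0 < D) :
    ν {p | ¬ IsGoodSample P g lam psi A T r D p} ≤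
      2 * (2 ^ m)⁻¹ + 4 * μ {u | ¬ ∀ᵐ z ∂P, g u z ≤ T} +
        m * (ENNReal.ofReal (ξ ^ 2) + ENNReal.ofReal τ) / ENNReal.ofReal D := by
  have h₀ : ∀ᵐ p ∂ν, ∀ j, MemLp (g (p.1 j)) 2 P := ae_all_iff.2 fun j =>
    (hν.measurePreserving_draw j).quasiMeasurePreserving.ae (hg.ae_memLp_path (P := P) hk)
  have h₁ := hν.measure_not_spread_le hg hk hM hr hrm
  have h₂ := hν.measure_lt_sum_indicator_le (hg.measurableSet_not_ae_le (P := P) T) hm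
  have h₃ := hν.measure_lt_sum_error_le hg.measurable hA hrisk (fun _ => sq_nonneg _)
    (hg.integrable_residual_sq hk hM hr) hτ hD
  refine le_trans (measure_mono_ae ?_) ((measure_union_le _ _).trans (add_le_add
    ((measure_union_le _ _).trans (add_le_add h₁ h₂)) h₃))
  filter_upwards [h₀] with p hp hbad
  by_contra hc
  exact hbad ⟨hp, not_not.1 fun h => hc (Or.inl (Or.inl h)),
    not_not.1 fun h => hc (Or.inl (Or.inr h)), not_not.1 fun h => hc (Or.inr h)⟩

end IsSharedSample

lemma norm_toL2_sub_sq_le {f h : Z → ℝ} {e : ℝ≥0∞} (hf : MemLp f 2 P) (hh : MemLp h 2 P)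
    (he : eLpNorm (f - h) 2 P ≤ e) : ENNReal.ofReal (‖toL2 P f - toL2 P h‖ ^ 2) ≤ e ^ 2 := by
  rw [toL2, toL2, dif_pos hf, dif_pos hh, ← MemLp.toLp_sub, ENNReal.ofReal_pow (norm_nonneg _),
    ofReal_norm, Lp.enorm_toLp]
  gcongr

/-- At most a quarter of the draws exceed the truncation level and at most a quarter hit a given
direction weakly. At least half remain, which gives the factor `√(m / 2)`. The set `J` of retained
draws does not depend on the direction, while the set of weak hits does. -/
lemma IsGoodSample.exists_coefficients (hg : IsCenteredGP μ k g) (hk : ∀ x y, |k x y| ≤ B)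
    (hM : IsMercerSystem P k lam psi) {r : ℕ} (hr : ∀ i < r, 0 < lam i) (hm : 0 < m)
    {A : (Fin n → Z × ℝ) → Z → ℝ} (hA : Measurable (Function.uncurry A)) {Ck D : ℝ} (hD : 0 ≤ D)
    {p : (Fin m → U) × SharedData Z m n}
    (hp : IsGoodSample P g lam psi A (Ck * Real.log n) r D p) :
    ∃ Θ : Lp ℝ 2 P →L[ℝ] EuclideanSpace ℝ (Fin m),
      (∀ f, ‖Θ f‖ ≤ ((1 / 2) ^ 43 * √(m / 2))⁻¹ * ‖stdCoeff lam psi r f‖) ∧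
      avgError P μ g (truncEst A Ck p.2) Θ ≤
        ENNReal.ofReal (((1 / 2) ^ 43 * √(m / 2))⁻¹ * √(2 * D) +
          √(∫ u, ‖toL2 P (g u) - mercerProj psi r (toL2 P (g u))‖ ^ 2 ∂μ)) := by
  classical
  set T := Ck * Real.log n with hT
  set V : Set U := {u | ¬ ∀ᵐ z ∂P, g u z ≤ T} with hV
  have hm' : (0 : ℝ) < m := by exact_mod_cast hm
  let J : Finset (Fin m) := Finset.univ.filter fun j => p.1 j ∉ V
  have hJle : ∀ j ∈ J, ∀ᵐ z ∂P, g (p.1 j) z ≤ T := fun j hj =>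
    not_not.1 (Finset.mem_filter.1 hj).2
  have hJc : 4 * (Finset.univ.filter fun j => p.1 j ∈ V).card ≤ m := by
    have h := hp.exceed
    have e : ∑ j, V.indicator (1 : U → ℝ≥0∞) (p.1 j) =
        ((Finset.univ.filter fun j => p.1 j ∈ V).card : ℝ≥0∞) := by
      simp [Set.indicator_apply, ← Finset.sum_boole]
    rw [e] at h
    exact_mod_cast h
  have hAm : ∀ j, Measurable (A (p.2.task j)) := fun j => hA.of_uncurry_left
  have hGm : ∀ j, Measurable (truncEst A Ck p.2 j) := fun j => measurable_const.min (hAm j)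
  set err : Fin m → ℝ≥0∞ := fun j =>
    eLpNorm (fun z => A (p.2.task j) z - g (p.1 j) z) 2 P with herr
  -- Where the path lies below the level, cutting the estimate at that level moves it towards the
  -- path.
  have hdiff : ∀ j ∈ J, eLpNorm (truncEst A Ck p.2 j - g (p.1 j)) 2 P ≤ err j := fun j hj => by
    refine eLpNorm_mono_ae ?_
    filter_upwards [hJle j hj] with z hz
    simp only [Pi.sub_apply, truncEst, Real.norm_eq_abs, ← hT]
    rcases min_cases T (A (p.2.task j) z) with ⟨h, h'⟩ | ⟨h, h'⟩ <;> rw [h]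
    rw [abs_of_nonneg (by linarith), abs_of_nonneg (by linarith)]
    linarith
  have herrtop : ∀ j, err j < ⊤ := fun j => by
    have h := (Finset.single_le_sum (fun i _ => bot_le) (Finset.mem_univ j)).trans hp.error
    have h' : err j ^ 2 < ⊤ := (le_self_add.trans h).trans_lt ENNReal.ofReal_lt_top
    by_contra hc
    rw [not_lt, top_le_iff] at hc
    simp [hc] at h'
  have hGL : ∀ j ∈ J, MemLp (truncEst A Ck p.2 j) 2 P := fun j hj => by
    have h : MemLp (truncEst A Ck p.2 j - g (p.1 j)) 2 P :=
      ⟨((hGm j).sub (hg.measurable_path _)).aestronglyMeasurable,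
        (hdiff j hj).trans_lt (herrtop j)⟩
    simpa using h.add (hp.memLp j)
  refine hg.exists_coefficients_avgError_le hk hM hr J hGL (fun j => toL2 P (g (p.1 j)))
    (by positivity) (fun x => ?_) ?_
  · let S := Finset.univ.filter fun j =>
      |⟪x, stdCoeff lam psi r (toL2 P (g (p.1 j)))⟫| < (1 / 2) ^ 43 * ‖x‖
    have hS : 4 * S.card ≤ m := hp.spread x
    have hcard : m ≤ 2 * (J \ S).card := by
      have h1 : (Finset.univ.filter fun j => p.1 j ∈ V).card + J.card = m := by
        rw [Finset.card_filter_add_card_filter_not, Finset.card_univ, Fintype.card_fin]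
      have h2 := Finset.le_card_sdiff S J
      omega
    have h1 : ∀ j ∈ J \ S, ((1 / 2) ^ 43 * ‖x‖) ^ 2 ≤
        ⟪x, stdCoeff lam psi r (toL2 P (g (p.1 j)))⟫ ^ 2 := fun j hj => by
      rw [← sq_abs ⟪x, _⟫]
      refine pow_le_pow_left₀ (by positivity) ?_ 2
      have := (Finset.mem_sdiff.1 hj).2
      simpa [S] using this
    have h2 := Finset.card_nsmul_le_sum _ _ _ h1
    have h3 : (m : ℝ) ≤ 2 * (J \ S).card := by exact_mod_cast hcard
    calc ((1 / 2) ^ 43 * √((m : ℝ) / 2)) ^ 2 * ‖x‖ ^ 2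
        = (m / 2) * ((1 / 2) ^ 43 * ‖x‖) ^ 2 := by
          rw [mul_pow, mul_pow, Real.sq_sqrt (by positivity)]; ring
      _ ≤ (J \ S).card * ((1 / 2) ^ 43 * ‖x‖) ^ 2 :=
          mul_le_mul_of_nonneg_right (by linarith) (sq_nonneg _)
      _ ≤ ∑ j ∈ J \ S, ⟪x, stdCoeff lam psi r (toL2 P (g (p.1 j)))⟫ ^ 2 := by
          rw [← nsmul_eq_mul]; exact h2
      _ ≤ _ := Finset.sum_le_sum_of_subset_of_nonneg Finset.sdiff_subset
          fun _ _ _ => sq_nonneg _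
  · set ρ : Fin m → ℝ := fun j =>
      ‖toL2 P (g (p.1 j)) - mercerProj psi r (toL2 P (g (p.1 j)))‖ with hρ
    set δ : Fin m → ℝ := fun j => ‖toL2 P (truncEst A Ck p.2 j) - toL2 P (g (p.1 j))‖ with hδ
    have h1 : ∑ j ∈ J, (δ j ^ 2 + ρ j ^ 2) ≤ D := by
      rw [← ENNReal.ofReal_le_ofReal_iff hD, ENNReal.ofReal_sum_of_nonneg fun j _ => by positivity]
      refine le_trans ?_ ((Finset.sum_le_sum_of_subset (Finset.subset_univ J)).trans hp.error)
      refine Finset.sum_le_sum fun j hj => ?_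
      rw [ENNReal.ofReal_add (sq_nonneg _) (sq_nonneg _)]
      exact add_le_add (norm_toL2_sub_sq_le (hGL j hj) (hp.memLp j) (hdiff j hj)) le_rfl
    calc _ ≤ ∑ j ∈ J, 2 * (δ j ^ 2 + ρ j ^ 2) := by
          refine Finset.sum_le_sum fun j _ => ?_
          have h2 := norm_add_le (toL2 P (truncEst A Ck p.2 j) - toL2 P (g (p.1 j)))
            (toL2 P (g (p.1 j)) - mercerProj psi r (toL2 P (g (p.1 j))))
          rw [sub_add_sub_cancel] at h2
          refine (pow_le_pow_left₀ (norm_nonneg _) h2 2).trans ?_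
          change (δ j + ρ j) ^ 2 ≤ _
          nlinarith [sq_nonneg (δ j - ρ j)]
      _ ≤ 2 * D := by
          rw [← Finset.mul_sum]
          linarith

end

/-! ### The event for a fixed sample size -/

lemma sqrt_rpow_neg {x : ℝ} (hx : 0 ≤ x) (b : ℝ) : √(x ^ (-b)) = x ^ (-b / 2) := by
  rw [Real.sqrt_eq_rpow, ← Real.rpow_mul hx]
  ring_nf

lemma coefficient_error_le {m ξ L K b : ℝ} (hm : 0 < m) (hξ : 0 ≤ ξ) (hKL : K ≤ L) :
    ((1 / 2) ^ 43 * √(m / 2))⁻¹ * √(2 * (m * ((ξ ^ 2 + m ^ (-b)) * L))) + √(K * m ^ (-b)) ≤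
      2 ^ 45 * (ξ + m ^ (-b / 2)) * √L := by
  have hmb : 0 ≤ m ^ (-b) := by positivity
  have hy : 0 ≤ m ^ (-b / 2) := by positivity
  have hs : 0 < √(m / 2) := Real.sqrt_pos.2 (by positivity)
  have e1 : √(2 * (m * ((ξ ^ 2 + m ^ (-b)) * L))) =
      √(m / 2) * (2 * (√(ξ ^ 2 + m ^ (-b)) * √L)) := by
    rw [show 2 * (m * ((ξ ^ 2 + m ^ (-b)) * L)) = m / 2 * (2 ^ 2 * ((ξ ^ 2 + m ^ (-b)) * L)) by ring,
      Real.sqrt_mul (by positivity), Real.sqrt_mul (by positivity), Real.sqrt_sq (by norm_num),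
      Real.sqrt_mul (by positivity)]
  have e2 : √(ξ ^ 2 + m ^ (-b)) ≤ ξ + m ^ (-b / 2) := by
    rw [← sqrt_rpow_neg hm.le]
    refine Real.sqrt_le_iff.2 ⟨by positivity, ?_⟩
    have := Real.sq_sqrt hmb
    nlinarith [mul_nonneg hξ (Real.sqrt_nonneg (m ^ (-b)))]
  have e3 : √(K * m ^ (-b)) ≤ √L * (ξ + m ^ (-b / 2)) := by
    rw [Real.sqrt_mul' _ hmb, sqrt_rpow_neg hm.le]
    exact mul_le_mul (Real.sqrt_le_sqrt hKL) (by linarith) hy (Real.sqrt_nonneg _)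
  have e4 := mul_le_mul_of_nonneg_right e2 (Real.sqrt_nonneg L)
  have e5 : ((1 / 2) ^ 43 * √(m / 2))⁻¹ * (√(m / 2) * (2 * (√(ξ ^ 2 + m ^ (-b)) * √L))) =
      2 ^ 44 * (√(ξ ^ 2 + m ^ (-b)) * √L) := by
    field_simp
  rw [e1, e5]
  have e6 : 0 ≤ (ξ + m ^ (-b / 2)) * √L := by positivity
  linarith

section

variable {U Z : Type*} [MeasurableSpace U] [MeasurableSpace Z] {μ : Measure U}
  [IsProbabilityMeasure μ] {P : Measure Z} [IsProbabilityMeasure P] {k : Z → Z → ℝ}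
  {g : U → Z → ℝ} {B : ℝ} {lam : ℕ → ℝ} {psi : ℕ → Lp ℝ 2 P} {m n : ℕ}

namespace IsCenteredGP

lemma avgError_zero_le (hg : IsCenteredGP μ k g) (hk : ∀ x y, |k x y| ≤ B)
    (hM : IsMercerSystem P k lam psi) {r : ℕ} (hr : ∀ i < r, 0 < lam i) {c : ℝ}
    (hc : ∀ f, √(lam 0) * ‖stdCoeff lam psi r f‖ ≤ c * ‖stdCoeff lam psi r f‖)
    (G : Fin m → Z → ℝ) :
    avgError P μ g G (fun _ => 0) ≤ ENNReal.ofReal (∫ u, (c * ‖stdCoeff lam psi r (toL2 P (g u))‖ +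
      ‖toL2 P (g u) - mercerProj psi r (toL2 P (g u))‖) ∂μ) := by
  have h0 : ∀ f, 0 ≤ c * ‖stdCoeff lam psi r f‖ := fun f => le_trans (by positivity) (hc f)
  have hI : Integrable (fun u => c * ‖stdCoeff lam psi r (toL2 P (g u))‖ +
      ‖toL2 P (g u) - mercerProj psi r (toL2 P (g u))‖) μ :=
    ((hg.integrable_norm_stdCoeff hk r).const_mul c).add (hg.integrable_residual hk hM hr)
  rw [ofReal_integral_eq_lintegral_ofReal hI
    (ae_of_all _ fun u => add_nonneg (h0 _) (norm_nonneg _)), avgError]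
  refine lintegral_mono_ae ?_
  filter_upwards [hg.ae_memLp_path (P := P) hk] with u hu
  have e : eLpNorm (fun z => learnedFun G (0 : EuclideanSpace ℝ (Fin m)) z - g u z) 2 P =
      ENNReal.ofReal ‖toL2 P (g u)‖ := by
    have h1 : (fun z => learnedFun G (0 : EuclideanSpace ℝ (Fin m)) z - g u z) = -g u := by
      ext z; simp [learnedFun]
    rw [h1, eLpNorm_neg, ofReal_norm, toL2, dif_pos hu, Lp.enorm_toLp]
  rw [e]
  refine ENNReal.ofReal_le_ofReal ?_
  have h1 := norm_add_le (mercerProj psi r (toL2 P (g u)))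
    (toL2 P (g u) - mercerProj psi r (toL2 P (g u)))
  rw [add_sub_cancel] at h1
  have h2 := norm_mercerProj_le hM hr (toL2 P (g u))
  have h3 := hc (toL2 P (g u))
  linarith

/-- This converts an error bound without an RKHS norm into the claimed one: on average that norm is
at least `√m / 32`, since `m / 2` is at least `m / 4` after rounding down. -/
lemma le_integral_stdCoeff_add_residual (hg : IsCenteredGP μ k g) (hk : ∀ x y, |k x y| ≤ B)
    (hM : IsMercerSystem P k lam psi) (hm : 2 ≤ m) (hr : ∀ i < m / 2, 0 < lam i) {c : ℝ}
    (hc : 0 ≤ c) :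
    c * (√m / 32) ≤ ∫ u, (c * ‖stdCoeff lam psi (m / 2) (toL2 P (g u))‖ +
      ‖toL2 P (g u) - mercerProj psi (m / 2) (toL2 P (g u))‖) ∂μ := by
  rw [integral_add ((hg.integrable_norm_stdCoeff hk _).const_mul c)
    (hg.integrable_residual hk hM hr), integral_const_mul]
  have h1 := mul_le_mul_of_nonneg_left (hg.sqrt_le_integral_norm_stdCoeff hk hM hr) hc
  have h2 : 0 ≤ ∫ u, ‖toL2 P (g u) - mercerProj psi (m / 2) (toL2 P (g u))‖ ∂μ :=
    integral_nonneg fun u => norm_nonneg _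
  have h3 : √(m : ℝ) / 2 ≤ √((m / 2 : ℕ) : ℝ) := by
    refine Real.le_sqrt_of_sq_le ?_
    rw [div_pow, Real.sq_sqrt (by positivity)]
    have : (m : ℝ) ≤ 4 * (m / 2 : ℕ) := by exact_mod_cast (by omega : m ≤ 4 * (m / 2))
    linarith
  have h4 : c * (√m / 32) ≤ c * (√((m / 2 : ℕ) : ℝ) / 16) :=
    mul_le_mul_of_nonneg_left (by linarith) hc
  linarith

end IsCenteredGP

variable {H : Type*} [NormedAddCommGroup H] [InnerProductSpace ℝ H] [CompleteSpace H]
  [RKHS ℝ H Z ℝ]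

lemma approxBound_eq (hg : IsCenteredGP μ k g) (hk : ∀ x y, |k x y| ≤ B)
    (hM : IsMercerSystem P k lam psi) (hker : ∀ x y, RKHS.kernel H x y 1 = k x y)
    (hr : ∀ i < m / 2, 0 < lam i) (c b x : ℝ) (f : Lp ℝ 2 P) :
    approxBound P H psi c b m n x f =
      c * (x + (m : ℝ) ^ (-(b + 1) / 2)) * √(Real.log n) * ‖stdCoeff lam psi (m / 2) f‖ +
        ‖f - mercerProj psi (m / 2) f‖ := by
  rw [approxBound, rkhsNorm_mercerProj hker hg.measurable_kernel hk hM hr]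
  ring

/-- For few draws the factor `m ^ (-(b + 1) / 2) * L`, with `L = √(log n)`, is at least `√L`. This
exceeds `√(lam 0)`, so the bound already covers the whole projection. -/
lemma exists_event_of_few_draws (hg : IsCenteredGP μ k g) (hk : ∀ x y, |k x y| ≤ B)
    (hM : IsMercerSystem P k lam psi) (hker : ∀ x y, RKHS.kernel H x y 1 = k x y)
    (hr : ∀ i < m / 2, 0 < lam i) {b ξ : ℝ} (hξ : 0 ≤ ξ)
    (hL1 : 1 ≤ √(Real.log n)) (hL0 : lam 0 ≤ √(Real.log n))
    (hfew : (m : ℝ) ^ (b + 1) ≤ √(Real.log n)) (G : Fin m → Z → ℝ) :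
    avgError P μ g G (fun _ => 0) ≤
      ENNReal.ofReal (∫ u, approxBound P H psi (2 ^ 50) b m n
        ((m : ℝ) ^ (-(1 / 2) : ℝ) * ξ) (toL2 P (g u)) ∂μ) := by
  simp_rw [approxBound_eq hg hk hM hker hr]
  refine hg.avgError_zero_le hk hM hr (fun f => ?_) G
  -- For `m = 0` the real power of `0` with negative exponent is `0`, so no lower bound on it is
  -- available; there are no coefficients to bound either.
  rcases Nat.eq_zero_or_pos m with rfl | hm
  · have h : ‖stdCoeff lam psi (0 / 2) f‖ = 0 := by
      rw [← sq_eq_zero_iff, norm_stdCoeff_sq _ hM.nonneg]; simp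
    rw [h]; simp
  refine mul_le_mul_of_nonneg_right ?_ (norm_nonneg _)
  set L := √(Real.log n) with hL
  have hm' : (0 : ℝ) < m := by exact_mod_cast hm
  have h1 : (√L)⁻¹ ≤ (m : ℝ) ^ (-(b + 1) / 2) := by
    rw [← sqrt_rpow_neg hm'.le, Real.rpow_neg hm'.le, Real.sqrt_inv]
    exact inv_anti₀ (Real.sqrt_pos.2 (by positivity)) (Real.sqrt_le_sqrt hfew)
  have h2 : √L ≤ (m : ℝ) ^ (-(b + 1) / 2) * L := by
    have h3 := mul_le_mul_of_nonneg_right h1 (by linarith : 0 ≤ L)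
    rwa [inv_mul_eq_div, Real.div_sqrt] at h3
  have h4 : √(lam 0) ≤ √L := Real.sqrt_le_sqrt hL0
  have h5 : 0 ≤ (m : ℝ) ^ (-(1 / 2) : ℝ) * ξ * L := by positivity
  have h6 := Real.sqrt_nonneg L
  nlinarith

/-- The constant `2 ^ 50` is `32 * 2 ^ 45`: the error constant `2 ^ 45` from `coefficient_error_le`,
divided by the `1 / 32` in the lower bound for the mean norm. The coefficient bound alone would only
need `2 ^ 44`. -/
lemma exists_event_of_many_draws (hg : IsCenteredGP μ k g) (hk : ∀ x y, |k x y| ≤ B)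
    (hM : IsMercerSystem P k lam psi) (hker : ∀ x y, RKHS.kernel H x y 1 = k x y)
    (hr : ∀ i < m / 2, 0 < lam i) {b ξ K : ℝ} (hξ : 0 ≤ ξ) (hm : 2 ≤ m)
    (hres : ∫ u, ‖toL2 P (g u) - mercerProj psi (m / 128) (toL2 P (g u))‖ ^ 2 ∂μ ≤
      K * (m : ℝ) ^ (-b))
    {A : (Fin n → Z × ℝ) → Z → ℝ} (hA : Measurable (Function.uncurry A)) {Ck : ℝ}
    (hL1 : 1 ≤ √(Real.log n)) (hLK : K ≤ √(Real.log n))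
    {p : (Fin m → U) × SharedData Z m n}
    (hp : IsGoodSample P g lam psi A (Ck * Real.log n) (m / 128)
      (m * ((ξ ^ 2 + (m : ℝ) ^ (-b)) * √(Real.log n))) p) :
    ∃ Θ : Lp ℝ 2 P →L[ℝ] EuclideanSpace ℝ (Fin m),
      (∀ f, learnedNorm (Θ f) ≤ 2 ^ 50 * rkhsNorm P H (mercerProj psi (m / 2) f)) ∧
      avgError P μ g (truncEst A Ck p.2) Θ ≤
        ENNReal.ofReal (∫ u, approxBound P H psi (2 ^ 50) b m n
          ((m : ℝ) ^ (-(1 / 2) : ℝ) * ξ) (toL2 P (g u)) ∂μ) ∧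
      avgError P μ g (truncEst A Ck p.2) Θ ≤
        ENNReal.ofReal (2 ^ 45 * (ξ + (m : ℝ) ^ (-b / 2)) * √(Real.log n)) := by
  simp_rw [approxBound_eq hg hk hM hker hr]
  set L := √(Real.log n) with hL
  have hm' : (0 : ℝ) < m := by exact_mod_cast (by omega : 0 < m)
  have hr' : ∀ i < m / 128, 0 < lam i := fun i hi => hr i (by omega)
  obtain ⟨Θ, hΘ, herr⟩ := hp.exists_coefficients hg hk hM hr' (by omega) hA (by positivity)
  have hbound : avgError P μ g (truncEst A Ck p.2) Θ ≤
      ENNReal.ofReal (2 ^ 45 * (ξ + (m : ℝ) ^ (-b / 2)) * L) := by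
    refine herr.trans (ENNReal.ofReal_le_ofReal ?_)
    refine (add_le_add le_rfl (Real.sqrt_le_sqrt hres)).trans
      ((coefficient_error_le hm' hξ hLK).trans ?_)
    refine mul_le_mul_of_nonneg_left ?_ (by positivity)
    exact Real.sqrt_le_self_iff.2 (Or.inr hL1)
  refine ⟨Θ, fun f => ?_, hbound.trans (ENNReal.ofReal_le_ofReal ?_), hbound⟩
  · rw [rkhsNorm_mercerProj hker hg.measurable_kernel hk hM hr, learnedNorm]
    have h1 := norm_stdCoeff_mono (psi := psi) hM.nonneg (by omega : m / 128 ≤ m / 2) f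
    have h2 : √(m : ℝ) ≤ 2 * √((m : ℝ) / 2) := by
      rw [Real.sqrt_le_left (by positivity), mul_pow, Real.sq_sqrt (by positivity)]
      linarith
    have hs : 0 < √((m : ℝ) / 2) := Real.sqrt_pos.2 (by positivity)
    calc √(m : ℝ) * ‖Θ f‖
        ≤ (2 * √((m : ℝ) / 2)) * (((1 / 2) ^ 43 * √((m : ℝ) / 2))⁻¹ *
            ‖stdCoeff lam psi (m / 2) f‖) := by
          refine mul_le_mul h2 ((hΘ f).trans ?_) (norm_nonneg _) (by positivity)
          exact mul_le_mul_of_nonneg_left h1 (by positivity)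
      _ = 2 ^ 44 * ‖stdCoeff lam psi (m / 2) f‖ := by field_simp
      _ ≤ _ := mul_le_mul_of_nonneg_right (by norm_num) (norm_nonneg _)
  · have hc : 0 ≤ 2 ^ 50 * ((m : ℝ) ^ (-(1 / 2) : ℝ) * ξ + (m : ℝ) ^ (-(b + 1) / 2)) * L := by
      positivity
    refine le_trans (le_of_eq ?_) (hg.le_integral_stdCoeff_add_residual hk hM hm hr hc)
    have e1 : (m : ℝ) ^ (-(1 / 2) : ℝ) * √m = 1 := by
      rw [Real.sqrt_eq_rpow, ← Real.rpow_add hm']; norm_num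
    have e2 : (m : ℝ) ^ (-(b + 1) / 2) * √m = (m : ℝ) ^ (-b / 2) := by
      rw [Real.sqrt_eq_rpow, ← Real.rpow_add hm']; ring_nf
    calc 2 ^ 45 * (ξ + (m : ℝ) ^ (-b / 2)) * L
        = 2 ^ 45 * (((m : ℝ) ^ (-(1 / 2) : ℝ) * √m) * ξ + (m : ℝ) ^ (-(b + 1) / 2) * √m) * L := by
          rw [e1, e2, one_mul]
      _ = _ := by ring

lemma measure_not_isGoodSample_le_of_many_draws (hg : IsCenteredGP μ k g)
    (hk : ∀ x y, |k x y| ≤ B) (hM : IsMercerSystem P k lam psi) (hr : ∀ i < m / 2, 0 < lam i)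
    {b ξ K : ℝ} (hb : 0 < b) (hK : 0 ≤ K) (hm : 0 < m)
    (hres : ∫ u, ‖toL2 P (g u) - mercerProj psi (m / 128) (toL2 P (g u))‖ ^ 2 ∂μ ≤
      K * (m : ℝ) ^ (-b))
    {A : (Fin n → Z × ℝ) → Z → ℝ} (hA : Measurable (Function.uncurry A))
    {Q : Kernel U (Z × ℝ)} [IsMarkovKernel Q]
    (hrisk : oracleRisk P μ g Q n A ≤ ENNReal.ofReal (ξ ^ 2))
    {ν : Measure ((Fin m → U) × SharedData Z m n)} (hν : IsSharedSample μ Q ν) (T : ℝ) {L : ℝ}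
    (hL : 0 < L) (hmany : L < (m : ℝ) ^ (b + 1)) :
    ν {p | ¬ IsGoodSample P g lam psi A T (m / 128) (m * ((ξ ^ 2 + (m : ℝ) ^ (-b)) * L)) p} ≤
      2 * ENNReal.ofReal ((L ^ (1 / (b + 1)))⁻¹) + 4 * μ {u | ¬ ∀ᵐ z ∂P, g u z ≤ T} +
        ENNReal.ofReal ((1 + K) / L) := by
  have hm' : (0 : ℝ) < m := by exact_mod_cast hm
  have hmb : 0 < (m : ℝ) ^ (-b) := Real.rpow_pos_of_pos hm' _
  have hD : 0 < m * ((ξ ^ 2 + (m : ℝ) ^ (-b)) * L) := by positivity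
  refine (hν.measure_not_isGoodSample_le hg hk hM (fun i hi => hr i (by omega))
    (by omega) hm hA hrisk hres T hD).trans (add_le_add (add_le_add ?_ le_rfl) ?_)
  -- There is no assumption that `m` tends to infinity. The condition on many draws supplies a lower
  -- bound on `m` that does, and `2 ^ m ≥ m` suffices.
  · have h1 : L ^ (1 / (b + 1)) ≤ m := by
      have h2 := Real.rpow_le_rpow hL.le hmany.le (by positivity : 0 ≤ 1 / (b + 1))
      rwa [← Real.rpow_mul hm'.le, mul_one_div_cancel (by positivity), Real.rpow_one] at h2
    have h2 : (m : ℝ) ≤ 2 ^ m := by exact_mod_cast Nat.lt_two_pow_self.le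
    have h3 : ((2 : ℝ≥0∞) ^ m)⁻¹ = ENNReal.ofReal ((2 ^ m)⁻¹) := by
      rw [ENNReal.ofReal_inv_of_pos (by positivity), ENNReal.ofReal_pow (by norm_num)]
      norm_num
    rw [h3]
    gcongr
    exact h1.trans h2
  · rw [← ENNReal.ofReal_add (sq_nonneg _) (by positivity), ← ENNReal.ofReal_natCast,
      ← ENNReal.ofReal_mul (by positivity), ← ENNReal.ofReal_div_of_pos hD]
    refine ENNReal.ofReal_le_ofReal ?_
    rw [mul_div_mul_left _ _ hm'.ne', div_le_div_iff₀ (by positivity) hL]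
    have : ξ ^ 2 + K * (m : ℝ) ^ (-b) ≤ (1 + K) * (ξ ^ 2 + (m : ℝ) ^ (-b)) := by
      nlinarith [mul_nonneg hK (sq_nonneg ξ)]
    calc _ ≤ (1 + K) * (ξ ^ 2 + (m : ℝ) ^ (-b)) * L := mul_le_mul_of_nonneg_right this hL.le
      _ = _ := by ring

/-- For a fixed, sufficiently large sample size, the event on which the learned space approximates
the process. -/
lemma exists_event (hg : IsCenteredGP μ k g) (hk : ∀ x y, |k x y| ≤ B)
    (hM : IsMercerSystem P k lam psi) (hker : ∀ x y, RKHS.kernel H x y 1 = k x y)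
    (hr : ∀ i < m / 2, 0 < lam i) {b ξ K : ℝ} (hb : 0 < b) (hξ : 0 ≤ ξ) (hK : 0 ≤ K)
    (hres : 0 < m → ∫ u, ‖toL2 P (g u) - mercerProj psi (m / 128) (toL2 P (g u))‖ ^ 2 ∂μ ≤
      K * (m : ℝ) ^ (-b))
    {A : (Fin n → Z × ℝ) → Z → ℝ} (hA : Measurable (Function.uncurry A))
    {Q : Kernel U (Z × ℝ)} [IsMarkovKernel Q]
    (hrisk : oracleRisk P μ g Q n A ≤ ENNReal.ofReal (ξ ^ 2))
    {ν : Measure ((Fin m → U) × SharedData Z m n)} (hν : IsSharedSample μ Q ν) (Ck : ℝ)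
    (hL1 : 1 ≤ √(Real.log n)) (hLK : K ≤ √(Real.log n)) (hL0 : lam 0 ≤ √(Real.log n)) :
    ∃ E : Set ((Fin m → U) × SharedData Z m n), MeasurableSet E ∧
      ν Eᶜ ≤ 2 * ENNReal.ofReal ((√(Real.log n) ^ (1 / (b + 1)))⁻¹) +
        4 * μ {u | ¬ ∀ᵐ z ∂P, g u z ≤ Ck * Real.log n} +
          ENNReal.ofReal ((1 + K) / √(Real.log n)) ∧
      ∀ p ∈ E, ∃ Θ : Lp ℝ 2 P → EuclideanSpace ℝ (Fin m), Measurable[borel _] Θ ∧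
        (∀ f, learnedNorm (Θ f) ≤ 2 ^ 50 * rkhsNorm P H (mercerProj psi (m / 2) f)) ∧
        avgError P μ g (truncEst A Ck p.2) Θ ≤
          ENNReal.ofReal (∫ u, approxBound P H psi (2 ^ 50) b m n
            ((m : ℝ) ^ (-(1 / 2) : ℝ) * ξ) (toL2 P (g u)) ∂μ) ∧
        (√(Real.log n) < (m : ℝ) ^ (b + 1) → avgError P μ g (truncEst A Ck p.2) Θ ≤
          ENNReal.ofReal (2 ^ 45 * (ξ + (m : ℝ) ^ (-b / 2)) * √(Real.log n))) := by
  rcases le_or_gt ((m : ℝ) ^ (b + 1)) √(Real.log n) with hfew | hmany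
  · refine ⟨Set.univ, .univ, by simp, fun p _ => ⟨fun _ => 0, measurable_const, fun f => ?_,
      exists_event_of_few_draws hg hk hM hker hr hξ hL1 hL0 hfew _,
      fun h => absurd h (not_lt.2 hfew)⟩⟩
    rw [rkhsNorm_mercerProj hker hg.measurable_kernel hk hM hr]
    simp [learnedNorm]
  · have hm : 2 ≤ m := by
      by_contra hc
      have : (m : ℝ) ^ (b + 1) ≤ 1 :=
        Real.rpow_le_one (by positivity) (by exact_mod_cast (by omega : m ≤ 1)) (by positivity)
      linarith
    have hres' := hres (by omega)
    set bad : Set ((Fin m → U) × SharedData Z m n) :=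
      {p | ¬ IsGoodSample P g lam psi A (Ck * Real.log n) (m / 128)
        (m * ((ξ ^ 2 + (m : ℝ) ^ (-b)) * √(Real.log n))) p} with hbad
    -- The bad set need not be measurable, since its spread condition quantifies over all directions
    -- and its error term uses an almost everywhere measurable residual. Its measurable hull has the
    -- same measure.
    refine ⟨(toMeasurable ν bad)ᶜ, (measurableSet_toMeasurable _ _).compl, ?_, fun p hp => ?_⟩
    · rw [compl_compl, measure_toMeasurable]
      exact measure_not_isGoodSample_le_of_many_draws hg hk hM hr hb hK (by omega) hres' hA hrisk
        hν _ (by linarith) hmany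
    · have hgood := not_not.1 fun h => hp (subset_toMeasurable ν bad h)
      obtain ⟨Θ, h1, h2, h3⟩ := exists_event_of_many_draws hg hk hM hker hr hξ hm hres' hA hL1 hLK
        hgood
      have hΘ : Measurable[borel _] Θ := by
        let _ : MeasurableSpace ↥(Lp ℝ 2 P) := borel _
        have _ : BorelSpace ↥(Lp ℝ 2 P) := ⟨rfl⟩
        exact Θ.continuous.measurable
      exact ⟨Θ, hΘ, h1, h2, fun _ => h3⟩

end

/-! ### Growth of the number of draws -/

lemma tendsto_sqrt_log_atTop : Tendsto (fun n : ℕ => √(Real.log n)) atTop atTop :=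
  Real.tendsto_sqrt_atTop.comp (Real.tendsto_log_atTop.comp tendsto_natCast_atTop_atTop)

lemma half_rpow_le_floor {b : ℝ} (hb : 0 < b) {n : ℕ} (hn : 1 ≤ n) :
    (n : ℝ) ^ (1 / (b + 1)) / 2 ≤ (⌊(n : ℝ) ^ (1 / (b + 1))⌋₊ : ℝ) := by
  have h1 : (1 : ℝ) ≤ (n : ℝ) ^ (1 / (b + 1)) :=
    Real.one_le_rpow (by exact_mod_cast hn) (by positivity)
  have h2 := Nat.lt_floor_add_one ((n : ℝ) ^ (1 / (b + 1)))
  have h3 : (1 : ℝ) ≤ (⌊(n : ℝ) ^ (1 / (b + 1))⌋₊ : ℝ) := by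
    exact_mod_cast (Nat.one_le_floor_iff _).2 h1
  linarith

lemma floor_rpow_neg_le {b : ℝ} (hb : 0 < b) {n : ℕ} (hn : 1 ≤ n) :
    (⌊(n : ℝ) ^ (1 / (b + 1))⌋₊ : ℝ) ^ (-b / 2) ≤
      2 ^ (b / 2) * (n : ℝ) ^ (-(b / (2 * (b + 1)))) := by
  have hn' : (0 : ℝ) < n := by exact_mod_cast hn
  have h0 : 0 < (n : ℝ) ^ (1 / (b + 1)) := Real.rpow_pos_of_pos hn' _
  refine (Real.rpow_le_rpow_of_nonpos (by positivity) (half_rpow_le_floor hb hn)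
    (by linarith)).trans_eq ?_
  rw [Real.div_rpow h0.le (by norm_num), ← Real.rpow_mul hn'.le,
    show -b / 2 = -(b / 2) by ring, Real.rpow_neg (by norm_num : (0 : ℝ) ≤ 2), div_inv_eq_mul,
    mul_comm]
  congr 2
  field_simp

/-- With the prescribed growth, `m ^ (b + 1)` is of order `n`, so the case of many draws holds
eventually. -/
lemma eventually_sqrt_log_lt_floor {b : ℝ} (hb : 0 < b) :
    ∀ᶠ n : ℕ in atTop, √(Real.log n) < (⌊(n : ℝ) ^ (1 / (b + 1))⌋₊ : ℝ) ^ (b + 1) := by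
  have hc : (0 : ℝ) < (1 / 2) ^ (b + 1) := by positivity
  have h1 : ∀ᶠ n : ℕ in atTop, Real.log n ≤ ((1 / 2) ^ (b + 1) / 2) * n := by
    have h := (Real.isLittleO_log_id_atTop.comp_tendsto tendsto_natCast_atTop_atTop).def
      (half_pos hc)
    filter_upwards [h] with n hn
    simp only [Function.comp, id, Real.norm_eq_abs, Nat.abs_cast] at hn
    exact (le_abs_self _).trans hn
  filter_upwards [h1, tendsto_sqrt_log_atTop.eventually_ge_atTop 1, eventually_ge_atTop 1]
    with n hn hlog hn1
  have hn' : (0 : ℝ) < n := by exact_mod_cast hn1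
  have h2 : √(Real.log n) ≤ Real.log n := by
    have h0 : 0 ≤ Real.log n := Real.log_natCast_nonneg n
    nlinarith [Real.sq_sqrt h0]
  have h3 : ((n : ℝ) ^ (1 / (b + 1)) / 2) ^ (b + 1) = (1 / 2) ^ (b + 1) * n := by
    rw [div_eq_mul_one_div, Real.mul_rpow (by positivity) (by norm_num), ← Real.rpow_mul hn'.le,
      one_div_mul_cancel (by positivity), Real.rpow_one, mul_comm]
  have h4 := Real.rpow_le_rpow (by positivity) (half_rpow_le_floor hb hn1)
    (by positivity : 0 ≤ b + 1)
  have h5 : 0 < (1 / 2) ^ (b + 1) * (n : ℝ) := by positivity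
  linarith

lemma tendsto_measure_one_of_compl_le {Ω : ℕ → Type*} [∀ n, MeasurableSpace (Ω n)]
    {ν : ∀ n, Measure (Ω n)} (hν : ∀ n, IsProbabilityMeasure (ν n)) {E : ∀ n, Set (Ω n)}
    (hE : ∀ n, MeasurableSet (E n)) {δ : ℕ → ℝ≥0∞} (hδ : Tendsto δ atTop (𝓝 0))
    (h : ∀ᶠ n in atTop, ν n (E n)ᶜ ≤ δ n) : Tendsto (fun n => ν n (E n)) atTop (𝓝 1) := by
  have h1 : Tendsto (fun n => ν n (E n)ᶜ) atTop (𝓝 0) :=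
    tendsto_of_tendsto_of_tendsto_of_le_of_le' tendsto_const_nhds hδ
      (Eventually.of_forall fun _ => bot_le) h
  have h2 := ENNReal.Tendsto.sub (tendsto_const_nhds (x := (1 : ℝ≥0∞))) h1
    (Or.inl ENNReal.one_ne_top)
  rw [tsub_zero] at h2
  refine h2.congr fun n => ?_
  rw [← prob_compl_eq_one_sub (hE n).compl, compl_compl]

end

/-! ### The main theorem: choice of the constants and of the events -/

theorem mainTheorem8 :
    ∃ c_r : ℝ, 0 < c_r ∧
    ∀ (Z : Type*) [TopologicalSpace Z] [MeasurableSpace Z] [BorelSpace Z]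
      (P : Measure Z) [IsProbabilityMeasure P]
      -- the feature map, the latent kernel and the prior draws
      (d : ℕ) (Zbar : Set (EuclideanSpace ℝ (Fin d))) (Φ : Z → Zbar) (_ : Continuous Φ)
      (_ : ∃ S : Set (EuclideanSpace ℝ (Fin d)), Bornology.IsBounded S ∧
        ∀ᵐ z ∂P, (Φ z : EuclideanSpace ℝ (Fin d)) ∈ S)
      (kbar : Zbar → Zbar → ℝ) (_ : ∃ B : ℝ, ∀ x y, |kbar x y| ≤ B)
      (U : Type*) [MeasurableSpace U] (μ : Measure U) [IsProbabilityMeasure μ]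
      (gbar : U → Zbar → ℝ) (_ : IsCenteredGP μ kbar gbar)
      (_ : ∀ᵐ u ∂μ, eLpNorm (gbar u) ⊤ (P.map Φ) < ⊤)
      -- eigendecay of the latent kernel
      (b : ℝ) (_ : 0 < b)
      (lambar : ℕ → ℝ) (psibar : ℕ → Lp ℝ 2 (P.map Φ))
      (_ : IsMercerSystem (P.map Φ) kbar lambar psibar)
      (_ : ∃ K : ℝ, ∀ i : ℕ, lambar i ≤ K * ((i : ℝ) + 1) ^ (-(b + 1)))
      -- the induced kernel on the input space, its RKHS and its Mercer eigensystem
      (H : Type*) [NormedAddCommGroup H] [InnerProductSpace ℝ H] [CompleteSpace H]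
      [RKHS ℝ H Z ℝ] (_ : ∀ z z', RKHS.kernel H z z' 1 = kbar (Φ z) (Φ z'))
      (lam : ℕ → ℝ) (psi : ℕ → Lp ℝ 2 P)
      (_ : IsMercerSystem P (fun z z' => kbar (Φ z) (Φ z')) lam psi),
    ∃ (C : ℝ) (q : ℕ),
    -- the observation model and the regression oracle
    ∀ (Q : Kernel U (Z × ℝ)) [IsMarkovKernel Q] (s : ℝ≥0)
      (_ : IsNoisyObservation P μ (fun u z => gbar u (Φ z)) Q s)
      (A : (n : ℕ) → (Fin n → Z × ℝ) → Z → ℝ)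
      (_ : ∀ n, Measurable (Function.uncurry (A n)))
      (ξ : ℕ → ℝ) (_ : ∀ n, 0 ≤ ξ n) (_ : Tendsto ξ atTop (𝓝 0))
      (_ : ∀ n, oracleRisk P μ (fun u z => gbar u (Φ z)) Q n (A n) ≤ ENNReal.ofReal (ξ n ^ 2))
      (Ck : ℝ) (_ : 0 < Ck)
      -- the number of draws, and the joint law of the draws and the shared dataset
      (m : ℕ → ℕ) (_ : ∀ n, ∀ i < m n / 2, 0 < lam i)
      (ν : (n : ℕ) → Measure ((Fin (m n) → U) × SharedData Z (m n) n))
      (_ : ∀ n, IsSharedSample μ Q (ν n)),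
    ∃ E : (n : ℕ) → Set ((Fin (m n) → U) × SharedData Z (m n) n),
      (∀ n, MeasurableSet (E n)) ∧ Tendsto (fun n => ν n (E n)) atTop (𝓝 1) ∧
      ∀ n, ∀ p ∈ E n,
        ∃ Θ : Lp ℝ 2 P → EuclideanSpace ℝ (Fin (m n)), Measurable[borel _] Θ ∧
          (∀ f : Lp ℝ 2 P,
            learnedNorm (Θ f) ≤ c_r * rkhsNorm P H (mercerProj psi (m n / 2) f)) ∧
          avgError P μ (fun u z => gbar u (Φ z)) (truncEst (A n) Ck p.2) Θ ≤
            ENNReal.ofReal (∫ u, approxBound P H psi c_r b (m n) n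
              ((m n : ℝ) ^ (-(1 / 2) : ℝ) * ξ n) (toL2 P fun z => gbar u (Φ z)) ∂μ) ∧
          ((∀ k : ℕ, m k = ⌊(k : ℝ) ^ (1 / (b + 1))⌋₊) → 2 ≤ n →
            avgError P μ (fun u z => gbar u (Φ z)) (truncEst (A n) Ck p.2) Θ ≤
              ENNReal.ofReal (C * Real.log n ^ q *
                (ξ n + (n : ℝ) ^ (-(b / (2 * (b + 1))))))) := by
  refine ⟨2 ^ 50, by positivity, ?_⟩
  intro Z _ _ _ P _ d Zbar Φ hΦ _ kbar hkB U _ μ _ gbar hgbar hbdd b hb lambar psibar hMbar hdecay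
    H _ _ _ _ hker lam psi hM
  -- The factor `2 ^ (b / 2)` pays for rounding down the number of draws. One power of the logarithm
  -- is enough, as `√(log n) ≤ log n` once `n` is large.
  refine ⟨2 ^ 45 * 2 ^ (b / 2), 1, ?_⟩
  intro Q _ s _ A hA ξ hξ _ hrisk Ck hCk m hm ν hν
  obtain ⟨B, hk⟩ := hkB
  obtain ⟨K, hK⟩ := hdecay
  have hΦm : Measurable Φ := hΦ.measurable
  have hg := hgbar.comp_measurable hΦm
  have hk' : ∀ x y, |kbar (Φ x) (Φ y)| ≤ B := fun x y => hk _ _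
  obtain ⟨K', hK', hres⟩ := hgbar.exists_integral_residual_sq_le hΦm hk hM hb
    fun i => (hgbar.eigenvalue_le hΦm hk hM hMbar i).trans (hK i)
  have hbdd' : ∀ᵐ u ∂μ, eLpNorm (fun z => gbar u (Φ z)) ⊤ P < ⊤ := by
    filter_upwards [hbdd] with u hu
    rwa [eLpNorm_map_measure (hgbar.measurable_path u).aestronglyMeasurable hΦm.aemeasurable] at hu
  set L : ℕ → ℝ := fun n => √(Real.log n) with hL
  have hLtop : Tendsto L atTop atTop := tendsto_sqrt_log_atTop
  let δ : ℕ → ℝ≥0∞ := fun n => 2 * ENNReal.ofReal ((L n ^ (1 / (b + 1)))⁻¹) +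
    4 * μ {u | ¬ ∀ᵐ z ∂P, gbar u (Φ z) ≤ Ck * Real.log n} + ENNReal.ofReal ((1 + K') / L n)
  have hδ : Tendsto δ atTop (𝓝 0) := by
    have h1 : Tendsto (fun n => ENNReal.ofReal ((L n ^ (1 / (b + 1)))⁻¹)) atTop (𝓝 0) := by
      rw [← ENNReal.ofReal_zero]
      exact ENNReal.tendsto_ofReal (((tendsto_rpow_atTop (by positivity)).comp
        hLtop).inv_tendsto_atTop)
    have h2 : Tendsto (fun n : ℕ => μ {u | ¬ ∀ᵐ z ∂P, gbar u (Φ z) ≤ Ck * Real.log n}) atTop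
        (𝓝 0) :=
      (hg.tendsto_measure_not_ae_le hbdd').comp (Tendsto.const_mul_atTop hCk
        (Real.tendsto_log_atTop.comp tendsto_natCast_atTop_atTop))
    have h3 : Tendsto (fun n => ENNReal.ofReal ((1 + K') / L n)) atTop (𝓝 0) := by
      rw [← ENNReal.ofReal_zero]
      exact ENNReal.tendsto_ofReal (hLtop.const_div_atTop _)
    have h4 := ((ENNReal.Tendsto.const_mul (a := 2) h1 (Or.inr ENNReal.ofNat_ne_top)).add
      (ENNReal.Tendsto.const_mul (a := 4) h2 (Or.inr ENNReal.ofNat_ne_top))).add h3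
    rwa [mul_zero, mul_zero, add_zero, add_zero] at h4
  -- Below `n₀` the events are taken empty. This does not affect the limit of the probabilities and
  -- makes the final rate hold on the events for every `n`, with a constant independent of the
  -- oracle.
  obtain ⟨n₀, hn₀⟩ := eventually_atTop.1 ((((hLtop.eventually_ge_atTop 1).and
    (hLtop.eventually_ge_atTop K')).and (hLtop.eventually_ge_atTop (lam 0))).and
    ((eventually_sqrt_log_lt_floor hb).and (eventually_ge_atTop 1)))
  have key : ∀ n, ∃ E : Set ((Fin (m n) → U) × SharedData Z (m n) n), MeasurableSet E ∧
      (n₀ ≤ n → ν n Eᶜ ≤ δ n) ∧ ∀ p ∈ E, n₀ ≤ n ∧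
        ∃ Θ : Lp ℝ 2 P → EuclideanSpace ℝ (Fin (m n)), Measurable[borel _] Θ ∧
          (∀ f, learnedNorm (Θ f) ≤ 2 ^ 50 * rkhsNorm P H (mercerProj psi (m n / 2) f)) ∧
          avgError P μ (fun u z => gbar u (Φ z)) (truncEst (A n) Ck p.2) Θ ≤
            ENNReal.ofReal (∫ u, approxBound P H psi (2 ^ 50) b (m n) n
              ((m n : ℝ) ^ (-(1 / 2) : ℝ) * ξ n) (toL2 P fun z => gbar u (Φ z)) ∂μ) ∧
          (L n < (m n : ℝ) ^ (b + 1) →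
            avgError P μ (fun u z => gbar u (Φ z)) (truncEst (A n) Ck p.2) Θ ≤
              ENNReal.ofReal (2 ^ 45 * (ξ n + (m n : ℝ) ^ (-b / 2)) * L n)) := fun n => by
    by_cases hn : n₀ ≤ n
    · obtain ⟨⟨⟨hL1, hLK⟩, hL0⟩, -⟩ := hn₀ n hn
      obtain ⟨E, hE, hEδ, h⟩ := exists_event hg hk' hM hker (hm n) hb (hξ n) hK'
        (fun h0 => hres (m n) h0 fun i hi => hm n i (by omega)) (hA n) (hrisk n) (hν n) Ck hL1 hLK
        hL0
      exact ⟨E, hE, fun _ => hEδ, fun p hp => ⟨hn, h p hp⟩⟩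
    · exact ⟨∅, .empty, fun h => absurd h hn, fun p hp => absurd hp (Set.notMem_empty p)⟩
  choose E hE hEδ hEΘ using key
  refine ⟨E, hE, tendsto_measure_one_of_compl_le (fun n => (hν n).isProbabilityMeasure) hE hδ
    (eventually_atTop.2 ⟨n₀, hEδ⟩), fun n p hp => ?_⟩
  obtain ⟨hn, Θ, hΘm, hΘn, hΘe, hΘb⟩ := hEΘ n p hp
  refine ⟨Θ, hΘm, hΘn, hΘe, fun hmk _ => ?_⟩
  obtain ⟨⟨⟨hL1, -⟩, -⟩, hfloor, hn1⟩ := hn₀ n hn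
  rw [← hmk n] at hfloor
  refine (hΘb hfloor).trans (ENNReal.ofReal_le_ofReal ?_)
  have h1 := floor_rpow_neg_le hb hn1
  rw [← hmk n] at h1
  have h2 : (1 : ℝ) ≤ 2 ^ (b / 2) := Real.one_le_rpow (by norm_num) (by positivity)
  have h3 : L n ≤ Real.log n := by
    have h0 : 0 ≤ Real.log n := Real.log_natCast_nonneg n
    have h4 : L n ^ 2 = Real.log n := Real.sq_sqrt h0
    nlinarith
  have h4 : ξ n + (m n : ℝ) ^ (-b / 2) ≤
      2 ^ (b / 2) * (ξ n + (n : ℝ) ^ (-(b / (2 * (b + 1))))) := by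
    have := mul_le_mul_of_nonneg_right h2 (hξ n)
    linarith
  have h5 : 0 ≤ ξ n := hξ n
  calc 2 ^ 45 * (ξ n + (m n : ℝ) ^ (-b / 2)) * L n
      ≤ 2 ^ 45 * (2 ^ (b / 2) * (ξ n + (n : ℝ) ^ (-(b / (2 * (b + 1)))))) * Real.log n := by
        refine mul_le_mul (mul_le_mul_of_nonneg_left h4 (by norm_num)) h3 (by positivity)
          (by positivity)
    _ = _ := by ring
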